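/- Let $\mathbb K$ be a commutative ring. A (non-negatively graded) cdg-category $\mathcal C$ over $\mathbb K$ is a $\mathbb K$-linear category with a zero object, whose morphism modules are graded, $\mathrm{Hom}(E,F)=\bigoplus_{n\ge 0}\mathrm{Hom}^n(E,F)$ (compatibly with composition, identities in degree $0$), with a linear connection $\nabla:\mathrm{Hom}^n\to\mathrm{Hom}^{n+1}$ satisfying $\nabla(f\circ g)=\nabla f\circ g+(-1)^{|f|}f\circ\nabla g$, and with closed curvature elements $R_E\in\mathrm{Hom}^2(E,E)$ such that $\nabla^2 f=R_F\circ f-f\circ R_E$ for $f\in\mathrm{Hom}(E,F)$. Let $\mathcal C^0$ be the full subcategory of objects with $R_E=0$ (a dg-category). A $\mathbb Z$-graded category with such a structure and all curvatures zero is a dg-category. * $\mathcal C$ is *sufficiently Maurer–Cartan* if for all objects $E,G$ and all $d\in\mathrm{Hom}^0(E,G)$, $b\in\mathrm{Hom}^0(G,E)$ there is an object $E^a$ and an invertible $f\in\mathrm{Hom}^0(E,E^a)$ with inverse of degree $0$ such that $\nabla(f)=f\circ a$, where $a=b\circ\nabla(d)$. * Let $Z^0(\mathcal C)$ have the same objects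 as $\mathcal C$ and the closed morphisms of degree $0$. $\mathcal C$ is *split* if $Z^0(\mathcal C)$ satisfies the axioms of an abelian category except possibly the existence of binary products, and for every short exact sequence $0\to E\xrightarrow{i}F\xrightarrow{p}G\to 0$ in $Z^0(\mathcal C)$ there are (not necessarily closed) $r\in\mathrm{Hom}^0(F,E)$, $s\in\mathrm{Hom}^0(G,F)$ with $ri=1$, $ps=1$, $ir+sp=1$. * An *$A_\infty$-functor* $\mathcal F:\mathcal C\to\mathcal D$ assigns to each object $E$ an object $\mathcal F(E)$ and to composable $f_i\in\mathrm{Hom}(E_{i+1},E_i)$, $1\le i\le n$, $n\ge1$, a morphism $\mathcal F(f_1,\dots,f_n)\in\mathrm{Hom}(\mathcal F(E_{n+1}),\mathcal F(E_1))$, of degree $|f_1|+\dots+|f_n|-n+1$ for homogeneous $f_i$, multilinearly, with $\mathcal F(1_E)=1_{\mathcal F(E)}$, $\mathcal F(R_E)=R_{\mathcal F(E)}$ and $$(-1)^{|f_1|+\dots+|f_n|+1-n}\nabla\mathcal F(f_1,\dots,f_n)+\sum_{k=1}^{n-1}(-1)^{|f_{k+1}|+\dots+|f_n|-n+k+1}\mathcal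 F(f_1,\dots,f_k)\mathcal F(f_{k+1},\dots,f_n)$$ $$=\sum_{k=1}^n(-1)^{|f_k|+\dots+|f_n|-n+k}\mathcal F(\dots,\nabla f_k,\dots)+\sum_{k=1}^{n-1}(-1)^{|f_{k+1}|+\dots+|f_n|-n+k-1}\mathcal F(\dots,f_k\circ f_{k+1},\dots)+\sum_{k=1}^{n+1}(-1)^{|f_k|+\dots+|f_n|-n+k}\mathcal F(\dots,f_{k-1},R_{E_k},f_k,\dots).$$ For dg-categories the terms with $R$ vanish. $\mathcal F$ is *proper* if for $n\ge 2$, $\mathcal F(f_1,\dots,f_n)=0$ whenever the $f_i$ are homogeneous and some $|f_i|=0$. It restricts to an $A_\infty$-functor $\mathcal F^0:\mathcal C^0\to\mathcal D^0$. * An $A_\infty$-functor $\mathcal F$ of dg-categories is a *quasi-equivalence* if each $f\mapsto\mathcal F(f)$, $\mathrm{Hom}^*(E,F)\to\mathrm{Hom}^*(\mathcal F E,\mathcal F F)$, is a quasi-isomorphism and every object of the target is homotopy equivalent (isomorphic in $H^0$) to some $\mathcal F(E)$. * $\mathrm{Tw}(\mathcal C)$ has as objects pairs $(E^*,\mathbb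 E)$ of a sequence $(E^n)_{n\in\mathbb Z}$ of objects of $\mathcal C$, almost all of them zero objects, and $\mathbb E\in\bigoplus_{a+b=1,\,a\ne0}\mathrm{Hom}^{a,b}(E^*,E^*)$ with $\nabla(\mathbb E)+\mathbb E^2+R_{E}=0$. Here $\mathrm{Hom}^{a,b}(E^*,F^*)=\bigoplus_p\mathrm{Hom}^b(E^p,F^{p+a})$, $\mathrm{Hom}^n=\bigoplus_{a+b=n}\mathrm{Hom}^{a,b}$, the composite of $f$ of bidegree $(a,b)$ with $g$ of bidegree $(a',b')$ is $(-1)^{a'b}$ times the composite in $\mathcal C$, $\nabla$ and $R_E=(R_{E^n})_n$ are taken entrywise, and $d(f)=\nabla f+\mathbb F\circ f-(-1)^{|f|}f\circ\mathbb E$. * For proper $\mathcal F$, extend $\mathcal F$ linearly to such matrices of morphisms and set $\mathcal F'(f_1,\dots,f_n)=(-1)^{p_1(q_2+\dots+q_n+n)+p_2(q_3+\dots+q_n+n-1)+\dots+p_n}\mathcal F(f_1,\dots,f_n)$ for $f_i$ of bidegree $(p_i,q_i)$. Then $\mathrm{Tw}(\mathcal F)(E^*,\mathbb E)=\big((\mathcal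 F(E^n))_n,\ \sum_{k\ge1}\mathcal F'(\mathbb E^{\otimes k})\big)$ and $\mathrm{Tw}(\mathcal F)(f_1,\dots,f_n)=\sum_{k_1,\dots,k_{n+1}\ge0}\mathcal F'(\mathbb E_1^{\otimes k_1},f_1,\mathbb E_2^{\otimes k_2},\dots,f_n,\mathbb E_{n+1}^{\otimes k_{n+1}})$ (finite sums). **Theorem.** Let $\mathcal F:\mathcal C\to\mathcal D$ be a proper $A_\infty$-functor between (non-negatively graded) cdg-categories such that both $\mathcal C$ and $\mathcal D$ are sufficiently Maurer–Cartan and split. Assume that the induced $A_\infty$-functor $\mathcal F^0:\mathcal C^0\to\mathcal D^0$ is a quasi-equivalence. Then the above formulas give objects of $\mathrm{Tw}(\mathcal D)$ and define an $A_\infty$-functor of dg-categories $\mathrm{Tw}(\mathcal F):\mathrm{Tw}(\mathcal C)\to\mathrm{Tw}(\mathcal D)$, and $\mathrm{Tw}(\mathcal F)$ is an $A_\infty$-quasi-equivalence. -/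

import Mathlib

open CategoryTheory CategoryTheory.Limits

universe w v u v₁ u₁ v₂ u₂

set_option linter.unusedSectionVars false

/-! ## Curved dg-categories -/

/-- A `ℤ`-graded curved dg-structure on a `K`-linear category: a grading of the morphism modules
compatible with identities and composition, a connection `∇` of degree `1` satisfying the graded
Leibniz rule, and for each object `X` a closed curvature endomorphism `R_X` of degree `2` with
`∇² f = R_Y ∘ f - f ∘ R_X`. (In Mathlib `f ≫ g` denotes `g ∘ f`.)
A dg-category is the case in which all curvatures vanish. -/
class CurvedDG (K : Type w) [CommRing K] (C : Type u) [Category.{v} C] [Preadditive C]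
    [Linear K C] where
  /-- `gr X Y n` is `Hom^n(X, Y)`. -/
  gr (X Y : C) : ℤ → Submodule K (X ⟶ Y)
  isInternal (X Y : C) : DirectSum.IsInternal (gr X Y)
  id_mem (X : C) : 𝟙 X ∈ gr X X 0
  comp_mem {X Y Z : C} {m n : ℤ} {f : X ⟶ Y} {g : Y ⟶ Z} (hf : f ∈ gr X Y m)
    (hg : g ∈ gr Y Z n) : f ≫ g ∈ gr X Z (m + n)
  /-- the connection, resp. the differential -/
  nabla {X Y : C} : (X ⟶ Y) →ₗ[K] (X ⟶ Y)
  nabla_mem {X Y : C} {n : ℤ} {f : X ⟶ Y} (hf : f ∈ gr X Y n) : nabla f ∈ gr X Y (n + 1)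
  leibniz {X Y Z : C} {n : ℤ} (f : X ⟶ Y) {g : Y ⟶ Z} (hg : g ∈ gr Y Z n) :
    nabla (f ≫ g) = f ≫ nabla g + n.negOnePow • (nabla f ≫ g)
  /-- the curvature -/
  curv (X : C) : X ⟶ X
  curv_mem (X : C) : curv X ∈ gr X X 2
  nabla_curv (X : C) : nabla (curv X) = 0
  nabla_nabla {X Y : C} (f : X ⟶ Y) : nabla (nabla f) = f ≫ curv Y - curv X ≫ f

/-- A (non-negatively graded) cdg-category. -/
class CDGCategory (K : Type w) [CommRing K] (C : Type u) [Category.{v} C] [Preadditive C]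
    [Linear K C] extends CurvedDG K C where
  gr_neg (X Y : C) (n : ℤ) (hn : n < 0) : gr X Y n = ⊥
  hasZeroObject : HasZeroObject C

namespace CurvedDG

section Twist

variable (K : Type w) [CommRing K] {C : Type u} [Category.{v} C] [Preadditive C] [Linear K C]
  [CurvedDG K C]

lemma bijective_coe (X Y : C) :
    Function.Bijective (DirectSum.coeLinearMap (gr (K := K) X Y)) :=
  isInternal X Y

/-- The decomposition of a morphism into its homogeneous components. -/
noncomputable def decomp (X Y : C) : (X ⟶ Y) ≃ₗ[K] DirectSum ℤ (fun d => gr (K := K) X Y d) :=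
  (LinearEquiv.ofBijective (DirectSum.coeLinearMap (gr (K := K) X Y)) (bijective_coe K X Y)).symm

/-- The projection of a morphism to its component of degree `d`. -/
noncomputable def proj {X Y : C} (d : ℤ) : (X ⟶ Y) →ₗ[K] (X ⟶ Y) :=
  (gr (K := K) X Y d).subtype ∘ₗ DirectSum.component K ℤ (fun i => gr (K := K) X Y i) d ∘ₗ
    (decomp K X Y).toLinearMap

/-- The linear map that multiplies a homogeneous morphism `f` by the sign `(-1)^{a |f|}`. -/
noncomputable def twist {X Y : C} (a : ℤ) : (X ⟶ Y) →ₗ[K] (X ⟶ Y) :=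
  DirectSum.toModule K ℤ (X ⟶ Y)
      (fun d => (a * d).negOnePow • (gr (K := K) X Y d).subtype) ∘ₗ
    (decomp K X Y).toLinearMap

variable {K}

lemma decomp_of_mem {X Y : C} {d : ℤ} {f : X ⟶ Y} (hf : f ∈ gr (K := K) X Y d) :
    decomp K X Y f = DirectSum.lof K ℤ (fun i => gr (K := K) X Y i) d ⟨f, hf⟩ := by
  rw [decomp, LinearEquiv.symm_apply_eq, LinearEquiv.ofBijective_apply,
    DirectSum.coeLinearMap_lof]

lemma twist_of_mem {X Y : C} (a : ℤ) {d : ℤ} {f : X ⟶ Y} (hf : f ∈ gr (K := K) X Y d) :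
    twist K a f = (a * d).negOnePow • f := by
  rw [twist, LinearMap.comp_apply, LinearEquiv.coe_coe, decomp_of_mem hf, DirectSum.toModule_lof]
  rfl

lemma proj_of_mem {X Y : C} {d : ℤ} {f : X ⟶ Y} (hf : f ∈ gr (K := K) X Y d) (e : ℤ) :
    proj K e f = if d = e then f else 0 := by
  rw [proj, LinearMap.comp_apply, LinearMap.comp_apply, LinearEquiv.coe_coe, decomp_of_mem hf]
  split_ifs with h
  · subst h
    rw [DirectSum.component.lof_self]
    rfl
  · rw [DirectSum.component.of, dif_neg h, map_zero]

lemma mem_iSup {X Y : C} (f : X ⟶ Y) : f ∈ ⨆ d, gr (K := K) X Y d := by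
  rw [(isInternal X Y).submodule_iSup_eq_top]; trivial

/-- Additive statements on morphisms may be checked on homogeneous ones. -/
lemma hom_induction {X Y : C} {P : (X ⟶ Y) → Prop} (f : X ⟶ Y)
    (hom : ∀ d, ∀ g ∈ gr (K := K) X Y d, P g) (add : ∀ g h, P g → P h → P (g + h)) : P f :=
  Submodule.iSup_induction _ (motive := P) (mem_iSup (K := K) f) hom
    (hom 0 0 (Submodule.zero_mem _)) add

lemma smul_mem_gr {X Y : C} {d : ℤ} {f : X ⟶ Y} (s : ℤˣ) (hf : f ∈ gr (K := K) X Y d) :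
    s • f ∈ gr (K := K) X Y d := by
  rcases Int.units_eq_one_or s with rfl | rfl
  · simpa using hf
  · simpa using hf

lemma twist_mem {X Y : C} (a : ℤ) {d : ℤ} {f : X ⟶ Y} (hf : f ∈ gr (K := K) X Y d) :
    twist K a f ∈ gr (K := K) X Y d := by
  rw [twist_of_mem a hf]; exact smul_mem_gr _ hf

lemma twist_zero {X Y : C} (f : X ⟶ Y) : twist K 0 f = f := by
  refine hom_induction (K := K) (P := fun f => twist K 0 f = f) f (fun d g hg => ?_) (fun g h hg hh => ?_)
  · simp [twist_of_mem 0 hg]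
  · rw [map_add, hg, hh]

lemma twist_twist {X Y : C} (a b : ℤ) (f : X ⟶ Y) :
    twist K a (twist K b f) = twist K (a + b) f := by
  refine hom_induction (K := K) (P := fun f => twist K a (twist K b f) = twist K (a + b) f) f (fun d g hg => ?_) (fun g h hg hh => ?_)
  · rw [twist_of_mem a (twist_mem b hg), twist_of_mem b hg, twist_of_mem _ hg, smul_smul, add_mul,
      Int.negOnePow_add]
  · simp only [map_add, hg, hh]

lemma twist_id {X : C} (a : ℤ) : twist K a (𝟙 X) = 𝟙 X := by
  simp [twist_of_mem a (id_mem (K := K) X)]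

lemma twist_curv {X : C} (a : ℤ) : twist K a (curv K X) = curv K X := by
  rw [twist_of_mem a (curv_mem (K := K) X), mul_comm]
  simp

lemma twist_comp {X Y Z : C} (a : ℤ) (f : X ⟶ Y) (g : Y ⟶ Z) :
    twist K a (f ≫ g) = twist K a f ≫ twist K a g := by
  refine hom_induction (K := K) (P := fun f => twist K a (f ≫ g) = twist K a f ≫ twist K a g) f (fun d f hf => ?_) (fun f h hf hh => ?_)
  · refine hom_induction (K := K) (P := fun g => twist K a (f ≫ g) = twist K a f ≫ twist K a g) g (fun e g hg => ?_) (fun g h hg hh => ?_)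
    · rw [twist_of_mem a (comp_mem hf hg), twist_of_mem a hf, twist_of_mem a hg, mul_add,
        Int.negOnePow_add, Linear.units_smul_comp, Linear.comp_units_smul, smul_smul]
    · simp only [Preadditive.comp_add, map_add, hg, hh]
  · simp only [Preadditive.add_comp, map_add, hf, hh]

lemma nabla_units_smul {X Y : C} (s : ℤˣ) (f : X ⟶ Y) :
    nabla (K := K) (s • f) = s • nabla (K := K) f := by
  rcases Int.units_eq_one_or s with rfl | rfl <;> simp

lemma nabla_twist {X Y : C} (a : ℤ) (f : X ⟶ Y) :
    nabla (K := K) (twist K a f) = a.negOnePow • twist K a (nabla (K := K) f) := by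
  refine hom_induction (K := K) (P := fun f => nabla (K := K) (twist K a f) = a.negOnePow • twist K a (nabla (K := K) f)) f (fun d f hf => ?_) (fun f h hf hh => ?_)
  · rw [twist_of_mem a hf, twist_of_mem a (nabla_mem hf), nabla_units_smul, smul_smul,
      ← Int.negOnePow_add, show a + a * (d + 1) = a * d + 2 * a by ring, Int.negOnePow_add,
      Int.negOnePow_two_mul, mul_one]
  · simp only [map_add, hf, hh, smul_add]

lemma leibniz' {X Y Z : C} (f : X ⟶ Y) (g : Y ⟶ Z) :
    nabla (K := K) (f ≫ g) = f ≫ nabla (K := K) g + nabla (K := K) f ≫ twist K 1 g := by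
  refine hom_induction (K := K) (P := fun g => nabla (K := K) (f ≫ g) =
    f ≫ nabla (K := K) g + nabla (K := K) f ≫ twist K 1 g) g (fun d g hg => ?_) (fun g h hg hh => ?_)
  · rw [leibniz f hg, twist_of_mem 1 hg, one_mul, Linear.comp_units_smul]
  · simp only [Preadditive.comp_add, map_add, hg, hh]
    abel

lemma nabla_id (X : C) : nabla (K := K) (𝟙 X) = 0 := by
  have h := leibniz (K := K) (𝟙 X) (id_mem X)
  simpa using h

end Twist

section Cohomology

variable (K : Type w) [CommRing K] {C : Type u} [Category.{v} C] [Preadditive C] [Linear K C]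
  [CurvedDG K C]

/-- The closed morphisms of degree `n`. -/
def cocycles (X Y : C) (n : ℤ) : Submodule K (X ⟶ Y) :=
  gr X Y n ⊓ LinearMap.ker (nabla (K := K))

/-- The exact morphisms of degree `n`. -/
def coboundaries (X Y : C) (n : ℤ) : Submodule K (X ⟶ Y) :=
  (gr X Y (n - 1)).map (nabla (K := K))

/-- Two objects of a dg-category are homotopy equivalent, that is, isomorphic in its homotopy
category `H⁰`. -/
def HomotopyEquivalent (X Y : C) : Prop :=
  ∃ f ∈ cocycles K X Y 0, ∃ g ∈ cocycles K Y X 0,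
    f ≫ g - 𝟙 X ∈ coboundaries K X X 0 ∧ g ≫ f - 𝟙 Y ∈ coboundaries K Y Y 0

end Cohomology

end CurvedDG

open CurvedDG

/-! ## Maurer-Cartan and splitting conditions -/

/-- Sufficiently Maurer-Cartan: one may twist an object `E` by every `a : E ⟶ E` of degree `1` of the
form `a = b ∘ ∇(d)`, where `d : E ⟶ G` and `b : G ⟶ E` have degree `0`. -/
def SufficientlyMaurerCartan (K : Type w) [CommRing K] (C : Type u) [Category.{v} C]
    [Preadditive C] [Linear K C] [CurvedDG K C] : Prop :=
  ∀ (E G : C) (d : E ⟶ G) (b : G ⟶ E), d ∈ gr (K := K) E G 0 → b ∈ gr (K := K) G E 0 →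
    ∃ (E' : C) (f : E ⟶ E') (g : E' ⟶ E), f ∈ gr (K := K) E E' 0 ∧ g ∈ gr (K := K) E' E 0 ∧
      f ≫ g = 𝟙 E ∧ g ≫ f = 𝟙 E' ∧ nabla (K := K) f = (nabla (K := K) d ≫ b) ≫ f

/-- The category `Z⁰(C)`: the objects of `C` with the closed morphisms of degree `0`. -/
@[ext] structure ZeroCocycleCat (K : Type w) (C : Type u) where
  of : C

namespace ZeroCocycleCat

variable {K : Type w} [CommRing K] {C : Type u} [Category.{v} C] [Preadditive C] [Linear K C]
  [CurvedDG K C]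

instance : Category.{v} (ZeroCocycleCat K C) where
  Hom X Y := cocycles K X.of Y.of 0
  id X := ⟨𝟙 X.of, id_mem X.of, nabla_id X.of⟩
  comp {X Y Z} f g := ⟨f.1 ≫ g.1, by simpa using comp_mem f.2.1 g.2.1, by
    have hf : nabla (K := K) f.1 = 0 := f.2.2
    have hg : nabla (K := K) g.1 = 0 := g.2.2
    simp [LinearMap.mem_ker, leibniz', hf, hg]⟩
  id_comp f := Subtype.ext (Category.id_comp f.1)
  comp_id f := Subtype.ext (Category.comp_id f.1)
  assoc f g h := Subtype.ext (Category.assoc f.1 g.1 h.1)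

instance : Preadditive (ZeroCocycleCat K C) where
  homGroup X Y := inferInstanceAs (AddCommGroup (cocycles K X.of Y.of 0))
  add_comp _ _ _ f f' g := Subtype.ext (Preadditive.add_comp _ _ _ f.1 f'.1 g.1)
  comp_add _ _ _ f g g' := Subtype.ext (Preadditive.comp_add _ _ _ f.1 g.1 g'.1)

end ZeroCocycleCat

/-- Quasi-abelian: `Z⁰(C)` satisfies the axioms of an abelian category, except possibly the existence
of binary products. -/
structure IsQuasiAbelian (K : Type w) [CommRing K] (C : Type u) [Category.{v} C] [Preadditive C]
    [Linear K C] [CurvedDG K C] : Prop where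
  hasZeroObject : HasZeroObject (ZeroCocycleCat K C)
  hasKernels : HasKernels (ZeroCocycleCat K C)
  hasCokernels : HasCokernels (ZeroCocycleCat K C)
  normalMono : IsNormalMonoCategory (ZeroCocycleCat K C)
  normalEpi : IsNormalEpiCategory (ZeroCocycleCat K C)

/-- Split: `C` is quasi-abelian and every short exact sequence `0 ⟶ E ⟶ F ⟶ G ⟶ 0` in `Z⁰(C)`
(`i` is a kernel of `p` and `p` is a cokernel of `i`) splits through morphisms `r : F ⟶ E` and
`s : G ⟶ F` of degree `0`, which need not be closed. -/
structure IsSplitCDG (K : Type w) [CommRing K] (C : Type u) [Category.{v} C] [Preadditive C]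
    [Linear K C] [CurvedDG K C] : Prop extends IsQuasiAbelian K C where
  split {E F G : ZeroCocycleCat K C} (i : E ⟶ F) (p : F ⟶ G) (hip : i ≫ p = 0)
    (hi : Nonempty (IsLimit (KernelFork.ofι i hip)))
    (hp : Nonempty (IsColimit (CokernelCofork.ofπ p hip))) :
    ∃ (r : F.of ⟶ E.of) (s : G.of ⟶ F.of), r ∈ gr (K := K) F.of E.of 0 ∧
      s ∈ gr (K := K) G.of F.of 0 ∧ i.1 ≫ r = 𝟙 E.of ∧ s ≫ p.1 = 𝟙 G.of ∧
      r ≫ i.1 + p.1 ≫ s = 𝟙 F.of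

/-! ## The dg-category of uncurved objects -/

/-- The objects of `C⁰`: the objects of `C` with curvature `0`. -/
structure Uncurved (K : Type w) [CommRing K] (C : Type u) [Category.{v} C] [Preadditive C]
    [Linear K C] [CurvedDG K C] where
  of : C
  curv_eq_zero : curv K of = 0

namespace Uncurved

variable {K : Type w} [CommRing K] {C : Type u} [Category.{v} C] [Preadditive C] [Linear K C]
  [CurvedDG K C]

instance : Category.{v} (Uncurved K C) where
  Hom X Y := X.of ⟶ Y.of
  id X := 𝟙 X.of
  comp f g := f ≫ g
  id_comp {X Y} f := Category.id_comp (X := X.of) (Y := Y.of) f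
  comp_id {X Y} f := Category.comp_id (X := X.of) (Y := Y.of) f
  assoc {W X Y Z} f g h := Category.assoc (W := W.of) (X := X.of) (Y := Y.of) (Z := Z.of) f g h

instance : Preadditive (Uncurved K C) where
  homGroup X Y := inferInstanceAs (AddCommGroup (X.of ⟶ Y.of))
  add_comp X Y Z f f' g := Preadditive.add_comp X.of Y.of Z.of f f' g
  comp_add X Y Z f g g' := Preadditive.comp_add X.of Y.of Z.of f g g'

instance : Linear K (Uncurved K C) where
  homModule X Y := inferInstanceAs (Module K (X.of ⟶ Y.of))
  smul_comp X Y Z r f g := Linear.smul_comp X.of Y.of Z.of r f g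
  comp_smul X Y Z f r g := Linear.comp_smul X.of Y.of Z.of f r g

/-- `C⁰` is a dg-category. -/
instance : CurvedDG K (Uncurved K C) where
  gr X Y := gr (K := K) X.of Y.of
  isInternal X Y := isInternal (K := K) X.of Y.of
  id_mem X := id_mem (K := K) X.of
  comp_mem {X Y Z} _ _ _ _ hf hg :=
    CurvedDG.comp_mem (K := K) (X := X.of) (Y := Y.of) (Z := Z.of) hf hg
  nabla {X Y} := nabla (K := K) (X := X.of) (Y := Y.of)
  nabla_mem {X Y} _ _ hf := nabla_mem (K := K) (X := X.of) (Y := Y.of) hf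
  leibniz {X Y Z} _ f _ hg := leibniz (K := K) (X := X.of) (Y := Y.of) (Z := Z.of) f hg
  curv _ := 0
  curv_mem _ := Submodule.zero_mem _
  nabla_curv _ := map_zero _
  nabla_nabla {X Y} f := by
    have h := nabla_nabla (K := K) (X := X.of) (Y := Y.of) f
    rw [X.curv_eq_zero, Y.curv_eq_zero] at h
    simpa using h

/-- The inclusion of `C⁰` into `C`, on quivers. -/
def incl : Uncurved K C ⥤q C where
  obj X := X.of
  map f := f

end Uncurved

/-! ## Bounded sequences of objects -/

/-- A sequence of objects of `C`, almost all of which are zero objects. (The ring `K` is recorded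
since the signs in the composition below depend on the grading.) -/
structure BddSeq (K : Type w) (C : Type u) [Category.{v} C] where
  X : ℤ → C
  finite : {n | ¬ IsZero (X n)}.Finite

namespace BddSeq

variable {K : Type w} [CommRing K] {C : Type u} [Category.{v} C] [Preadditive C] [Linear K C]
  [CurvedDG K C]

/-- The finite set of degrees in which `A` is not zero. -/
noncomputable def supp (A : BddSeq K C) : Finset ℤ := A.finite.toFinset

lemma isZero_of_notMem {A : BddSeq K C} {p : ℤ} (hp : p ∉ A.supp) : IsZero (A.X p) := by
  simpa [supp] using hp

/-- A morphism of bounded sequences is a matrix of morphisms `f p q : A^p ⟶ B^q`, of internal degree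
`q - p`; as almost all `A^p` and `B^q` are zero, only finitely many entries are nonzero. -/
def Mat (A B : BddSeq K C) : Type v := ∀ p q : ℤ, A.X p ⟶ B.X q

instance (A B : BddSeq K C) : AddCommGroup (Mat A B) :=
  inferInstanceAs (AddCommGroup (∀ p q : ℤ, A.X p ⟶ B.X q))

instance (A B : BddSeq K C) : Module K (Mat A B) :=
  inferInstanceAs (Module K (∀ p q : ℤ, A.X p ⟶ B.X q))

/-- The diagonal matrix with entries `φ p : A^p ⟶ A^p`. -/
def diag (A : BddSeq K C) (φ : ∀ p : ℤ, A.X p ⟶ A.X p) : Mat A A := fun p q =>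
  if h : p = q then φ p ≫ eqToHom (congrArg A.X h) else 0

lemma diag_self (A : BddSeq K C) (φ : ∀ p : ℤ, A.X p ⟶ A.X p) (p : ℤ) : diag A φ p p = φ p := by
  simp [diag]

lemma diag_ne (A : BddSeq K C) (φ : ∀ p : ℤ, A.X p ⟶ A.X p) {p q : ℤ} (h : p ≠ q) :
    diag A φ p q = 0 := by
  simp [diag, h]

/-- The composition `g ∘ f`, where for `f` of auxiliary degree `b` and `g` of internal degree `a'` the
composite in `C` is multiplied by the sign `(-1)^{a' b}`. -/
noncomputable def matComp {A B D : BddSeq K C} (f : Mat A B) (g : Mat B D) : Mat A D := fun p r =>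
  ∑ q ∈ B.supp, twist K (r - q) (f p q) ≫ g q r

lemma sum_eq_single_supp {B : BddSeq K C} {M : Type*} [AddCommMonoid M] (F : ℤ → M) (p : ℤ)
    (h0 : ∀ q, q ≠ p → F q = 0) (h1 : IsZero (B.X p) → F p = 0) : ∑ q ∈ B.supp, F q = F p :=
  Finset.sum_eq_single p (fun q _ hq => h0 q hq) (fun hp => h1 (isZero_of_notMem hp))

lemma matComp_diag {A B : BddSeq K C} (f : Mat A B) (φ : ∀ p, B.X p ⟶ B.X p) (p r : ℤ) :
    matComp f (diag B φ) p r = f p r ≫ φ r := by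
  unfold matComp
  rw [sum_eq_single_supp _ r]
  · rw [diag_self, sub_self, twist_zero]
  · intro q hq
    rw [diag_ne B φ hq, comp_zero]
  · intro h
    exact h.eq_of_tgt _ _

lemma diag_matComp {A B : BddSeq K C} (φ : ∀ p, A.X p ⟶ A.X p) (f : Mat A B) (p r : ℤ) :
    matComp (diag A φ) f p r = twist K (r - p) (φ p) ≫ f p r := by
  unfold matComp
  rw [sum_eq_single_supp _ p]
  · rw [diag_self]
  · intro q hq
    rw [diag_ne A φ (Ne.symm hq), map_zero, zero_comp]
  · intro h
    rw [h.eq_of_src (f p r) 0, comp_zero]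

noncomputable instance : Category.{v} (BddSeq K C) where
  Hom := Mat
  id A := diag A (fun p => 𝟙 (A.X p))
  comp := matComp
  id_comp f := by
    funext p r
    rw [diag_matComp, twist_id, Category.id_comp]
  comp_id f := by
    funext p r
    rw [matComp_diag, Category.comp_id]
  assoc {A B D E} f g h := by
    funext p s
    simp only [matComp, map_sum, Preadditive.sum_comp, Preadditive.comp_sum]
    rw [Finset.sum_comm]
    refine Finset.sum_congr rfl fun q _ => Finset.sum_congr rfl fun r _ => ?_
    rw [twist_comp, twist_twist, Category.assoc, sub_add_sub_cancel]

@[ext] lemma hom_ext {A B : BddSeq K C} {f g : A ⟶ B} (h : ∀ p q, f p q = g p q) : f = g :=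
  funext fun p => funext fun q => h p q

lemma id_eq (A : BddSeq K C) : 𝟙 A = diag A (fun p => 𝟙 (A.X p)) := rfl

lemma comp_eq {A B D : BddSeq K C} (f : A ⟶ B) (g : B ⟶ D) : f ≫ g = matComp f g := rfl

lemma comp_apply {A B D : BddSeq K C} (f : A ⟶ B) (g : B ⟶ D) (p r : ℤ) :
    (f ≫ g) p r = ∑ q ∈ B.supp, twist K (r - q) (f p q) ≫ g q r := rfl

noncomputable instance : Preadditive (BddSeq K C) where
  homGroup A B := inferInstanceAs (AddCommGroup (Mat A B))
  add_comp A B D f f' g := by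
    ext p r
    change ∑ q ∈ B.supp, twist K (r - q) (f p q + f' p q) ≫ g q r =
      ∑ q ∈ B.supp, twist K (r - q) (f p q) ≫ g q r +
        ∑ q ∈ B.supp, twist K (r - q) (f' p q) ≫ g q r
    simp only [map_add, Preadditive.add_comp, Finset.sum_add_distrib]
  comp_add A B D f g g' := by
    ext p r
    change ∑ q ∈ B.supp, twist K (r - q) (f p q) ≫ (g q r + g' q r) =
      ∑ q ∈ B.supp, twist K (r - q) (f p q) ≫ g q r +
        ∑ q ∈ B.supp, twist K (r - q) (f p q) ≫ g' q r
    simp only [Preadditive.comp_add, Finset.sum_add_distrib]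

noncomputable instance : Linear K (BddSeq K C) where
  homModule A B := inferInstanceAs (Module K (Mat A B))
  smul_comp A B D k f g := by
    ext p r
    change ∑ q ∈ B.supp, twist K (r - q) (k • f p q) ≫ g q r =
      k • ∑ q ∈ B.supp, twist K (r - q) (f p q) ≫ g q r
    simp only [map_smul, Linear.smul_comp, Finset.smul_sum]
  comp_smul A B D f k g := by
    ext p r
    change ∑ q ∈ B.supp, twist K (r - q) (f p q) ≫ (k • g q r) =
      k • ∑ q ∈ B.supp, twist K (r - q) (f p q) ≫ g q r
    simp only [Linear.comp_smul, Finset.smul_sum]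

/-- The morphisms of total degree `n`: the entries `A^p ⟶ B^q` have auxiliary degree
`n - (q - p)`. -/
def matGr (A B : BddSeq K C) (n : ℤ) : Submodule K (A ⟶ B) where
  carrier := {f | ∀ p q, f p q ∈ gr (K := K) (A.X p) (B.X q) (n - (q - p))}
  add_mem' hf hg p q := Submodule.add_mem _ (hf p q) (hg p q)
  zero_mem' _ _ := Submodule.zero_mem _
  smul_mem' k _ hf p q := Submodule.smul_mem _ k (hf p q)

lemma mem_matGr {A B : BddSeq K C} {n : ℤ} {f : A ⟶ B} :
    f ∈ matGr A B n ↔ ∀ p q, f p q ∈ gr (K := K) (A.X p) (B.X q) (n - (q - p)) := Iff.rfl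

/-- The evaluation of a matrix at an entry. -/
def entry (A B : BddSeq K C) (p q : ℤ) : (A ⟶ B) →ₗ[K] (A.X p ⟶ B.X q) where
  toFun f := f p q
  map_add' _ _ := rfl
  map_smul' _ _ := rfl

/-- The matrix with a single nonzero entry. -/
noncomputable def single (A B : BddSeq K C) (p q : ℤ) : (A.X p ⟶ B.X q) →ₗ[K] (A ⟶ B) :=
  (LinearMap.single K (fun p => ∀ q, A.X p ⟶ B.X q) p) ∘ₗ
    (LinearMap.single K (fun q => A.X p ⟶ B.X q) q)

lemma single_apply {A B : BddSeq K C} (p q : ℤ) (f : A.X p ⟶ B.X q) (p' q' : ℤ) :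
    single A B p q f p' q' =
      (Pi.single p (Pi.single q f) : ∀ p q : ℤ, A.X p ⟶ B.X q) p' q' := rfl

lemma single_self {A B : BddSeq K C} (p q : ℤ) (f : A.X p ⟶ B.X q) : single A B p q f p q = f := by
  rw [single_apply, Pi.single_eq_same, Pi.single_eq_same]

lemma single_ne {A B : BddSeq K C} {p q : ℤ} (f : A.X p ⟶ B.X q) {p' q' : ℤ}
    (h : ¬ (p = p' ∧ q = q')) : single A B p q f p' q' = 0 := by
  rw [single_apply]
  by_cases hp : p = p'
  · subst hp
    rw [Pi.single_eq_same, Pi.single_eq_of_ne (fun e => h ⟨rfl, e.symm⟩)]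
  · rw [Pi.single_eq_of_ne (fun e => hp e.symm)]
    rfl

lemma sum_apply {A B : BddSeq K C} {ι : Type*} (s : Finset ι) (F : ι → (A ⟶ B)) (p q : ℤ) :
    (∑ i ∈ s, F i) p q = ∑ i ∈ s, F i p q :=
  map_sum (entry A B p q) F s

lemma eq_sum_single {A B : BddSeq K C} (f : A ⟶ B) :
    f = ∑ p ∈ A.supp, ∑ q ∈ B.supp, single A B p q (f p q) := by
  ext p q
  simp only [sum_apply]
  rw [Finset.sum_eq_single p, Finset.sum_eq_single q]
  · rw [single_self]
  · intro q' _ hq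
    exact single_ne _ (fun h => hq h.2)
  · intro hq
    exact (isZero_of_notMem hq).eq_of_tgt _ _
  · intro p' _ hp
    exact Finset.sum_eq_zero fun q' _ => single_ne _ (fun h => hp h.1)
  · intro hp
    exact (isZero_of_notMem hp).eq_of_src _ _

lemma single_mem {A B : BddSeq K C} {p q d : ℤ} {f : A.X p ⟶ B.X q}
    (hf : f ∈ gr (K := K) (A.X p) (B.X q) d) : single A B p q f ∈ matGr A B (d + (q - p)) := by
  intro p' q'
  by_cases h : p = p' ∧ q = q'
  · obtain ⟨rfl, rfl⟩ := h
    rw [single_self, add_sub_cancel_right]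
    exact hf
  · rw [single_ne _ h]
    exact Submodule.zero_mem _

lemma isInternal_matGr (A B : BddSeq K C) : DirectSum.IsInternal (matGr A B) := by
  classical
  constructor
  · rw [injective_iff_map_eq_zero]
    intro x hx
    have hx' : ∑ n ∈ x.support, (x n : A ⟶ B) = 0 := by
      rw [← hx, DirectSum.coeAddMonoidHom_eq_dfinsuppSum]
      rfl
    refine DFinsupp.ext fun m => Subtype.ext ?_
    by_cases hm : m ∈ x.support
    · change (x m : A ⟶ B) = 0
      refine hom_ext fun p q => ?_
      have h := congrArg (fun f : A ⟶ B => proj K (m - (q - p)) (f p q)) hx'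
      simp only [sum_apply, map_sum] at h
      rw [Finset.sum_eq_single m] at h
      · rw [proj_of_mem ((x m).2 p q), if_pos rfl] at h
        rw [h]
        exact map_zero _
      · intro n _ hn
        rw [proj_of_mem ((x n).2 p q), if_neg]
        intro e
        exact hn (by linarith)
      · intro h'
        exact absurd hm h'
    · simp only [DFinsupp.mem_support_iff, not_not] at hm
      rw [hm]
      rfl
  · have htop : (⨆ n, matGr A B n) = ⊤ := by
      rw [eq_top_iff]
      intro f _
      rw [eq_sum_single f]
      refine Submodule.sum_mem _ fun p _ => Submodule.sum_mem _ fun q _ => ?_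
      refine hom_induction (K := K) (P := fun g => single A B p q g ∈ ⨆ n, matGr A B n) (f p q)
        (fun d g hg => Submodule.mem_iSup_of_mem _ (single_mem hg)) (fun g h hg hh => ?_)
      rw [map_add]
      exact Submodule.add_mem _ hg hh
    intro f
    have hf : f ∈ ⨆ n, matGr A B n := htop ▸ Submodule.mem_top
    rw [Submodule.iSup_eq_range_dfinsupp_lsum] at hf
    exact hf

/-- The connection acts on each entry. -/
def matNabla {A B : BddSeq K C} : (A ⟶ B) →ₗ[K] (A ⟶ B) where
  toFun f := fun p q => nabla (K := K) (f p q)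
  map_add' f g := by
    ext p q
    exact map_add (nabla (K := K)) (f p q) (g p q)
  map_smul' k f := by
    ext p q
    exact map_smul (nabla (K := K)) k (f p q)

lemma units_smul_apply {A B : BddSeq K C} (s : ℤˣ) (f : A ⟶ B) (p q : ℤ) :
    (s • f) p q = s • f p q := by
  rcases Int.units_eq_one_or s with rfl | rfl
  · simp
  · rw [Units.neg_smul, Units.neg_smul, one_smul, one_smul]
    rfl

/-- Bounded sequences of objects form a curved dg-category, with the total degree as degree, the
composition with signs, the connection of `C` on each entry, and the curvature
`(..., R_{A^{-1}}, R_{A^0}, ...)`. -/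
noncomputable instance : CurvedDG K (BddSeq K C) where
  gr := matGr
  isInternal := isInternal_matGr
  id_mem A := by
    intro p q
    by_cases h : p = q
    · subst h
      rw [id_eq, diag_self, sub_self, sub_zero]
      exact id_mem _
    · rw [id_eq, diag_ne _ _ h]
      exact Submodule.zero_mem _
  comp_mem {A B D m n f g} hf hg := by
    intro p r
    rw [comp_apply]
    refine Submodule.sum_mem _ fun q _ => ?_
    have h := CurvedDG.comp_mem (twist_mem (r - q) (hf p q)) (hg q r)
    rwa [show m - (q - p) + (n - (r - q)) = m + n - (r - p) by ring] at h
  nabla := matNabla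
  nabla_mem {A B n f} hf := by
    intro p q
    have h := nabla_mem (hf p q)
    rwa [show n - (q - p) + 1 = n + 1 - (q - p) by ring] at h
  leibniz {A B D n} f g hg := by
    ext p r
    change nabla (K := K) ((f ≫ g) p r) = (f ≫ matNabla g) p r +
      (n.negOnePow • (matNabla f ≫ g)) p r
    rw [units_smul_apply, comp_apply, comp_apply, comp_apply, map_sum, Finset.smul_sum,
      ← Finset.sum_add_distrib]
    refine Finset.sum_congr rfl fun q _ => ?_
    rw [leibniz _ (hg q r), nabla_twist, Linear.units_smul_comp, smul_smul, ← Int.negOnePow_add,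
      sub_add_cancel]
    rfl
  curv A := diag A (fun p => curv K (A.X p))
  curv_mem A := by
    intro p q
    by_cases h : p = q
    · subst h
      rw [diag_self, sub_self, sub_zero]
      exact curv_mem _
    · rw [diag_ne _ _ h]
      exact Submodule.zero_mem _
  nabla_curv A := by
    ext p q
    change nabla (K := K) (diag A (fun p => curv K (A.X p)) p q) = 0
    by_cases h : p = q
    · subst h
      rw [diag_self]
      exact nabla_curv _
    · rw [diag_ne _ _ h, map_zero]
  nabla_nabla {A B} f := by
    ext p q
    change nabla (K := K) (nabla (K := K) (f p q)) =
      matComp f (diag B fun p => curv K (B.X p)) p q -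
        matComp (diag A fun p => curv K (A.X p)) f p q
    rw [matComp_diag, diag_matComp, twist_curv]
    exact nabla_nabla (f p q)

end BddSeq

/-! ## Twisted complexes -/

/-- The conditions on an endomorphism `δ` of a bounded sequence `A` to be the differential of a
twisted complex: it has total degree `1`, its component of internal degree `0` vanishes, and
`∇(δ) + δ ∘ δ + R_A = 0`. -/
structure IsTwistedDifferential {K : Type w} [CommRing K] {C : Type u} [Category.{v} C]
    [Preadditive C] [Linear K C] [CurvedDG K C] (A : BddSeq K C) (δ : A ⟶ A) : Prop where
  mem : δ ∈ gr (K := K) A A 1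
  internal_zero (p : ℤ) : δ p p = 0
  maurerCartan : nabla (K := K) δ + δ ≫ δ + curv K A = 0

/-- An object of `Tw(C)`. -/
structure Tw (K : Type w) [CommRing K] (C : Type u) [Category.{v} C] [Preadditive C] [Linear K C]
    [CurvedDG K C] where
  seq : BddSeq K C
  δ : seq ⟶ seq
  isTwisted : IsTwistedDifferential seq δ

namespace Tw

variable {K : Type w} [CommRing K] {C : Type u} [Category.{v} C] [Preadditive C] [Linear K C]
  [CurvedDG K C]

noncomputable instance : Category.{v} (Tw K C) where
  Hom A B := A.seq ⟶ B.seq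
  id A := 𝟙 A.seq
  comp f g := f ≫ g
  id_comp {A B} f := Category.id_comp (X := A.seq) (Y := B.seq) f
  comp_id {A B} f := Category.comp_id (X := A.seq) (Y := B.seq) f
  assoc {A B D E} f g h :=
    Category.assoc (W := A.seq) (X := B.seq) (Y := D.seq) (Z := E.seq) f g h

noncomputable instance : Preadditive (Tw K C) where
  homGroup A B := inferInstanceAs (AddCommGroup (A.seq ⟶ B.seq))
  add_comp A B D f f' g := Preadditive.add_comp A.seq B.seq D.seq f f' g
  comp_add A B D f g g' := Preadditive.comp_add A.seq B.seq D.seq f g g'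

noncomputable instance : Linear K (Tw K C) where
  homModule A B := inferInstanceAs (Module K (A.seq ⟶ B.seq))
  smul_comp A B D r f g := Linear.smul_comp A.seq B.seq D.seq r f g
  comp_smul A B D f r g := Linear.comp_smul A.seq B.seq D.seq f r g

/-- The differential `d(f) = ∇(f) + δ_B ∘ f - (-1)^{|f|} f ∘ δ_A` on `Hom(A, B)`. -/
noncomputable def diff (A B : Tw K C) : (A.seq ⟶ B.seq) →ₗ[K] (A.seq ⟶ B.seq) :=
  nabla (K := K) + Linear.rightComp K A.seq B.δ - Linear.leftComp K B.seq A.δ ∘ₗ twist K 1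

lemma diff_apply (A B : Tw K C) (f : A.seq ⟶ B.seq) :
    diff A B f = nabla (K := K) f + f ≫ B.δ - A.δ ≫ twist K 1 f := rfl

lemma twist_one_δ (A : Tw K C) : twist K 1 A.δ = -A.δ := by
  rw [twist_of_mem 1 A.isTwisted.mem]
  simp

lemma twist_one_nabla {X Y : BddSeq K C} (f : X ⟶ Y) :
    twist K 1 (nabla (K := K) f) = -nabla (K := K) (twist K 1 f) := by
  rw [nabla_twist]
  simp

lemma twist_one_one {X Y : BddSeq K C} (f : X ⟶ Y) : twist K 1 (twist K 1 f) = f := by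
  refine hom_induction (K := K) (P := fun f => twist K 1 (twist K 1 f) = f) f
    (fun d f hf => ?_) (fun f h hf hh => ?_)
  · rw [twist_of_mem 1 (twist_mem 1 hf), twist_of_mem 1 hf, smul_smul, Int.units_mul_self, one_smul]
  · rw [map_add, map_add, hf, hh]

lemma diff_diff (A B : Tw K C) (f : A.seq ⟶ B.seq) : diff A B (diff A B f) = 0 := by
  have hA := A.isTwisted.maurerCartan
  have hB := B.isTwisted.maurerCartan
  have hA' : nabla (K := K) A.δ = -(A.δ ≫ A.δ) - curv K A.seq := by
    rw [← sub_eq_zero, ← hA]; abel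
  have hB' : nabla (K := K) B.δ = -(B.δ ≫ B.δ) - curv K B.seq := by
    rw [← sub_eq_zero, ← hB]; abel
  simp only [diff_apply, map_add, map_sub, leibniz', nabla_nabla, twist_comp, twist_one_δ,
    twist_one_nabla, twist_one_one, hA', hB', Preadditive.comp_sub, Preadditive.sub_comp,
    Preadditive.neg_comp, Preadditive.comp_neg,
    Category.assoc]
  abel

/-- `Tw(C)` is a dg-category. -/
noncomputable instance : CurvedDG K (Tw K C) where
  gr A B := gr (K := K) A.seq B.seq
  isInternal A B := isInternal (K := K) A.seq B.seq
  id_mem A := id_mem (K := K) A.seq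
  comp_mem {A B D} _ _ _ _ hf hg :=
    CurvedDG.comp_mem (K := K) (X := A.seq) (Y := B.seq) (Z := D.seq) hf hg
  nabla {A B} := diff A B
  nabla_mem {A B n f} hf := by
    change A.seq ⟶ B.seq at f
    change f ∈ gr (K := K) A.seq B.seq n at hf
    change diff A B f ∈ gr (K := K) A.seq B.seq (n + 1)
    rw [diff_apply]
    refine Submodule.sub_mem _ (Submodule.add_mem _ (nabla_mem hf)
      (CurvedDG.comp_mem hf B.isTwisted.mem)) ?_
    rw [add_comm n 1]
    exact CurvedDG.comp_mem A.isTwisted.mem (twist_mem 1 hf)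
  leibniz {A B D n} f g hg := by
    change A.seq ⟶ B.seq at f
    change B.seq ⟶ D.seq at g
    change g ∈ gr (K := K) B.seq D.seq n at hg
    change diff A D (f ≫ g) = f ≫ diff B D g + n.negOnePow • (diff A B f ≫ g)
    rw [diff_apply, diff_apply, diff_apply, leibniz f hg, twist_comp, twist_of_mem 1 hg, one_mul]
    simp only [Preadditive.comp_add, Preadditive.comp_sub, Preadditive.add_comp,
      Preadditive.sub_comp, Category.assoc, Linear.comp_units_smul, smul_add, smul_sub]
    abel
  curv _ := 0
  curv_mem _ := Submodule.zero_mem _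
  nabla_curv _ := map_zero _
  nabla_nabla {A B} f := by
    rw [comp_zero, zero_comp, sub_zero]
    exact diff_diff A B f

end Tw

/-! ## `A_∞`-functors -/

/-- The data of an `A_∞`-functor: an object `F(X)` for each `X`, and a morphism `F(f₁, ..., fₙ)` for
each sequence of composable morphisms. The sequence `f₁ : X₂ ⟶ X₁, ..., fₙ : Xₙ₊₁ ⟶ Xₙ` is encoded
as the path from `Xₙ₊₁` to `X₁` built by `Quiver.Path.cons`, with `f₁` as the outermost morphism. -/
structure AInftyData (C : Type u₁) [Category.{v₁} C] (D : Type u₂) [Category.{v₂} D] where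
  obj : C → D
  map {X Y : C} : Quiver.Path X Y → (obj X ⟶ obj Y)

namespace AInfty

open Quiver

section Relations

variable (K : Type w) [CommRing K] {C : Type u} [Category.{v} C] [Preadditive C] [Linear K C]
  [CurvedDG K C]

/-- The morphisms `f₁, ..., fₙ` are homogeneous of degrees `d₁, ..., dₙ`. -/
def HasDegrees {X : C} : ∀ {Y : C}, Path X Y → List ℤ → Prop
  | _, .nil, L => L = []
  | Y, .cons (b := W) P f, L =>
      ∃ (d : ℤ) (L' : List ℤ), L = d :: L' ∧ f ∈ gr (K := K) W Y d ∧ HasDegrees P L'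

/-- For the degrees `d_k, ..., d_n`, the integer `d_k + ... + d_n - n + k`. -/
def signExp (L : List ℤ) : ℤ := L.sum - L.length + 1

variable {K}

/-- `∑_{k=1}^n (-1)^{|f_k|+...+|f_n|-n+k} φ(f₁, ..., ∇ f_k, ..., fₙ)`. -/
def nablaSum {X : C} {M : Type*} [AddCommGroup M] :
    ∀ {Y : C}, Path X Y → List ℤ → (Path X Y → M) → M
  | _, .nil, _, _ => 0
  | _, .cons P f, L, φ =>
      (signExp L).negOnePow • φ (P.cons (nabla (K := K) f)) +
        nablaSum P L.tail (fun Q => φ (Q.cons f))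

/-- `∑_{k=1}^{n-1} (-1)^{|f_{k+1}|+...+|f_n|-n+k-1} φ(f₁, ..., f_k ∘ f_{k+1}, ..., fₙ)`. -/
def compSum {X : C} {M : Type*} [AddCommGroup M] :
    ∀ {Y : C}, Path X Y → List ℤ → (Path X Y → M) → M
  | _, .nil, _, _ => 0
  | _, .cons .nil _, _, _ => 0
  | _, .cons (.cons P g) f, L, φ =>
      (signExp L.tail).negOnePow • φ (P.cons (g ≫ f)) +
        compSum (P.cons g) L.tail (fun Q => φ (Q.cons f))

/-- `∑_{k=1}^{n+1} (-1)^{|f_k|+...+|f_n|-n+k} φ(f₁, ..., f_{k-1}, R, f_k, ..., fₙ)`. -/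
def curvSum {X : C} {M : Type*} [AddCommGroup M] :
    ∀ {Y : C}, Path X Y → List ℤ → (Path X Y → M) → M
  | _, .nil, L, φ => (signExp L).negOnePow • φ (Path.nil.cons (curv K X))
  | Y, .cons P f, L, φ =>
      (signExp L).negOnePow • φ ((P.cons f).cons (curv K Y)) +
        curvSum P L.tail (fun Q => φ (Q.cons f))

/-- `∑_{k=1}^n (-1)^{|f_{k+1}|+...+|f_n|-n+k+1} φ((f_{k+1}, ..., fₙ), (f₁, ..., f_k))`. -/
def splitSum {X : C} {M : Type*} [AddCommGroup M] :
    ∀ {Y : C}, Path X Y → List ℤ → (∀ {W : C}, Path X W → Path W Y → M) → M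
  | _, .nil, _, _ => 0
  | _, .cons P f, L, φ =>
      (signExp L.tail).negOnePow • φ P (Path.nil.cons f) +
        splitSum P L.tail (fun P' Q => φ P' (Q.cons f))

end Relations

end AInfty

open AInfty in
/-- The axioms of an `A_∞`-functor between curved dg-categories. By convention `F` vanishes on empty
sequences, so that the summand `k = n` of `splitSum` in the `A_∞`-relation is zero. If all curvatures
vanish, then this is an `A_∞`-functor of dg-categories in the usual sense. -/
structure AInftyData.IsAInfty (K : Type w) [CommRing K]
    {C : Type u₁} [Category.{v₁} C] [Preadditive C] [Linear K C] [CurvedDG K C]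
    {D : Type u₂} [Category.{v₂} D] [Preadditive D] [Linear K D] [CurvedDG K D]
    (F : AInftyData C D) : Prop where
  map_nil (X : C) : F.map (Quiver.Path.nil : Quiver.Path X X) = 0
  map_add {W X Y Z : C} (P : Quiver.Path W X) (Q : Quiver.Path Y Z) (f g : X ⟶ Y) :
    F.map ((P.cons (f + g)).comp Q) = F.map ((P.cons f).comp Q) + F.map ((P.cons g).comp Q)
  map_smul {W X Y Z : C} (P : Quiver.Path W X) (Q : Quiver.Path Y Z) (k : K) (f : X ⟶ Y) :
    F.map ((P.cons (k • f)).comp Q) = k • F.map ((P.cons f).comp Q)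
  /-- `F(f₁, ..., fₙ)` has degree `|f₁| + ... + |fₙ| - n + 1`. -/
  map_mem {X Y : C} (P : Quiver.Path X Y) (L : List ℤ) (hP : HasDegrees K P L) :
    F.map P ∈ gr (K := K) (F.obj X) (F.obj Y) (L.sum - L.length + 1)
  map_id (X : C) : F.map (𝟙 X : X ⟶ X).toPath = 𝟙 (F.obj X)
  map_curv (X : C) : F.map (curv K X).toPath = curv K (F.obj X)
  relation {X Y : C} (P : Quiver.Path X Y) (L : List ℤ) (hP : HasDegrees K P L)
    (hn : 0 < P.length) :
    (L.sum + 1 - L.length).negOnePow • nabla (K := K) (F.map P) +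
        splitSum P L (fun P₁ P₂ => F.map P₁ ≫ F.map P₂) =
      nablaSum (K := K) P L F.map + compSum P L F.map + curvSum (K := K) P L F.map

/-- An `A_∞`-functor between curved dg-categories. -/
structure AInftyFunctor (K : Type w) [CommRing K]
    (C : Type u₁) [Category.{v₁} C] [Preadditive C] [Linear K C] [CurvedDG K C]
    (D : Type u₂) [Category.{v₂} D] [Preadditive D] [Linear K D] [CurvedDG K D]
    extends AInftyData C D where
  isAInfty : toAInftyData.IsAInfty K

/-- An `A_∞`-functor of dg-categories (only its data is used) is quasi-fully faithful if each
`f ↦ F(f)`, `Hom(X, Y) ⟶ Hom(F(X), F(Y))`, is bijective on cohomology in every degree. -/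
structure AInftyData.IsQuasiFullyFaithful (K : Type w) [CommRing K]
    {C : Type u₁} [Category.{v₁} C] [Preadditive C] [Linear K C] [CurvedDG K C]
    {D : Type u₂} [Category.{v₂} D] [Preadditive D] [Linear K D] [CurvedDG K D]
    (F : AInftyData C D) : Prop where
  injective (X Y : C) (n : ℤ) (f : X ⟶ Y) (hf : f ∈ cocycles K X Y n)
    (h : F.map f.toPath ∈ coboundaries K (F.obj X) (F.obj Y) n) : f ∈ coboundaries K X Y n
  surjective (X Y : C) (n : ℤ) (g : F.obj X ⟶ F.obj Y)
    (hg : g ∈ cocycles K (F.obj X) (F.obj Y) n) :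
    ∃ f ∈ cocycles K X Y n, F.map f.toPath - g ∈ coboundaries K (F.obj X) (F.obj Y) n

/-- `F` is essentially surjective on homotopy categories. -/
def AInftyData.IsQuasiEssSurj (K : Type w) [CommRing K]
    {C : Type u₁} [Category.{v₁} C] {D : Type u₂} [Category.{v₂} D] [Preadditive D] [Linear K D]
    [CurvedDG K D] (F : AInftyData C D) : Prop :=
  ∀ Y : D, ∃ X : C, HomotopyEquivalent K (F.obj X) Y

/-- Quasi-equivalences of dg-categories. -/
structure AInftyData.IsQuasiEquivalence (K : Type w) [CommRing K]
    {C : Type u₁} [Category.{v₁} C] [Preadditive C] [Linear K C] [CurvedDG K C]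
    {D : Type u₂} [Category.{v₂} D] [Preadditive D] [Linear K D] [CurvedDG K D]
    (F : AInftyData C D) : Prop where
  quasiFullyFaithful : F.IsQuasiFullyFaithful K
  quasiEssSurj : F.IsQuasiEssSurj K

namespace AInfty

open Quiver

section Components

variable {K : Type w} [CommRing K] {C : Type u} [Category.{v} C] [Preadditive C] [Linear K C]
  [CurvedDG K C]

/-- The sum of `± φ` over all sequences of entries of a sequence `f₁, ..., fₙ` of composable
matrices, the source of `fₙ` being in position `p` and the target of `f₁` in position `q`. For entries
`fᵢ` of internal degrees `pᵢ` and auxiliary degrees `qᵢ` and for `t = 0`, the sign is `(-1)` to the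
power `p₁(q₂ + ... + qₙ + n) + p₂(q₃ + ... + qₙ + n - 1) + ... + pₙ`. Namely, `t` accumulates
`p₁ + ... + p_{i-1}`, the twist contributes the exponent `(p₁ + ... + p_{i-1}) qᵢ`, and the explicit
sign contributes `pᵢ (n - i + 1)`. -/
noncomputable def entrySum {A : BddSeq K C} {M : Type*} [AddCommGroup M] :
    ∀ {B : BddSeq K C}, Path A B → ∀ p q : ℤ, ℤ → (Path (A.X p) (B.X q) → M) → M
  | _, .nil, p, q, _, φ => if h : p = q then φ (h ▸ Path.nil) else 0
  | _, .cons (b := B) P f, p, q, t, φ =>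
      ∑ r ∈ B.supp, ((q - r) * (P.length + 1)).negOnePow •
        entrySum P p r (t + (q - r)) (fun Q => φ (Q.cons (twist K t (f r q))))

/-- The sequence `δ, ..., δ` of length `k`. -/
def deltaPow (A : Tw K C) : ℕ → Path A.seq A.seq
  | 0 => .nil
  | k + 1 => (deltaPow A k).cons A.δ

/-- `∑ φ(δ₁^{k₁}, f₁, δ₂^{k₂}, f₂, ..., fₙ, δₙ₊₁^{kₙ₊₁})` over all `k₁, ..., kₙ₊₁ ≥ 0`. -/
noncomputable def insertSum {A : Tw K C} {M : Type*} [AddCommGroup M] :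
    ∀ {B : Tw K C}, Path A B → (Path A.seq B.seq → M) → M
  | _, .nil, φ => ∑ᶠ k : ℕ, φ (deltaPow A k)
  | B, .cons (b := B') P f, φ =>
      ∑ᶠ k : ℕ, insertSum P (fun Q =>
        φ ((Q.cons (show B'.seq ⟶ B.seq from f)).comp (deltaPow B k)))

end Components

end AInfty

namespace AInftyFunctor

open Quiver AInfty

variable {K : Type w} [CommRing K]
  {C : Type u₁} [Category.{v₁} C] [Preadditive C] [Linear K C] [CurvedDG K C]
  {D : Type u₂} [Category.{v₂} D] [Preadditive D] [Linear K D] [CurvedDG K D]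
  (F : AInftyFunctor K C D)

/-- `F` is proper if for `n ≥ 2`, `F(f₁, ..., fₙ)` vanishes as soon as some `fᵢ` has degree `0`. -/
def IsProper : Prop :=
  ∀ {X Y : C} (P : Path X Y) (L : List ℤ), HasDegrees K P L → 2 ≤ P.length → 0 ∈ L → F.map P = 0

lemma map_zero_toPath (X Y : C) : F.map (0 : X ⟶ Y).toPath = 0 := by
  have h := F.isAInfty.map_smul (Path.nil : Path X X) (Path.nil : Path Y Y) 0 (0 : X ⟶ Y)
  rw [zero_smul, zero_smul] at h
  exact h

lemma isZero_obj {X : C} (hX : IsZero X) : IsZero (F.obj X) := by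
  rw [IsZero.iff_id_eq_zero, ← F.isAInfty.map_id, (IsZero.iff_id_eq_zero X).1 hX,
    F.map_zero_toPath]

/-- The induced functor `F⁰ : C⁰ ⟶ D⁰`. -/
def uncurved : AInftyData (Uncurved K C) (Uncurved K D) where
  obj X := ⟨F.obj X.of, by
    rw [← F.isAInfty.map_curv, X.curv_eq_zero, F.map_zero_toPath]⟩
  map P := F.map (Uncurved.incl.mapPath P)

/-- `F` applied to each term of a bounded sequence. -/
def mapSeq (A : BddSeq K C) : BddSeq K D where
  X n := F.obj (A.X n)
  finite := A.finite.subset fun _ hn h => hn (F.isZero_obj h)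

/-- The extension `F'` of `F` to sequences of composable matrices, with the signs as in
`entrySum`. -/
noncomputable def prime {A B : BddSeq K C} (P : Path A B) : F.mapSeq A ⟶ F.mapSeq B :=
  fun p q => entrySum P p q 0 (fun Q => F.map Q)

/-- `F_*(δ) = ∑_{k ≥ 1} F'(δ, ..., δ)` with `k` arguments. For proper `F` this sum and the one in
`twData` are finite. -/
noncomputable def twDelta (A : Tw K C) : F.mapSeq A.seq ⟶ F.mapSeq A.seq :=
  ∑ᶠ k : ℕ, F.prime (deltaPow A (k + 1))

/-- The data of the induced functor `Tw(F) : Tw(C) ⟶ Tw(D)`. On objects it is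
`(A, δ) ↦ (F(A), F_*(δ))`, and on sequences of composable morphisms
`Tw(F)(f₁, ..., fₙ) = ∑ F'(δ₁^{k₁}, f₁, δ₂^{k₂}, f₂, ..., fₙ, δₙ₊₁^{kₙ₊₁})`. -/
noncomputable def twData
    (h : ∀ A : Tw K C, IsTwistedDifferential (F.mapSeq A.seq) (F.twDelta A)) :
    AInftyData (Tw K C) (Tw K D) where
  obj A := ⟨F.mapSeq A.seq, F.twDelta A, h A⟩
  map {A B} P :=
    match B, P with
    | _, .nil => (0 : F.mapSeq A.seq ⟶ F.mapSeq A.seq)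
    | B, .cons Q f =>
        (insertSum (Q.cons f) (fun R => F.prime R) : F.mapSeq A.seq ⟶ F.mapSeq B.seq)

end AInftyFunctor

/-! Why `Tw(F)` exists. With suspended signs absorbed into the arrows, the A∞-relations say that the
bar differential of `F` equals `∇F` plus the sum of `F ⊗ F` over all ways to cut a path
(`relation_iff`). In this form they pass to matrices (`prime_relation`). Inserting a differential
`δ` everywhere turns the curved bar differential into that of the uncurved category `Tw`, by the
Maurer-Cartan equation (`insAll_barD`), and is compatible with cutting (`insAll_cut`). All sums are
finite: a proper `F` kills sequences of length at least 2 with an entry of degree 0, and along a run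
of `δ` the other entries strictly lower the position, which ranges over a finite set
(`entrySum_eq_zero`).

Minimal models. An entry of `δ` of internal degree `a` has auxiliary degree `1 - a`, so `a ≤ 1`
because gradings are non-negative, and `a = 0` is excluded. The part with `a = 1` is a complex in
`Z⁰`. As the category is split, this complex contracts onto its cohomology by maps of degree 0. The
contraction exhibits an exact endomorphism which is idempotent up to lower internal degree;
correcting it to an honest idempotent and splitting the complement yields a homotopy equivalent
complex whose differential strictly lowers the internal degree (`IsSplitCDG.exists_isMinimal`). The
diagonal of its Maurer-Cartan equation says that the terms are uncurved, which brings `F⁰` into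
play.

Full faithfulness. Between minimal complexes the differential on `Hom` is `∇`, and the linear part
of `Tw(F)` is that of `F` up to sign, both modulo lower internal degree. The filtration by internal
degree is finite, so the cone of `Tw(F)` is acyclic because the cones of `F⁰` are
(`IsProper.exists_primitive_of_isMinimal`). Homotopy invariance extends this from minimal complexes
to all of them.

Essential surjectivity. Homotopies in `H⁰` have degree -1 and hence vanish, so the terms of a
minimal complex over `D` are isomorphic, by closed maps, to images of objects of `C⁰`. A
differential upstairs and a closed map onto the given complex are built by descending the
filtration: the obstruction at each stage is a leading-order cocycle of the cone of `F`, hence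
removable (`IsProper.exists_lift_succ`). The resulting map is congruent to an isomorphism, hence
invertible. -/

/-! ## Functionals on paths -/

namespace AInfty

open Quiver

section PathFunctionals

variable (K : Type w) [CommRing K] {C : Type u} [Category.{v} C] [Preadditive C] [Linear K C]
  [CurvedDG K C]

/-- Multilinear functionals on paths. -/
structure MultiLin {X Y : C} {M : Type*} [AddCommGroup M] [Module K M] (φ : Path X Y → M) :
    Prop where
  add {A B : C} (P : Path X A) (Q : Path B Y) (f g : A ⟶ B) :
    φ ((P.cons (f + g)).comp Q) = φ ((P.cons f).comp Q) + φ ((P.cons g).comp Q)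
  smul {A B : C} (P : Path X A) (Q : Path B Y) (k : K) (f : A ⟶ B) :
    φ ((P.cons (k • f)).comp Q) = k • φ ((P.cons f).comp Q)

/-- The suspended sign `f ↦ (-1)^{|f| - 1} f`. -/
noncomputable def tau {X Y : C} : (X ⟶ Y) →ₗ[K] (X ⟶ Y) := -twist K 1

/-- Apply an operation to all arrows of a path. -/
def mapArrows (g : ∀ {X Y : C}, (X ⟶ Y) → (X ⟶ Y)) {X : C} : ∀ {Y : C}, Path X Y → Path X Y
  | _, .nil => .nil
  | _, .cons P f => (mapArrows g P).cons (g f)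

/-- Apply the suspended sign to all arrows of a path. -/
noncomputable def tauPath {X Y : C} (P : Path X Y) : Path X Y :=
  mapArrows (fun f => tau K f) P

variable {K}

/-- `∑_k φ(f₁, ..., f_k ∘ g, ...)` restricted to the outermost composition, with signs. -/
noncomputable def merge (K : Type w) [CommRing K] {C : Type u} [Category.{v} C] [Preadditive C]
    [Linear K C] [CurvedDG K C] {X Y Z : C} {M : Type*} [AddCommGroup M] (f : Y ⟶ Z)
    (φ : Path X Z → M) (P : Path X Y) : M :=
  match Y, P, f with
  | _, .nil, _ => 0
  | _, .cons P g, f => φ ((tauPath K P).cons (tau K g ≫ f))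

/-- The curved bar differential, applied to functionals on paths. -/
noncomputable def barD (K : Type w) [CommRing K] {C : Type u} [Category.{v} C] [Preadditive C]
    [Linear K C] [CurvedDG K C] {X : C} {M : Type*} [AddCommGroup M] :
    ∀ {Y : C}, (Path X Y → M) → Path X Y → M
  | _, φ, .nil => φ (Path.nil.cons (curv K X))
  | Y, φ, .cons P f =>
      φ ((tauPath K P).cons (nabla (K := K) (tau K f))) +
        φ (((tauPath K P).cons (tau K f)).cons (curv K Y)) + merge K f φ P +
        barD K (fun Q => φ (Q.cons f)) P

/-- The sum over all decompositions of a path into an inner and an outer part. -/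
noncomputable def cut (K : Type w) [CommRing K] {C : Type u} [Category.{v} C] [Preadditive C]
    [Linear K C] [CurvedDG K C] {X : C} {M : Type*} [AddCommGroup M] :
    ∀ {Y : C}, (∀ W : C, Path X W → Path W Y → M) → Path X Y → M
  | _, Θ, .nil => Θ _ .nil .nil
  | _, Θ, .cons P f => Θ _ (tauPath K (P.cons f)) .nil + cut K (fun W P' Q => Θ W P' (Q.cons f)) P

lemma tau_of_mem {X Y : C} {d : ℤ} {f : X ⟶ Y} (hf : f ∈ gr (K := K) X Y d) :
    tau K f = (d + 1).negOnePow • f := by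
  rw [tau, LinearMap.neg_apply, twist_of_mem 1 hf, one_mul, Int.negOnePow_succ, Units.neg_smul]

lemma tau_mem {X Y : C} {d : ℤ} {f : X ⟶ Y} (hf : f ∈ gr (K := K) X Y d) :
    tau K f ∈ gr (K := K) X Y d := by
  rw [tau_of_mem hf]; exact smul_mem_gr _ hf

lemma twist_one_twist_one {X Y : C} (f : X ⟶ Y) : twist K 1 (twist K 1 f) = f := by
  rw [twist_twist, show (1 : ℤ) + 1 = 2 by norm_num]
  refine hom_induction (K := K) (P := fun f => twist K 2 f = f) f
    (fun d f hf => ?_) (fun f h hf hh => ?_)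
  · rw [twist_of_mem 2 hf, Int.negOnePow_two_mul, one_smul]
  · rw [map_add, hf, hh]

lemma twist_one_tau {X Y : C} (f : X ⟶ Y) : twist K 1 (tau K f) = -f := by
  rw [tau, LinearMap.neg_apply, map_neg, twist_one_twist_one]

lemma tau_tau {X Y : C} (f : X ⟶ Y) : tau K (tau K f) = f := by
  rw [tau, LinearMap.neg_apply, LinearMap.neg_apply, map_neg, twist_one_twist_one, neg_neg]

lemma units_smul_eq_smul {M : Type*} [AddCommGroup M] [Module K M] (s : ℤˣ) (x : M) :
    s • x = ((s : ℤ) : K) • x := by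
  rcases Int.units_eq_one_or s with rfl | rfl <;> simp

@[simp] lemma tauPath_nil {X : C} : tauPath K (Path.nil : Path X X) = .nil := rfl

@[simp] lemma tauPath_cons {X Y Z : C} (P : Path X Y) (f : Y ⟶ Z) :
    tauPath K (P.cons f) = (tauPath K P).cons (tau K f) := rfl

lemma tauPath_comp {X Y Z : C} (P : Path X Y) (Q : Path Y Z) :
    tauPath K (P.comp Q) = (tauPath K P).comp (tauPath K Q) := by
  induction Q with
  | nil => rfl
  | cons Q f ih => rw [Path.comp_cons, tauPath_cons, ih]; rfl

@[simp] lemma length_mapArrows (g : ∀ {X Y : C}, (X ⟶ Y) → (X ⟶ Y)) {X Y : C} (P : Path X Y) :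
    (mapArrows g P).length = P.length := by
  induction P with
  | nil => rfl
  | cons P f ih => rw [mapArrows, Path.length_cons, Path.length_cons, ih]

@[simp] lemma length_tauPath {X Y : C} (P : Path X Y) : (tauPath K P).length = P.length :=
  length_mapArrows _ P

namespace MultiLin

variable {X Y Z : C} {M : Type*} [AddCommGroup M] [Module K M]

lemma cons {φ : Path X Z → M} (h : MultiLin K φ) (f : Y ⟶ Z) :
    MultiLin K (fun P : Path X Y => φ (P.cons f)) where
  add P Q a b := h.add P (Q.cons f) a b
  smul P Q k a := h.smul P (Q.cons f) k a

/-- A multilinear functional as a linear map in the outermost arrow. -/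
def lastHom {φ : Path X Z → M} (h : MultiLin K φ) (P : Path X Y) : (Y ⟶ Z) →ₗ[K] M where
  toFun f := φ (P.cons f)
  map_add' f g := h.add P .nil f g
  map_smul' k f := h.smul P .nil k f

lemma cons_add {φ : Path X Z → M} (h : MultiLin K φ) (P : Path X Y) (f g : Y ⟶ Z) :
    φ (P.cons (f + g)) = φ (P.cons f) + φ (P.cons g) := h.add P .nil f g

lemma cons_zero {φ : Path X Z → M} (h : MultiLin K φ) (P : Path X Y) :
    φ (P.cons (0 : Y ⟶ Z)) = 0 := map_zero (h.lastHom P)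

lemma cons_units {φ : Path X Z → M} (h : MultiLin K φ) (P : Path X Y) (s : ℤˣ) (f : Y ⟶ Z) :
    φ (P.cons (s • f)) = s • φ (P.cons f) := by
  rw [units_smul_eq_smul (K := K), units_smul_eq_smul (K := K)]
  exact h.smul P .nil _ f

lemma cons_sum {φ : Path X Z → M} (h : MultiLin K φ) (P : Path X Y) {ι : Type*} (s : Finset ι)
    (f : ι → (Y ⟶ Z)) : φ (P.cons (∑ i ∈ s, f i)) = ∑ i ∈ s, φ (P.cons (f i)) :=
  map_sum (h.lastHom P) f s

lemma map_linear {M' : Type*} [AddCommGroup M'] [Module K M'] {φ : Path X Z → M}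
    (h : MultiLin K φ) (l : M →ₗ[K] M') : MultiLin K (fun P => l (φ P)) where
  add P Q a b := by rw [h.add, map_add]
  smul P Q k a := by rw [h.smul, map_smul]

lemma mapArrows {φ : Path X Z → M} (h : MultiLin K φ)
    (g : ∀ {X Y : C}, (X ⟶ Y) →ₗ[K] (X ⟶ Y)) :
    MultiLin K (fun P : Path X Z => φ (mapArrows (fun f => g f) P)) := by
  have key : ∀ {A B : C} (P : Path X A) (Q : Path A B), AInfty.mapArrows (fun f => g f) (P.comp Q) =
      (AInfty.mapArrows (fun f => g f) P).comp (AInfty.mapArrows (fun f => g f) Q) := by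
    intro A B P Q
    induction Q with
    | nil => rfl
    | cons Q f ih => rw [Path.comp_cons, AInfty.mapArrows, ih]; rfl
  constructor
  · intro A B P Q a b
    simp only [key, AInfty.mapArrows, map_add]
    exact h.add _ _ _ _
  · intro A B P Q k a
    simp only [key, AInfty.mapArrows, map_smul]
    exact h.smul _ _ _ _

end MultiLin

lemma signExp_cons (d : ℤ) (L : List ℤ) : signExp (d :: L) = d - 1 + signExp L := by
  simp only [signExp, List.sum_cons, List.length_cons]
  push_cast
  ring

section Homogeneous

variable {M : Type*} [AddCommGroup M] [Module K M]

/-- `tau` scales a homogeneous arrow according to its suspended degree `|f| - 1`, and these add up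
along the path. `signExp` exceeds their sum by one, whence the `+ 1`. -/
lemma map_tauPath {X Y : C} (P : Path X Y) : ∀ (L : List ℤ) {φ : Path X Y → M}, MultiLin K φ →
    HasDegrees K P L → φ (tauPath K P) = (signExp L + 1).negOnePow • φ P := by
  induction P with
  | nil =>
    rintro L φ _ rfl
    change φ Path.nil = (2 * 1 : ℤ).negOnePow • φ Path.nil
    rw [Int.negOnePow_two_mul, one_smul]
  | cons P f ih =>
    rintro _ φ hφ ⟨d, L, rfl, hf, hP⟩
    rw [tauPath_cons, ih L (hφ.cons (tau K f)) hP, tau_of_mem hf, hφ.cons_units, smul_smul,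
      ← Int.negOnePow_add, signExp_cons]
    congr 1
    rw [Int.negOnePow_eq_iff]
    exact ⟨1, by ring⟩

/-- The head `0` is a dummy degree: `compSum` reads only the tail of the list at the outermost
arrow, so the degree of `f` never enters. -/
lemma merge_eq {X Y Z : C} (f : Y ⟶ Z) {φ : Path X Z → M} (hφ : MultiLin K φ) (P : Path X Y)
    (L : List ℤ) (hP : HasDegrees K P L) :
    (compSum (P.cons f) (0 :: L) φ) =
      -merge K f φ P + compSum P L (fun Q => φ (Q.cons f)) := by
  cases P with
  | nil => simp [compSum, merge]
  | cons P g =>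
    obtain ⟨d, L, rfl, hg, hP⟩ := hP
    rw [compSum, merge, map_tauPath P L (hφ.cons _) hP, tau_of_mem hg, Linear.units_smul_comp,
      hφ.cons_units, smul_smul, ← Int.negOnePow_add, List.tail_cons, signExp_cons,
      ← Units.neg_smul, ← Int.negOnePow_succ]
    congr 2
    rw [Int.negOnePow_eq_iff]
    exact ⟨-2, by ring⟩

/-- Up to a common minus sign, each explicit sign is the effect of applying `tau` to the arrows past
which the operation is moved. `barD` applies `tau` to exactly these, so it needs no degrees. -/
lemma barD_eq {X Y : C} (P : Path X Y) : ∀ (L : List ℤ) {φ : Path X Y → M}, MultiLin K φ →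
    HasDegrees K P L → nablaSum (K := K) P L φ + compSum P L φ + curvSum (K := K) P L φ =
      -barD K φ P := by
  induction P with
  | nil =>
    rintro L φ _ rfl
    simp [nablaSum, compSum, curvSum, barD, signExp]
  | cons P f ih =>
    rintro _ φ hφ ⟨d, L, rfl, hf, hP⟩
    have h1 : compSum (P.cons f) (d :: L) φ = compSum (P.cons f) (0 :: L) φ := by
      cases P <;> rfl
    have h2 := ih L (hφ.cons f) hP
    rw [h1, merge_eq f hφ P L hP, nablaSum, curvSum, barD, List.tail_cons,
      map_tauPath P L (hφ.cons _) hP, map_tauPath P L ((hφ.cons _).cons _) hP, tau_of_mem hf,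
      nabla_units_smul, hφ.cons_units, (hφ.cons _).cons_units, smul_smul, smul_smul,
      ← Int.negOnePow_add, show signExp L + 1 + (d + 1) = signExp (d :: L) + 1 + 2 * 1 by
        rw [signExp_cons]; ring, Int.negOnePow_add, Int.negOnePow_two_mul, mul_one,
      Int.negOnePow_succ, Units.neg_smul, Units.neg_smul]
    have h3 : barD K (fun Q => φ (Q.cons f)) P = -(nablaSum (K := K) P L (fun Q => φ (Q.cons f)) +
      compSum P L (fun Q => φ (Q.cons f)) + curvSum (K := K) P L (fun Q => φ (Q.cons f))) := by
      rw [h2, neg_neg]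
    rw [h3]
    abel

/-- `splitSum` omits the cut with empty outer part, while `cut` contains it; this is the separate
first term. -/
lemma cut_eq {X Y : C} (P : Path X Y) : ∀ (L : List ℤ) {Θ : ∀ W : C, Path X W → Path W Y → M},
    (∀ (W : C) (Q : Path W Y), MultiLin K (fun P' => Θ W P' Q)) → HasDegrees K P L →
    (signExp L).negOnePow • Θ _ P .nil + splitSum P L (fun P₁ P₂ => Θ _ P₁ P₂) = -cut K Θ P := by
  induction P with
  | nil =>
    rintro L Θ _ rfl
    simp [splitSum, cut, signExp]
  | cons P f ih =>
    rintro _ Θ hΘ ⟨d, L, rfl, hf, hP⟩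
    have h := ih L (Θ := fun W P' Q => Θ W P' (Q.cons f)) (fun W Q => hΘ W (Q.cons f)) hP
    have h' := map_tauPath (P.cons f) (d :: L) (hΘ _ .nil) ⟨d, L, rfl, hf, hP⟩
    rw [splitSum, cut, h', neg_add, ← h, List.tail_cons, Int.negOnePow_succ, Units.neg_smul,
      neg_neg]

end Homogeneous

end PathFunctionals

end AInfty

/-! ## Insertion of powers of an endomorphism -/

namespace AInfty

open Quiver

section Insertion

variable {K : Type w} [CommRing K] {C : Type u} [Category.{v} C] [Preadditive C] [Linear K C]
  [CurvedDG K C] {M : Type*} [AddCommGroup M] [Module K M]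

/-- The path `δ, ..., δ` of length `k`. -/
def dpow {X : C} (δ : X ⟶ X) : ℕ → Path X X
  | 0 => .nil
  | k + 1 => (dpow δ k).cons δ

lemma dpow_add {X : C} (δ : X ⟶ X) (m n : ℕ) : (dpow δ m).comp (dpow δ n) = dpow δ (m + n) := by
  induction n with
  | zero => rfl
  | succ n ih => rw [dpow, Path.comp_cons, ih]; rfl

lemma comp_dpow_succ {X Y : C} (δ : Y ⟶ Y) (P : Path X Y) (n : ℕ) :
    P.comp (dpow δ (n + 1)) = (P.cons δ).comp (dpow δ n) := by
  rw [add_comm, ← dpow_add, ← Path.comp_assoc]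
  rfl

/-- An endomorphism of degree 1 has suspended degree 0. Inserting copies of it therefore produces no
signs. -/
lemma tauPath_dpow {X : C} {δ : X ⟶ X} (hδ : tau K δ = δ) (n : ℕ) :
    tauPath K (dpow δ n) = dpow δ n := by
  induction n with
  | zero => rfl
  | succ n ih => rw [dpow, tauPath_cons, ih, hδ]

/-- Functionals that vanish on all paths with sufficiently many consecutive entries `δ`, for each `δ`
with the property `Δ`. -/
def IsNil (Δ : ∀ X : C, (X ⟶ X) → Prop) {X Y : C} (φ : Path X Y → M) : Prop :=
  ∀ ⦃Z : C⦄ (δ : Z ⟶ Z), Δ Z δ → ∃ N : ℕ, ∀ n ≥ N, ∀ (P : Path X Z) (Q : Path Z Y),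
    φ ((P.comp (dpow δ n)).comp Q) = 0

/-- `∑_k φ(δ, ..., δ, f₁, ..., fₙ)`, with `k` arguments `δ`. -/
noncomputable def ins {X Y : C} (δ : Y ⟶ Y) (φ : Path X Y → M) (P : Path X Y) : M :=
  ∑ᶠ k : ℕ, φ (P.comp (dpow δ k))

variable {Δ : ∀ X : C, (X ⟶ X) → Prop}

namespace IsNil

lemma cons {X Y Z : C} {φ : Path X Z → M} (h : IsNil Δ φ) (f : Y ⟶ Z) :
    IsNil Δ (fun P : Path X Y => φ (P.cons f)) := fun _ δ hδ => by
  obtain ⟨N, hN⟩ := h δ hδ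
  exact ⟨N, fun n hn P Q => hN n hn P (Q.cons f)⟩

lemma comp_right {X Y Z : C} {φ : Path X Z → M} (h : IsNil Δ φ) (R : Path Y Z) :
    IsNil Δ (fun P : Path X Y => φ (P.comp R)) := fun _ δ hδ => by
  obtain ⟨N, hN⟩ := h δ hδ
  exact ⟨N, fun n hn P Q => by simpa only [Path.comp_assoc] using hN n hn P (Q.comp R)⟩

lemma add {X Y : C} {φ ψ : Path X Y → M} (h : IsNil Δ φ) (h' : IsNil Δ ψ) :
    IsNil Δ (fun P => φ P + ψ P) := fun _ δ hδ => by
  obtain ⟨N, hN⟩ := h δ hδ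
  obtain ⟨N', hN'⟩ := h' δ hδ
  exact ⟨max N N', fun n hn P Q => by
    beta_reduce
    rw [hN n ((le_max_left _ _).trans hn), hN' n ((le_max_right _ _).trans hn), add_zero]⟩

lemma map {M' : Type*} [AddCommGroup M'] {X Y : C} {φ : Path X Y → M} (h : IsNil Δ φ)
    (l : M →+ M') : IsNil Δ (fun P => l (φ P)) := fun _ δ hδ => by
  obtain ⟨N, hN⟩ := h δ hδ
  exact ⟨N, fun n hn P Q => by beta_reduce; rw [hN n hn, map_zero]⟩

lemma neg {X Y : C} {φ : Path X Y → M} (h : IsNil Δ φ) : IsNil Δ (fun P => -φ P) :=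
  h.map (-AddMonoidHom.id M)

lemma sub {X Y : C} {φ ψ : Path X Y → M} (h : IsNil Δ φ) (h' : IsNil Δ ψ) :
    IsNil Δ (fun P => φ P - ψ P) := by
  simpa only [sub_eq_add_neg] using h.add h'.neg

lemma sum {X Y : C} {ι : Type*} (s : Finset ι) {φ : ι → Path X Y → M}
    (h : ∀ i ∈ s, IsNil Δ (φ i)) : IsNil Δ (fun P => ∑ i ∈ s, φ i P) := by
  classical
  induction s using Finset.induction_on with
  | empty => exact fun _ _ _ => ⟨0, fun _ _ _ _ => Finset.sum_empty⟩
  | insert a s ha ih =>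
    simp only [Finset.sum_insert ha]
    exact (h a (Finset.mem_insert_self _ _)).add
      (ih fun i hi => h i (Finset.mem_insert_of_mem hi))

lemma exists_bound {X Y : C} {φ : Path X Y → M} (h : IsNil Δ φ) {δ : Y ⟶ Y} (hδ : Δ Y δ) :
    ∃ N : ℕ, ∀ n ≥ N, ∀ P : Path X Y, φ (P.comp (dpow δ n)) = 0 := by
  obtain ⟨N, hN⟩ := h δ hδ
  exact ⟨N, fun n hn P => hN n hn P .nil⟩

lemma exists_ins_eq {X Y : C} {φ : Path X Y → M} (h : IsNil Δ φ) {δ : Y ⟶ Y} (hδ : Δ Y δ) :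
    ∃ N : ℕ, ∀ n ≥ N, ∀ P : Path X Y, ins δ φ P = ∑ k ∈ Finset.range n, φ (P.comp (dpow δ k)) := by
  obtain ⟨N, hN⟩ := h.exists_bound hδ
  refine ⟨N, fun n hn P => finsum_eq_sum_of_support_subset _ fun k hk => ?_⟩
  rw [Finset.coe_range, Set.mem_Iio]
  by_contra hk'
  exact hk (hN k (hn.trans (not_lt.1 hk')) P)

lemma tauPath (hΔ : ∀ {X : C} {δ : X ⟶ X}, Δ X δ → tau K δ = δ) {X Y : C} {φ : Path X Y → M}
    (h : IsNil Δ φ) : IsNil Δ (fun P => φ (tauPath K P)) := fun _ δ hδ => by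
  obtain ⟨N, hN⟩ := h δ hδ
  refine ⟨N, fun n hn P Q => ?_⟩
  beta_reduce
  rw [tauPath_comp, tauPath_comp, tauPath_dpow (hΔ hδ)]
  exact hN n hn _ _

protected lemma ins {X Y : C} {φ : Path X Y → M} (h : IsNil Δ φ) (δ : Y ⟶ Y) :
    IsNil Δ (ins δ φ) := fun _ ε hε => by
  obtain ⟨N, hN⟩ := h ε hε
  refine ⟨N, fun n hn P Q => ?_⟩
  rw [AInfty.ins, ← finsum_zero (α := ℕ) (M := M)]
  exact finsum_congr fun k => by rw [Path.comp_assoc]; exact hN n hn _ _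

lemma ins_eq_add {X Y : C} {φ : Path X Y → M} (h : IsNil Δ φ) {δ : Y ⟶ Y} (hδ : Δ Y δ)
    (P : Path X Y) : ins δ φ P = φ P + ins δ φ (P.cons δ) := by
  obtain ⟨N, hN⟩ := h.exists_ins_eq hδ
  rw [hN (N + 1) (Nat.le_succ _), hN N le_rfl, Finset.sum_range_succ', add_comm]
  exact congrArg₂ _ rfl (Finset.sum_congr rfl fun k _ => by rw [comp_dpow_succ])

lemma ins_add {X Y : C} {φ ψ : Path X Y → M} (h : IsNil Δ φ) (h' : IsNil Δ ψ) {δ : Y ⟶ Y}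
    (hδ : Δ Y δ) (P : Path X Y) : AInfty.ins δ (fun P => φ P + ψ P) P =
      AInfty.ins δ φ P + AInfty.ins δ ψ P := by
  obtain ⟨N, hN⟩ := h.exists_ins_eq hδ
  obtain ⟨N', hN'⟩ := h'.exists_ins_eq hδ
  obtain ⟨N'', hN''⟩ := (h.add h').exists_ins_eq hδ
  rw [hN (max N (max N' N'')) (by simp), hN' (max N (max N' N'')) (by simp),
    hN'' (max N (max N' N'')) (by simp), Finset.sum_add_distrib]

lemma ins_map {M' : Type*} [AddCommGroup M'] {X Y : C} {φ : Path X Y → M} (h : IsNil Δ φ)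
    (l : M →+ M') {δ : Y ⟶ Y} (hδ : Δ Y δ) (P : Path X Y) :
    AInfty.ins δ (fun P => l (φ P)) P = l (AInfty.ins δ φ P) := by
  obtain ⟨N, hN⟩ := h.exists_ins_eq hδ
  obtain ⟨N', hN'⟩ := (h.map l).exists_ins_eq hδ
  rw [hN (max N N') (by simp), hN' (max N N') (by simp), map_sum]

/-- The insertion inverts `φ ↦ φ - φ(δ, ...)`. -/
lemma ins_eq_of_sub {X Y : C} {φ ψ : Path X Y → M} (h : IsNil Δ ψ) {δ : Y ⟶ Y} (hδ : Δ Y δ)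
    (e : ∀ P, ψ P - ψ (P.cons δ) = φ P) (P : Path X Y) : AInfty.ins δ φ P = ψ P := by
  obtain rfl : φ = fun P => ψ P - ψ (P.cons δ) := funext fun P => (e P).symm
  obtain ⟨N, hN⟩ := h.exists_bound hδ
  obtain ⟨N', hN'⟩ := (h.sub (h.cons δ)).exists_ins_eq hδ
  rw [hN' (max N N') (by simp)]
  have : ∀ k, ψ ((P.comp (dpow δ k)).cons δ) = ψ (P.comp (dpow δ (k + 1))) := fun _ => rfl
  simp only [this]
  -- The sum telescopes, and its last term vanishes by nilpotency.
  rw [Finset.sum_range_sub', hN _ (le_max_left _ _), sub_zero]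
  rfl

lemma ins_tauPath (hΔ : ∀ {X : C} {δ : X ⟶ X}, Δ X δ → tau K δ = δ) {X Y : C} {φ : Path X Y → M}
    {δ : Y ⟶ Y} (hδ : Δ Y δ) (P : Path X Y) :
    AInfty.ins δ (fun P => φ (AInfty.tauPath K P)) P = AInfty.ins δ φ (AInfty.tauPath K P) :=
  finsum_congr fun k => by beta_reduce; rw [tauPath_comp, tauPath_dpow (hΔ hδ)]

end IsNil

lemma MultiLin.ins {X Y : C} {φ : Path X Y → M} (h : MultiLin K φ) (h' : IsNil Δ φ) {δ : Y ⟶ Y}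
    (hδ : Δ Y δ) : MultiLin K (ins δ φ) := by
  obtain ⟨N, hN⟩ := h'.exists_ins_eq hδ
  have e := hN N le_rfl
  constructor
  · intro A B P Q f g
    rw [e, e, e, ← Finset.sum_add_distrib]
    exact Finset.sum_congr rfl fun k _ => by simp only [Path.comp_assoc]; exact h.add _ _ _ _
  · intro A B P Q k f
    rw [e, e, Finset.smul_sum]
    exact Finset.sum_congr rfl fun k _ => by simp only [Path.comp_assoc]; exact h.smul _ _ _ _

lemma merge_sub {X Y Z : C} (f : Y ⟶ Z) (φ ψ : Path X Z → M) (P : Path X Y) :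
    merge K f (fun Q => φ Q - ψ Q) P = merge K f φ P - merge K f ψ P := by
  cases P with
  | nil => simp [merge]
  | cons P g => rfl

lemma barD_sub {X Y : C} (P : Path X Y) : ∀ (φ ψ : Path X Y → M),
    barD K (fun Q => φ Q - ψ Q) P = barD K φ P - barD K ψ P := by
  induction P with
  | nil => intro φ ψ; rfl
  | cons P f ih =>
    intro φ ψ
    rw [barD, barD, barD, ih, merge_sub]
    abel

lemma merge_zero {X Y Z : C} (f : Y ⟶ Z) (P : Path X Y) :
    merge K f (fun _ : Path X Z => (0 : M)) P = 0 := by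
  cases P <;> rfl

lemma barD_zero {X Y : C} (P : Path X Y) : barD K (fun _ : Path X Y => (0 : M)) P = 0 := by
  induction P with
  | nil => rfl
  | cons P f ih => rw [barD, ih, merge_zero]; simp

lemma IsNil.merge (hΔ : ∀ {X : C} {δ : X ⟶ X}, Δ X δ → tau K δ = δ) {X Y Z : C} (f : Y ⟶ Z)
    {φ : Path X Z → M} (h : IsNil Δ φ) : IsNil Δ (AInfty.merge K f φ) := fun W δ hδ => by
  obtain ⟨N, hN⟩ := h δ hδ
  refine ⟨N + 1, fun n hn P Q => ?_⟩
  cases Q with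
  | nil =>
    obtain ⟨n, rfl⟩ := Nat.exists_eq_add_of_le' hn
    change φ ((AInfty.tauPath K (P.comp (dpow δ (n + N)))).cons (tau K δ ≫ f)) = 0
    rw [tauPath_comp, tauPath_dpow (hΔ hδ)]
    exact hN _ (Nat.le_add_left _ _) (AInfty.tauPath K P) (Path.nil.cons (tau K δ ≫ f))
  | cons Q g =>
    change φ ((AInfty.tauPath K ((P.comp (dpow δ n)).comp Q)).cons (tau K g ≫ f)) = 0
    rw [tauPath_comp, tauPath_comp, tauPath_dpow (hΔ hδ)]
    exact hN n ((Nat.le_succ _).trans hn) (AInfty.tauPath K P) ((AInfty.tauPath K Q).cons (tau K g ≫ f))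

/-- The bar differential alters a path at one place only, so a run of `2N + 1` arrows `δ` keeps an
unaltered run of length `N` on one side of that place. -/
lemma IsNil.barD (hΔ : ∀ {X : C} {δ : X ⟶ X}, Δ X δ → tau K δ = δ) {X Y : C}
    {φ : Path X Y → M} (h : IsNil Δ φ) : IsNil Δ (AInfty.barD K φ) := fun W δ hδ => by
  -- Arrows `δ` are peeled off the outer end and absorbed into `ψ`. After `j` of them the functional
  -- is identically zero; before that the inner run is still long enough.
  have base : ∀ (j : ℕ) {N : ℕ} {ψ : Path X W → M},
      (∀ n ≥ N, ∀ (P : Path X W) (Q : Path W W), ψ ((P.comp (dpow δ n)).comp Q) = 0) →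
      (∀ P : Path X W, ψ (P.comp (dpow δ j)) = 0) →
      ∀ n ≥ N + 1 + j, ∀ P : Path X W, AInfty.barD K ψ (P.comp (dpow δ n)) = 0 := by
    intro j
    induction j with
    | zero =>
      intro N ψ _ h0 n _ P
      rw [show ψ = fun _ => 0 from funext h0, barD_zero]
    | succ j ih =>
      intro N ψ hψ hj n hn P
      obtain ⟨n, rfl⟩ := Nat.exists_eq_add_of_le' (show 1 ≤ n by omega)
      rw [dpow, Path.comp_cons, AInfty.barD, ih (N := N) (fun n hn P Q => hψ n hn P (Q.cons δ))
        hj n (by omega), add_zero, tauPath_comp, tauPath_dpow (hΔ hδ)]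
      have h1 := hψ n (by omega) (AInfty.tauPath K P) (Path.nil.cons (nabla (K := K) (tau K δ)))
      have h2 := hψ n (by omega) (AInfty.tauPath K P) ((Path.nil.cons (tau K δ)).cons (curv K W))
      obtain ⟨n, rfl⟩ := Nat.exists_eq_add_of_le' (show 1 ≤ n by omega)
      have h3 := hψ n (by omega) (AInfty.tauPath K P) (Path.nil.cons (tau K δ ≫ δ))
      have h4 : AInfty.merge K δ ψ (P.comp (dpow δ (n + 1))) = 0 := by
        change ψ ((AInfty.tauPath K (P.comp (dpow δ n))).cons (tau K δ ≫ δ)) = 0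
        rw [tauPath_comp, tauPath_dpow (hΔ hδ)]
        exact h3
      rw [h4]
      simp only [Path.comp_cons, Path.comp_nil] at h1 h2
      rw [h1, h2, add_zero, add_zero]
  obtain ⟨N, hN⟩ := h δ hδ
  refine ⟨N + 1 + N, fun n hn P Q => ?_⟩
  induction Q with
  | nil => exact base N hN (fun P => hN N le_rfl P .nil) n hn P
  | cons Q f ih =>
    rw [Path.comp_cons, AInfty.barD, ih (h.cons f) (fun n hn P R => hN n hn P (R.cons f)), add_zero,
      tauPath_comp, tauPath_comp, tauPath_dpow (hΔ hδ)]
    have h1 := hN n (by omega) (AInfty.tauPath K P)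
      ((AInfty.tauPath K Q).cons (nabla (K := K) (tau K f)))
    have h2 := hN n (by omega) (AInfty.tauPath K P)
      (((AInfty.tauPath K Q).cons (tau K f)).cons (curv K _))
    simp only [Path.comp_cons] at h1 h2
    rw [h1, h2, add_zero, zero_add]
    cases Q with
    | nil =>
      obtain ⟨n, rfl⟩ := Nat.exists_eq_add_of_le' (show 1 ≤ n by omega)
      change φ ((AInfty.tauPath K (P.comp (dpow δ n))).cons (tau K δ ≫ f)) = 0
      rw [tauPath_comp, tauPath_dpow (hΔ hδ)]
      exact hN n (by omega) (AInfty.tauPath K P) (Path.nil.cons (tau K δ ≫ f))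
    | cons Q g =>
      change φ ((AInfty.tauPath K ((P.comp (dpow δ n)).comp Q)).cons (tau K g ≫ f)) = 0
      rw [tauPath_comp, tauPath_comp, tauPath_dpow (hΔ hδ)]
      exact hN n (by omega) (AInfty.tauPath K P) ((AInfty.tauPath K Q).cons (tau K g ≫ f))

/-- The commutator of the bar differential with the insertion of `δ`. -/
lemma IsNil.ins_barD (hΔ : ∀ {X : C} {δ : X ⟶ X}, Δ X δ → tau K δ = δ) {X Y : C}
    {φ : Path X Y → M} (h : IsNil Δ φ) (hφ : MultiLin K φ) {δ : Y ⟶ Y} (hδ : Δ Y δ)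
    (P : Path X Y) : AInfty.ins δ (AInfty.barD K φ) P =
      AInfty.barD K (AInfty.ins δ φ) P + AInfty.merge K δ (AInfty.ins δ φ) P -
        AInfty.ins δ φ ((AInfty.tauPath K P).cons (curv K Y)) +
        AInfty.ins δ (fun Q => AInfty.ins δ φ
          (Q.cons (nabla (K := K) δ + δ ≫ δ + curv K Y))) (AInfty.tauPath K P) := by
  have hS := h.ins δ
  have hSm := hφ.ins h hδ
  have hc := hS.cons (nabla (K := K) δ + δ ≫ δ + curv K Y)
  -- Since `ins δ` inverts `φ ↦ φ - φ(δ, ...)`, it suffices to subtract from the right-hand side its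
  -- value on `P.cons δ` and to recover `barD K φ P`.
  refine IsNil.ins_eq_of_sub (Δ := Δ) (((((hS.barD hΔ).add (hS.merge hΔ δ)).sub
    ((hS.cons (curv K Y)).tauPath hΔ)).add ((hc.ins δ).tauPath hΔ))) hδ (fun P => ?_) P
  have e1 : AInfty.barD K φ P = AInfty.barD K (AInfty.ins δ φ) P -
      AInfty.barD K (fun Q => AInfty.ins δ φ (Q.cons δ)) P := by
    rw [← barD_sub]
    congr 1
    funext Q
    rw [h.ins_eq_add hδ Q]
    abel
  have e2 := hc.ins_eq_add hδ (AInfty.tauPath K P)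
  rw [hSm.cons_add, hSm.cons_add] at e2
  rw [e2, e1, AInfty.barD, tauPath_cons, hΔ hδ]
  have e3 : AInfty.merge K δ (AInfty.ins δ φ) (P.cons δ) =
      AInfty.ins δ φ ((AInfty.tauPath K P).cons (δ ≫ δ)) := by
    change AInfty.ins δ φ ((AInfty.tauPath K P).cons (tau K δ ≫ δ)) = _
    rw [hΔ hδ]
  rw [e3]
  abel

/-- The bar differential of an inserted functional, on a path that ends with `f`. -/
lemma IsNil.ins_barD_cons (hΔ : ∀ {X : C} {δ : X ⟶ X}, Δ X δ → tau K δ = δ) {X Y Z : C}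
    {φ : Path X Z → M} (h : IsNil Δ φ) (hφ : MultiLin K φ) {δ : Z ⟶ Z} (hδ : Δ Z δ)
    (hMC : nabla (K := K) δ + δ ≫ δ + curv K Z = 0) (P : Path X Y) (f : Y ⟶ Z) :
    AInfty.ins δ (AInfty.barD K φ) (P.cons f) =
      AInfty.barD K (fun Q => AInfty.ins δ φ (Q.cons f)) P +
        AInfty.ins δ φ ((AInfty.tauPath K P).cons (nabla (K := K) (tau K f) + tau K f ≫ δ)) +
        AInfty.merge K f (AInfty.ins δ φ) P := by
  have hSm := hφ.ins h hδ
  rw [h.ins_barD hΔ hφ hδ, hMC, AInfty.barD, tauPath_cons, hSm.cons_add]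
  have e : AInfty.ins δ (fun Q => AInfty.ins δ φ (Q.cons (0 : Z ⟶ Z)))
      ((AInfty.tauPath K P).cons (tau K f)) = 0 := by
    simp only [hSm.cons_zero]
    exact finsum_zero
  rw [e, add_zero]
  change _ + _ + _ + _ + AInfty.ins δ φ ((AInfty.tauPath K P).cons (tau K f ≫ δ)) - _ = _
  abel

/-- If no `δ` is inserted, `f` is composed with the last arrow of the path. Otherwise it is composed
with the outermost `δ`, and the remaining copies are free. -/
lemma IsNil.ins_merge (hΔ : ∀ {X : C} {δ : X ⟶ X}, Δ X δ → tau K δ = δ) {X Y Z : C}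
    {φ : Path X Z → M} (h : IsNil Δ φ) {δ : Y ⟶ Y} (hδ : Δ Y δ) (f : Y ⟶ Z) (P : Path X Y) :
    AInfty.ins δ (AInfty.merge K f φ) P = AInfty.merge K f φ P +
      AInfty.ins δ (fun Q => φ (Q.cons (δ ≫ f))) (AInfty.tauPath K P) := by
  have hc := h.cons (δ ≫ f)
  rw [(h.merge hΔ f).ins_eq_add hδ]
  congr 1
  rw [← IsNil.ins_tauPath hΔ hδ (φ := fun Q => φ (Q.cons (δ ≫ f)))]
  refine finsum_congr fun k => ?_
  rw [← comp_dpow_succ]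
  change φ ((AInfty.tauPath K (P.comp (dpow δ k))).cons (tau K δ ≫ f)) = _
  rw [hΔ hδ]

/-! ### Insertion and decompositions of a path. -/

section Cut

variable {D : Type u₂} [Category.{v₂} D] [Preadditive D] [Linear K D] {X Y : C} {x y : D} {o : C → D}

/-- Uniform version of `IsNil`. -/
def IsNilBy (Δ : ∀ X : C, (X ⟶ X) → Prop) (N : ∀ Z : C, (Z ⟶ Z) → ℕ) {X Y : C}
    (φ : Path X Y → M) : Prop :=
  ∀ ⦃Z : C⦄ (δ : Z ⟶ Z), Δ Z δ → ∀ n ≥ N Z δ, ∀ (P : Path X Z) (Q : Path Z Y),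
    φ ((P.comp (dpow δ n)).comp Q) = 0

lemma IsNilBy.isNil {N : ∀ Z : C, (Z ⟶ Z) → ℕ} {φ : Path X Y → M} (h : IsNilBy Δ N φ) :
    IsNil Δ φ := fun _ δ hδ => ⟨_, h δ hδ⟩

lemma IsNilBy.cons {N : ∀ Z : C, (Z ⟶ Z) → ℕ} {Z : C} {φ : Path X Z → M} (h : IsNilBy Δ N φ)
    (f : Y ⟶ Z) : IsNilBy Δ N (fun P : Path X Y => φ (P.cons f)) :=
  fun _ δ hδ n hn P Q => h δ hδ n hn P (Q.cons f)

lemma IsNilBy.ins {N : ∀ Z : C, (Z ⟶ Z) → ℕ} {φ : Path X Y → M} (h : IsNilBy Δ N φ) (δ : Y ⟶ Y) :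
    IsNilBy Δ N (ins δ φ) := fun _ ε hε n hn P Q => by
  rw [AInfty.ins, ← finsum_zero (α := ℕ) (M := M)]
  exact finsum_congr fun k => by rw [Path.comp_assoc]; exact h ε hε n hn _ _

lemma cut_sub (P : Path X Y) : ∀ (Θ Θ' : ∀ W : C, Path X W → Path W Y → M),
    cut K (fun W P₁ P₂ => Θ W P₁ P₂ - Θ' W P₁ P₂) P = cut K Θ P - cut K Θ' P := by
  induction P with
  | nil => intro Θ Θ'; rfl
  | cons P f ih =>
    intro Θ Θ'
    rw [cut, cut, cut, ih]
    abel

lemma cut_zero (P : Path X Y) : cut K (fun _ _ _ => (0 : M)) P = 0 := by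
  induction P with
  | nil => rfl
  | cons P f ih => rw [cut, ih, add_zero]

/-- Cutting a run of `2N` arrows leaves a run of length `N` in one of the pieces. The bound must be
uniform, because the object at which the path is cut varies. -/
lemma IsNilBy.cut (hΔ : ∀ {X : C} {δ : X ⟶ X}, Δ X δ → tau K δ = δ)
    {N : ∀ Z : C, (Z ⟶ Z) → ℕ} {φ₁ : ∀ W, Path X W → (x ⟶ o W)} {φ₂ : ∀ W, Path W Y → (o W ⟶ y)}
    (h₁ : ∀ W, IsNilBy Δ N (φ₁ W)) (h₂ : ∀ W, IsNilBy Δ N (φ₂ W)) :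
    IsNil Δ (AInfty.cut K (fun W P Q => φ₁ W P ≫ φ₂ W Q)) := fun Z δ hδ => by
  have hP : ∀ n ≥ N Z δ, ∀ W (P : Path X Z) (Q : Path Z W),
      φ₁ W (AInfty.tauPath K ((P.comp (dpow δ n)).comp Q)) = 0 := by
    intro n hn W P Q
    rw [tauPath_comp, tauPath_comp, tauPath_dpow (hΔ hδ)]
    exact h₁ W δ hδ n hn _ _
  have base : ∀ (j : ℕ) {φ : ∀ W, Path W Z → (o W ⟶ y)},
      (∀ W (P : Path W Z), φ W (P.comp (dpow δ j)) = 0) → ∀ n ≥ N Z δ + j, ∀ P : Path X Z,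
        AInfty.cut K (fun W P Q => φ₁ W P ≫ φ W Q) (P.comp (dpow δ n)) = 0 := by
    intro j
    induction j with
    | zero =>
      intro φ h n _ P
      rw [← cut_zero (K := K) (M := (x ⟶ y)) (P.comp (dpow δ n))]
      congr 1
      funext W P Q
      rw [show φ W Q = 0 from h W Q, comp_zero]
    | succ j ih =>
      intro φ h n hn P
      obtain ⟨n, rfl⟩ := Nat.exists_eq_add_of_le' (show 1 ≤ n by omega)
      rw [dpow, Path.comp_cons, AInfty.cut, ih (φ := fun W Q => φ W (Q.cons δ)) h n (by omega),
        add_zero]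
      have := hP (n + 1) (by omega) Z P .nil
      rw [show φ₁ Z (AInfty.tauPath K ((P.comp (dpow δ n)).cons δ)) = 0 from this, zero_comp]
  refine ⟨N Z δ + N Z δ, fun n hn P Q => ?_⟩
  induction Q with
  | nil => exact base (N Z δ) (fun W P => h₂ W δ hδ _ le_rfl P .nil) n hn P
  | cons Q f ih =>
    rw [Path.comp_cons, AInfty.cut, ih (φ₂ := fun W Q => φ₂ W (Q.cons f)) (fun W => (h₂ W).cons f),
      add_zero]
    have := hP n (by omega) _ P (Q.cons f)
    rw [Path.comp_cons] at this
    rw [this, zero_comp]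

/-- A cut strictly after the end of `P` leaves at least one `δ` in the inner piece, whence the
difference, and an arbitrary number in the outer one. A cut within `P` or at its end leaves every
`δ` in the outer piece. -/
lemma ins_cut (hΔ : ∀ {X : C} {δ : X ⟶ X}, Δ X δ → tau K δ = δ)
    {N : ∀ Z : C, (Z ⟶ Z) → ℕ} {φ₁ : ∀ W, Path X W → (x ⟶ o W)} {φ₂ : ∀ W, Path W Y → (o W ⟶ y)}
    (h₁ : ∀ W, IsNilBy Δ N (φ₁ W)) (h₂ : ∀ W, IsNilBy Δ N (φ₂ W)) {δ : Y ⟶ Y} (hδ : Δ Y δ)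
    (P : Path X Y) : ins δ (cut K (fun W P Q => φ₁ W P ≫ φ₂ W Q)) P =
      (ins δ (φ₁ Y) (tauPath K P) - φ₁ Y (tauPath K P)) ≫ ins δ (φ₂ Y) .nil +
        cut K (fun W P Q => φ₁ W P ≫ ins δ (φ₂ W) Q) P := by
  have n1 := (((h₁ Y).isNil.ins δ).sub (h₁ Y).isNil).tauPath (K := K) hΔ
  refine IsNil.ins_eq_of_sub (Δ := Δ) ((n1.map (Preadditive.rightComp _
    (ins δ (φ₂ Y) .nil))).add (IsNilBy.cut hΔ h₁ fun W => (h₂ W).ins δ)) hδ (fun P => ?_) P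
  have e1 : cut K (fun W P Q => φ₁ W P ≫ φ₂ W Q) P =
      cut K (fun W P Q => φ₁ W P ≫ ins δ (φ₂ W) Q) P -
        cut K (fun W P Q => φ₁ W P ≫ ins δ (φ₂ W) (Q.cons δ)) P := by
    rw [← cut_sub]
    congr 1
    funext W P Q
    rw [(h₂ W).isNil.ins_eq_add hδ Q, ← Preadditive.comp_sub, add_sub_cancel_right]
  change ((_ : x ⟶ o Y) ≫ _ + _) - ((_ : x ⟶ o Y) ≫ _ + _) = _
  rw [e1, cut, tauPath_cons, hΔ hδ, (h₁ Y).isNil.ins_eq_add hδ (tauPath K P)]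
  simp only [Preadditive.sub_comp, Preadditive.add_comp]
  abel

end Cut

end Insertion

end AInfty

/-! ## Sums over the entries of composable matrices -/

namespace BddSeq

variable {K : Type w} [CommRing K] {C : Type u} [Category.{v} C] [Preadditive C] [Linear K C]
  [CurvedDG K C]

lemma add_apply {A B : BddSeq K C} (f g : A ⟶ B) (p q : ℤ) : (f + g) p q = f p q + g p q := rfl

lemma neg_apply {A B : BddSeq K C} (f : A ⟶ B) (p q : ℤ) : (-f) p q = -f p q := rfl

lemma sub_apply {A B : BddSeq K C} (f g : A ⟶ B) (p q : ℤ) : (f - g) p q = f p q - g p q := rfl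

lemma smul_apply {A B : BddSeq K C} (k : K) (f : A ⟶ B) (p q : ℤ) : (k • f) p q = k • f p q := rfl

lemma nabla_apply {A B : BddSeq K C} (f : A ⟶ B) (p q : ℤ) :
    nabla (K := K) f p q = nabla (K := K) (f p q) := rfl

lemma curv_eq (A : BddSeq K C) : curv K A = diag A (fun p => curv K (A.X p)) := rfl

lemma twist_apply {A B : BddSeq K C} (a : ℤ) (f : A ⟶ B) (p q : ℤ) :
    (twist K a f : A ⟶ B) p q = (a * (q - p)).negOnePow • twist K a (f p q) := by
  refine hom_induction (K := K) (P := fun f : A ⟶ B => (twist K a f : A ⟶ B) p q =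
    (a * (q - p)).negOnePow • twist K a (f p q)) f (fun d f hf => ?_) (fun f h hf hh => ?_)
  · rw [twist_of_mem a hf, units_smul_apply, twist_of_mem a (hf p q), smul_smul,
      ← Int.negOnePow_add]
    congr 2
    ring
  · rw [map_add, add_apply, hf, hh, add_apply, map_add, smul_add]

lemma tau_apply {A B : BddSeq K C} (f : A ⟶ B) (p q : ℤ) :
    AInfty.tau K f p q = (q - p).negOnePow • AInfty.tau K (f p q) := by
  rw [AInfty.tau, LinearMap.neg_apply, neg_apply, twist_apply, one_mul, AInfty.tau,
    LinearMap.neg_apply, smul_neg]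

end BddSeq

namespace AInfty

open Quiver BddSeq

section Entries

variable {K : Type w} [CommRing K] {C : Type u} [Category.{v} C] [Preadditive C] [Linear K C]
  [CurvedDG K C] {M : Type*} [AddCommGroup M] [Module K M]

lemma negOnePow_congr {a b : ℤ} (h : Even (a - b)) : a.negOnePow = b.negOnePow :=
  (Int.negOnePow_eq_iff a b).2 h

lemma tau_twist {X Y : C} (a : ℤ) (f : X ⟶ Y) : twist K a (tau K f) = tau K (twist K a f) := by
  rw [tau, LinearMap.neg_apply, LinearMap.neg_apply, map_neg, twist_twist, twist_twist, add_comm]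

lemma entrySum_add {A B : BddSeq K C} (P : Path A B) : ∀ (p q t : ℤ)
    (φ ψ : Path (A.X p) (B.X q) → M), entrySum P p q t (fun Q => φ Q + ψ Q) =
      entrySum P p q t φ + entrySum P p q t ψ := by
  induction P with
  | nil => intro p q t φ ψ; simp only [entrySum]; split_ifs <;> simp
  | cons P f ih =>
    intro p q t φ ψ
    simp only [entrySum, ← Finset.sum_add_distrib, ← smul_add]
    exact Finset.sum_congr rfl fun r _ => by rw [← ih]

lemma entrySum_zero {A B : BddSeq K C} (P : Path A B) (p q t : ℤ) :
    entrySum P p q t (fun _ => (0 : M)) = 0 := by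
  have h := entrySum_add P p q t (fun _ => (0 : M)) (fun _ => 0)
  simpa using h

lemma entrySum_map {M' : Type*} [AddCommGroup M'] {A B : BddSeq K C} (P : Path A B) :
    ∀ (p q t : ℤ) (φ : Path (A.X p) (B.X q) → M) (l : M →+ M'),
      entrySum P p q t (fun Q => l (φ Q)) = l (entrySum P p q t φ) := by
  induction P with
  | nil => intro p q t φ l; simp only [entrySum]; split_ifs <;> simp
  | cons P f ih =>
    intro p q t φ l
    rw [entrySum, entrySum, map_sum]
    refine Finset.sum_congr rfl fun r _ => ?_
    rw [ih p r _ (fun Q => φ (Q.cons (twist K t (f r q)))) l]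
    rcases Int.units_eq_one_or ((q - r) * (P.length + 1)).negOnePow with h | h <;> simp [h]

lemma entrySum_units {A B : BddSeq K C} (P : Path A B) (p q t : ℤ)
    (φ : Path (A.X p) (B.X q) → M) (s : ℤˣ) :
    entrySum P p q t (fun Q => s • φ Q) = s • entrySum P p q t φ :=
  entrySum_map P p q t φ (DistribSMul.toAddMonoidHom M s)

/-- Only paths of entries of the same length and the correct degrees contribute. -/
lemma entrySum_congr {A B : BddSeq K C} (P : Path A B) : ∀ (L : List ℤ) (_ : HasDegrees K P L)
    (p q t : ℤ) {φ ψ : Path (A.X p) (B.X q) → M}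
    (_ : ∀ Q L', HasDegrees K Q L' → Q.length = P.length → L'.sum = L.sum - (q - p) →
      L'.length = L.length → φ Q = ψ Q), entrySum P p q t φ = entrySum P p q t ψ := by
  induction P with
  | nil =>
    rintro L rfl p q t φ ψ h
    rw [entrySum, entrySum]
    split_ifs with e
    · subst e
      exact h .nil [] rfl rfl (by simp) rfl
    · rfl
  | cons P f ih =>
    rintro _ ⟨d, L, rfl, hf, hP⟩ p q t φ ψ h
    rw [entrySum, entrySum]
    refine Finset.sum_congr rfl fun r _ => ?_
    rw [ih L hP p r _ fun Q L' hQ hl hs hl' => h (Q.cons (twist K t (f r q))) ((d - (q - r)) :: L')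
      ⟨_, _, rfl, twist_mem t (hf r q), hQ⟩ (by rw [Path.length_cons, Path.length_cons, hl])
      (by rw [List.sum_cons, List.sum_cons, hs]; ring) (by simp [hl'])]

lemma entrySum_congr_length {A B : BddSeq K C} (P : Path A B) : ∀ (p q t : ℤ)
    {φ ψ : Path (A.X p) (B.X q) → M}
    (_ : ∀ Q, Q.length = P.length → φ Q = ψ Q), entrySum P p q t φ = entrySum P p q t ψ := by
  induction P with
  | nil =>
    intro p q t φ ψ h
    rw [entrySum, entrySum]
    split_ifs with e
    · subst e
      exact h .nil rfl
    · rfl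
  | cons P f ih =>
    intro p q t φ ψ h
    rw [entrySum, entrySum]
    refine Finset.sum_congr rfl fun r _ => ?_
    rw [ih p r _ fun Q hl => h _ (by rw [Path.length_cons, Path.length_cons, hl])]

/-- The normalized sum over all entries. -/
noncomputable def entryFun {A B : BddSeq K C} (p q t : ℤ) (φ : Path (A.X p) (B.X q) → M)
    (P : Path A B) : M :=
  (t * P.length).negOnePow • entrySum P p q t φ

lemma entryFun_zero_left {A B : BddSeq K C} (p q : ℤ) (φ : Path (A.X p) (B.X q) → M)
    (P : Path A B) : entryFun p q 0 φ P = entrySum P p q 0 φ := by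
  rw [entryFun, zero_mul, Int.negOnePow_zero, one_smul]

lemma entryFun_units {A B : BddSeq K C} (P : Path A B) (p q t : ℤ)
    (φ : Path (A.X p) (B.X q) → M) (s : ℤˣ) :
    entryFun p q t (fun Q => s • φ Q) P = s • entryFun p q t φ P := by
  rw [entryFun, entrySum_units, smul_comm, entryFun]

lemma entryFun_add {A B : BddSeq K C} (P : Path A B) (p q t : ℤ)
    (φ ψ : Path (A.X p) (B.X q) → M) : entryFun p q t (fun Q => φ Q + ψ Q) P =
      entryFun p q t φ P + entryFun p q t ψ P := by
  rw [entryFun, entrySum_add, smul_add]; rfl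

lemma entryFun_zero {A B : BddSeq K C} (P : Path A B) (p q t : ℤ) :
    entryFun p q t (fun _ => (0 : M)) P = 0 := by
  rw [entryFun, entrySum_zero, smul_zero]

lemma entryFun_sum {A B : BddSeq K C} (P : Path A B) (p q t : ℤ) {ι : Type*} (s : Finset ι)
    (φ : ι → Path (A.X p) (B.X q) → M) : entryFun p q t (fun Q => ∑ i ∈ s, φ i Q) P =
      ∑ i ∈ s, entryFun p q t (φ i) P := by
  classical
  induction s using Finset.induction_on with
  | empty => simpa using entryFun_zero P p q t
  | insert a s ha ih => simp only [Finset.sum_insert ha, entryFun_add, ih]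

/-- The normalizing sign `(-1)^{t·length}` is chosen so that the sign in this recursion no longer
depends on the length of the path. -/
lemma entryFun_cons {A B D : BddSeq K C} (p q t : ℤ) (φ : Path (A.X p) (D.X q) → M)
    (P : Path A B) (f : B ⟶ D) : entryFun p q t φ (P.cons f) =
      ∑ r ∈ B.supp, (t + (q - r)).negOnePow •
        entryFun p r (t + (q - r)) (fun Q => φ (Q.cons (twist K t (f r q)))) P := by
  rw [entryFun, entrySum, Finset.smul_sum]
  refine Finset.sum_congr rfl fun r _ => ?_
  rw [entryFun, smul_smul, smul_smul, ← Int.negOnePow_add, ← Int.negOnePow_add, Path.length_cons]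
  congr 2
  push_cast
  ring

lemma entryFun_nil {A : BddSeq K C} (p t : ℤ) (φ : Path (A.X p) (A.X p) → M) :
    entryFun p p t φ Path.nil = φ .nil := by
  simp [entryFun, entrySum]

lemma entryFun_nil_ne {A : BddSeq K C} {p q : ℤ} (h : p ≠ q) (t : ℤ)
    (φ : Path (A.X p) (A.X q) → M) : entryFun p q t φ Path.nil = 0 := by
  simp [entryFun, entrySum, h]

lemma multiLin_entrySum {A B : BddSeq K C} (p q t : ℤ) {φ : Path (A.X p) (B.X q) → M}
    (h : MultiLin K φ) : MultiLin K (fun P : Path A B => entrySum P p q t φ) := by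
  constructor
  · intro A' B' P Q f g
    induction Q generalizing q t with
    | nil =>
      simp only [Path.comp_nil, entrySum, ← Finset.sum_add_distrib, ← smul_add]
      refine Finset.sum_congr rfl fun r _ => ?_
      rw [← entrySum_add]
      simp only [BddSeq.add_apply, map_add, h.cons_add]
    | cons Q a ih =>
      simp only [Path.comp_cons, entrySum, ← Finset.sum_add_distrib]
      refine Finset.sum_congr rfl fun r _ => ?_
      rw [ih r _ (h.cons _), smul_add]
      simp [Path.length_comp]
  · intro A' B' P Q k f
    induction Q generalizing q t with
    | nil =>
      simp only [Path.comp_nil, entrySum, Finset.smul_sum]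
      refine Finset.sum_congr rfl fun r _ => ?_
      rw [smul_comm k]
      congr 1
      have := entrySum_map P p r (t + (q - r))
        (fun Q => φ (Q.cons (twist K t (f r q)))) (DistribSMul.toAddMonoidHom M k)
      simp only [DistribSMul.toAddMonoidHom_apply] at this
      rw [← this]
      congr 1
      funext Q
      rw [BddSeq.smul_apply, map_smul]
      exact h.smul Q .nil k _
    | cons Q a ih =>
      simp only [Path.comp_cons, entrySum, Finset.smul_sum]
      refine Finset.sum_congr rfl fun r _ => ?_
      rw [ih r _ (h.cons _), smul_comm k]
      simp [Path.length_comp]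

/-- For a matrix `tau` uses the total degree, for an entry the auxiliary one. The discrepancies are
internal degrees, which add up to `q - p` along a path. -/
lemma entryFun_tauPath {A B : BddSeq K C} (P : Path A B) : ∀ (p q t : ℤ)
    {φ : Path (A.X p) (B.X q) → M}, MultiLin K φ →
    entryFun p q t φ (tauPath K P) =
      (q - p).negOnePow • entryFun p q t (fun Q => φ (tauPath K Q)) P := by
  induction P with
  | nil =>
    intro p q t φ hφ
    by_cases h : p = q
    · subst h
      rw [tauPath_nil, entryFun_nil, entryFun_nil, sub_self, Int.negOnePow_zero, one_smul]
      rfl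
    · rw [tauPath_nil, entryFun_nil_ne h, entryFun_nil_ne h, smul_zero]
  | cons P f ih =>
    intro p q t φ hφ
    rw [tauPath_cons, entryFun_cons, entryFun_cons, Finset.smul_sum]
    refine Finset.sum_congr rfl fun r _ => ?_
    rw [ih p r _ (hφ.cons _)]
    simp only [tauPath_cons]
    have e : ∀ Q : Path (A.X p) _, φ (Q.cons (twist K t (tau K f r q))) =
        (q - r).negOnePow • φ (Q.cons (tau K (twist K t (f r q)))) := fun Q => by
      rw [BddSeq.tau_apply, ← hφ.cons_units]
      congr 2
      rw [units_smul_eq_smul (K := K), map_smul, tau_twist, units_smul_eq_smul (K := K)]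
    simp only [e]
    rw [entryFun_units, smul_smul, smul_smul, smul_smul, ← Int.negOnePow_add,
      ← Int.negOnePow_add, ← Int.negOnePow_add]
    congr 2
    ring

lemma entryFun_cons_curv {A B : BddSeq K C} (p q t : ℤ) {φ : Path (A.X p) (B.X q) → M}
    (hφ : MultiLin K φ) (P : Path A B) : entryFun p q t φ (P.cons (curv K B)) =
      t.negOnePow • entryFun p q t (fun Q => φ (Q.cons (curv K (B.X q)))) P := by
  have h0 : ∀ r, (curv K B r q = 0) → (t + (q - r)).negOnePow •
        entryFun p r (t + (q - r)) (fun Q => φ (Q.cons (twist K t (curv K B r q)))) P = 0 := by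
    intro r hr
    simp only [hr, map_zero, hφ.cons_zero]
    rw [entryFun_zero, smul_zero]
  rw [entryFun_cons, sum_eq_single_supp _ q (fun r hr => h0 r (diag_ne _ _ hr))
    (fun hz => h0 q (hz.eq_of_src _ _)), sub_self, add_zero, curv_eq, diag_self]
  simp only [twist_curv]

end Entries

end AInfty

/-! ### Compatibility of entries with the bar differential. -/

namespace AInfty

open Quiver BddSeq

section EntriesBar

variable {K : Type w} [CommRing K] {C : Type u} [Category.{v} C] [Preadditive C] [Linear K C]
  [CurvedDG K C] {M : Type*} [AddCommGroup M] [Module K M]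

lemma merge_map {M' : Type*} [AddCommGroup M'] {X Y Z : C} (f : Y ⟶ Z) (φ : Path X Z → M)
    (l : M →+ M') (P : Path X Y) : merge K f (fun Q => l (φ Q)) P = l (merge K f φ P) := by
  cases P with
  | nil => exact (map_zero l).symm
  | cons P g => rfl

lemma barD_map {M' : Type*} [AddCommGroup M'] {X Y : C} (P : Path X Y) :
    ∀ (φ : Path X Y → M) (l : M →+ M'), barD K (fun Q => l (φ Q)) P = l (barD K φ P) := by
  induction P with
  | nil => intro φ l; rfl
  | cons P f ih =>
    intro φ l
    rw [barD, barD, ih (fun Q => φ (Q.cons f)) l, merge_map, map_add, map_add, map_add]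

lemma barD_sum {X Y : C} (P : Path X Y) {ι : Type*} (s : Finset ι) (φ : ι → Path X Y → M) :
    barD K (fun Q => ∑ i ∈ s, φ i Q) P = ∑ i ∈ s, barD K (φ i) P := by
  -- The family is bundled into one functional with values in `ι → M`; summation and evaluation are
  -- then additive maps out of it.
  have h := barD_map (K := K) P (fun Q i => φ i Q) (∑ i ∈ s, Pi.evalAddMonoidHom (fun _ => M) i)
  have h' := fun i => barD_map (K := K) P (fun Q i => φ i Q) (Pi.evalAddMonoidHom (fun _ => M) i)
  simp only [AddMonoidHom.finsetSum_apply, Pi.evalAddMonoidHom_apply] at h h'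
  rw [h]
  exact Finset.sum_congr rfl fun i _ => (h' i).symm

lemma barD_units {X Y : C} (P : Path X Y) (φ : Path X Y → M) (s : ℤˣ) :
    barD K (fun Q => s • φ Q) P = s • barD K φ P :=
  barD_map P φ (DistribSMul.toAddMonoidHom M s)

lemma twist_units {X Y : C} (a : ℤ) (s : ℤˣ) (f : X ⟶ Y) :
    twist K a (s • f) = s • twist K a f := by
  rw [units_smul_eq_smul (K := K), map_smul, ← units_smul_eq_smul (K := K)]

lemma twist_nabla {X Y : C} (a : ℤ) (f : X ⟶ Y) :
    twist K a (nabla (K := K) f) = a.negOnePow • nabla (K := K) (twist K a f) := by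
  rw [nabla_twist, smul_smul, Int.units_mul_self, one_smul]

/-- The common form of two summands of `barD`: the connection, with `a = t`, and the insertion of
the curvature, with `a = 0`. -/
lemma entryFun_tauPath_cons {A B D : BddSeq K C} (p q t a : ℤ) {φ : Path (A.X p) (D.X q) → M}
    (hφ : MultiLin K φ) (P : Path A B) (g : B ⟶ D) (y : ∀ r, B.X r ⟶ D.X q)
    (hy : ∀ r, twist K t (g r q) = (q - r + a).negOnePow • y r) :
    entryFun p q t φ ((tauPath K P).cons g) = (q - p + a).negOnePow •
      ∑ r ∈ B.supp, (t + (q - r)).negOnePow •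
        entryFun p r (t + (q - r)) (fun Q => φ ((tauPath K Q).cons (y r))) P := by
  rw [entryFun_cons, Finset.smul_sum]
  refine Finset.sum_congr rfl fun r _ => ?_
  rw [entryFun_tauPath P p r _ (hφ.cons _)]
  simp only [hy, hφ.cons_units]
  rw [entryFun_units, smul_smul, smul_smul, smul_smul, ← Int.negOnePow_add,
    ← Int.negOnePow_add, ← Int.negOnePow_add]
  congr 2
  ring

/-- Expanding the product of matrices gives a sum over the middle position; the sign in that product
is the twist already carried by the inner entry on the right-hand side. -/
lemma merge_entryFun {A B D : BddSeq K C} (p q t : ℤ) {φ : Path (A.X p) (D.X q) → M}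
    (hφ : MultiLin K φ) (P : Path A B) (f : B ⟶ D) :
    merge K f (entryFun p q t φ) P = (q - p + t).negOnePow • ∑ r ∈ B.supp, (t + (q - r)).negOnePow •
      entryFun p r (t + (q - r)) (merge K (twist K t (f r q)) φ) P := by
  cases P with
  | nil =>
    rw [merge, Finset.sum_eq_zero, smul_zero]
    intro r _
    by_cases h : p = r
    · subst h
      rw [entryFun_nil, merge, smul_zero]
    · rw [entryFun_nil_ne h, smul_zero]
  | @cons B' _ P g =>
    rw [merge, entryFun_cons]
    simp only [entryFun_cons, Finset.smul_sum]
    rw [Finset.sum_comm]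
    refine Finset.sum_congr rfl fun r _ => ?_
    rw [entryFun_tauPath P p r _ (hφ.cons _)]
    have e : ∀ Q : Path (A.X p) (B'.X r), φ ((tauPath K Q).cons (twist K t ((tau K g ≫ f) r q))) =
        ∑ s ∈ B.supp, (s - r).negOnePow • merge K (twist K t (f s q)) φ
          (Q.cons (twist K (t + (q - s)) (g r s))) := fun Q => by
      rw [BddSeq.comp_apply, map_sum, hφ.cons_sum]
      refine Finset.sum_congr rfl fun s _ => ?_
      rw [merge, ← hφ.cons_units, BddSeq.tau_apply, twist_comp, twist_units, twist_units,
        Linear.units_smul_comp, twist_twist, tau_twist]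
    simp only [e]
    rw [entryFun_sum, Finset.smul_sum, Finset.smul_sum]
    refine Finset.sum_congr rfl fun s _ => ?_
    rw [entryFun_units, show t + (q - s) + (s - r) = t + (q - r) by ring]
    simp only [smul_smul, ← Int.negOnePow_add]
    congr 1
    exact negOnePow_congr ⟨s - t - q, by ring⟩

/-- The normalized sum over entries commutes with the bar differential, up to a sign. -/
lemma barD_entryFun {A B : BddSeq K C} (P : Path A B) : ∀ (p q t : ℤ)
    {φ : Path (A.X p) (B.X q) → M}, MultiLin K φ → barD K (entryFun p q t φ) P =
      (q - p + t).negOnePow • entryFun p q t (barD K φ) P := by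
  induction P with
  | nil =>
    intro p q t φ hφ
    rw [barD, entryFun_cons_curv p q t hφ]
    by_cases h : p = q
    · subst h
      rw [entryFun_nil, entryFun_nil, sub_self, zero_add, barD]
    · rw [entryFun_nil_ne h, entryFun_nil_ne h, smul_zero, smul_zero]
  | @cons B D P f ih =>
    intro p q t φ hφ
    have h1 := entryFun_tauPath_cons p q t t hφ P (nabla (K := K) (tau K f))
      (fun r => nabla (K := K) (tau K (twist K t (f r q)))) fun r => by
        rw [BddSeq.nabla_apply, BddSeq.tau_apply, nabla_units_smul, twist_units, twist_nabla,
          smul_smul, ← Int.negOnePow_add, tau_twist]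
    have h2 := entryFun_tauPath_cons p q t 0 (hφ.cons (curv K (D.X q))) P (tau K f)
      (fun r => tau K (twist K t (f r q))) fun r => by
        rw [BddSeq.tau_apply, twist_units, tau_twist, add_zero]
    rw [barD, entryFun_cons_curv p q t hφ, h1, h2, merge_entryFun p q t hφ, smul_smul,
      ← Int.negOnePow_add, show t + (q - p + 0) = q - p + t by ring, ← smul_add, ← smul_add]
    have h3 : barD K (fun Q => entryFun p q t φ (Q.cons f)) P = (q - p + t).negOnePow •
        ∑ r ∈ B.supp, (t + (q - r)).negOnePow • entryFun p r (t + (q - r))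
          (barD K (fun Q => φ (Q.cons (twist K t (f r q))))) P := by
      simp only [entryFun_cons]
      rw [barD_sum, Finset.smul_sum]
      refine Finset.sum_congr rfl fun r _ => ?_
      rw [barD_units, ih p r _ (hφ.cons _), smul_smul, smul_smul, ← Int.negOnePow_add,
        ← Int.negOnePow_add]
      congr 1
      exact negOnePow_congr ⟨0, by ring⟩
    rw [h3, ← smul_add, entryFun_cons]
    congr 1
    simp only [barD, entryFun_add, smul_add, Finset.sum_add_distrib]

end EntriesBar

end AInfty

/-! ## The `A_∞`-relations in terms of the bar differential -/

namespace AInfty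

open Quiver BddSeq

section Homogeneous

variable {K : Type w} [CommRing K] {C : Type u} [Category.{v} C] [Preadditive C] [Linear K C]
  [CurvedDG K C] {M : Type*} [AddCommGroup M] [Module K M]

lemma HasDegrees.length_eq {X Y : C} (P : Path X Y) : ∀ {L : List ℤ}, HasDegrees K P L →
    L.length = P.length := by
  induction P with
  | nil => rintro L rfl; rfl
  | cons P f ih =>
    rintro _ ⟨d, L, rfl, _, hP⟩
    rw [List.length_cons, ih hP, Path.length_cons]

/-- A multilinear functional is determined by its values on homogeneous arguments. -/
lemma MultiLin.ext_homogeneous {X Y : C} (P : Path X Y) : ∀ {φ ψ : Path X Y → M},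
    MultiLin K φ → MultiLin K ψ →
    (∀ Q L, HasDegrees K Q L → Q.length = P.length → φ Q = ψ Q) → φ P = ψ P := by
  induction P with
  | nil => intro φ ψ _ _ h; exact h .nil [] rfl rfl
  | cons P f ih =>
    intro φ ψ hφ hψ h
    refine hom_induction (K := K) (P := fun f => φ (P.cons f) = ψ (P.cons f)) f
      (fun d g hg => ?_) (fun f g hf hg => by rw [hφ.cons_add, hψ.cons_add, hf, hg])
    exact ih (hφ.cons g) (hψ.cons g) fun Q L hQ hl =>
      h (Q.cons g) (d :: L) ⟨d, L, rfl, hg, hQ⟩ (by rw [Path.length_cons, Path.length_cons, hl])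

lemma map_mapArrows_twist {X Y : C} (t : ℤ) (P : Path X Y) : ∀ (L : List ℤ) {φ : Path X Y → M},
    MultiLin K φ → HasDegrees K P L →
    φ (mapArrows (fun f => twist K t f) P) = (t * L.sum).negOnePow • φ P := by
  induction P with
  | nil =>
    rintro L φ _ rfl
    simp [mapArrows]
  | cons P f ih =>
    rintro _ φ hφ ⟨d, L, rfl, hf, hP⟩
    rw [mapArrows, ih L (hφ.cons _) hP, twist_of_mem t hf, hφ.cons_units, smul_smul,
      ← Int.negOnePow_add, List.sum_cons]
    congr 2
    ring

lemma cut_map {M' : Type*} [AddCommGroup M'] {X Y : C} (P : Path X Y) :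
    ∀ (Θ : ∀ W : C, Path X W → Path W Y → M) (l : M →+ M'),
      cut K (fun W P₁ P₂ => l (Θ W P₁ P₂)) P = l (cut K Θ P) := by
  induction P with
  | nil => intro Θ l; rfl
  | cons P f ih =>
    intro Θ l
    rw [cut, cut, ih (fun W P₁ P₂ => Θ W P₁ (P₂.cons f)) l, map_add]

lemma cut_sum {X Y : C} (P : Path X Y) {ι : Type*} (s : Finset ι)
    (Θ : ι → ∀ W : C, Path X W → Path W Y → M) :
    cut K (fun W P₁ P₂ => ∑ i ∈ s, Θ i W P₁ P₂) P = ∑ i ∈ s, cut K (Θ i) P := by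
  have h := cut_map (K := K) P (fun W P₁ P₂ i => Θ i W P₁ P₂)
    (∑ i ∈ s, Pi.evalAddMonoidHom (fun _ => M) i)
  have h' := fun i => cut_map (K := K) P (fun W P₁ P₂ i => Θ i W P₁ P₂)
    (Pi.evalAddMonoidHom (fun _ => M) i)
  simp only [AddMonoidHom.finsetSum_apply, Pi.evalAddMonoidHom_apply] at h h'
  rw [h]
  exact Finset.sum_congr rfl fun i _ => (h' i).symm

lemma cut_units {X Y : C} (P : Path X Y) (Θ : ∀ W : C, Path X W → Path W Y → M) (s : ℤˣ) :
    cut K (fun W P₁ P₂ => s • Θ W P₁ P₂) P = s • cut K Θ P :=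
  cut_map P Θ (DistribSMul.toAddMonoidHom M s)

variable {D : Type u₂} [Category.{v₂} D] [Preadditive D] [Linear K D] [CurvedDG K D]

/-- For homogeneous arguments, the `A_∞`-relation amounts to a relation without explicit signs. -/
lemma relation_iff (F : AInftyData C D)
    (hF : ∀ X Y : C, MultiLin K (fun P : Path X Y => F.map P))
    (h0 : ∀ X : C, F.map (Path.nil : Path X X) = 0) {X Y : C} (P : Path X Y) (L : List ℤ)
    (hP : HasDegrees K P L) :
    (L.sum + 1 - L.length).negOnePow • nabla (K := K) (F.map P) +
        splitSum P L (fun P₁ P₂ => F.map P₁ ≫ F.map P₂) =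
      nablaSum (K := K) P L F.map + compSum P L F.map + curvSum (K := K) P L F.map ↔
    nabla (K := K) (F.map (tauPath K P)) + cut K (fun _ P₁ P₂ => F.map P₁ ≫ F.map P₂) P =
      barD K (fun Q => F.map Q) P := by
  have h1 := cut_eq P L (Θ := fun _ P₁ P₂ => F.map P₁ ≫ F.map P₂)
    (fun W Q => (hF _ _).map_linear (Linear.rightComp K _ (F.map Q))) hP
  have h2 := barD_eq P L (hF _ _) hP
  have h3 := map_tauPath P L (hF _ _) hP
  rw [h0, comp_zero, smul_zero, zero_add] at h1
  rw [h1, h2, h3, nabla_units_smul, Int.negOnePow_succ, Units.neg_smul,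
    show L.sum + 1 - L.length = signExp L by rw [signExp]; ring, ← neg_inj, neg_add, neg_neg,
    neg_neg]

end Homogeneous

end AInfty

namespace AInftyFunctor

open Quiver AInfty BddSeq

section Prime

variable {K : Type w} [CommRing K]
  {C : Type u₁} [Category.{v₁} C] [Preadditive C] [Linear K C] [CurvedDG K C]
  {D : Type u₂} [Category.{v₂} D] [Preadditive D] [Linear K D] [CurvedDG K D]
  (F : AInftyFunctor K C D)

lemma multiLin (X Y : C) : MultiLin K (fun P : Path X Y => F.map P) :=
  ⟨F.isAInfty.map_add, F.isAInfty.map_smul⟩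

/-- `F` changes the sum of the degrees by `1 - n`, so twisting its value differs from twisting all
arguments by a sign with exponent `t(n + 1)`. -/
lemma twist_map {X Y : C} (t : ℤ) (P : Path X Y) : twist K t (F.map P) =
    (t * (P.length + 1)).negOnePow • F.map (mapArrows (fun f => twist K t f) P) := by
  have h1 : MultiLin K (fun P : Path X Y => twist K t (F.map P)) :=
    (F.multiLin X Y).map_linear (twist K t)
  have h2 : MultiLin K (fun Q : Path X Y => (t * (P.length + 1)).negOnePow •
      F.map (mapArrows (fun f => twist K t f) Q)) := by
    have := ((F.multiLin X Y).mapArrows (fun {_ _} => twist K t)).map_linear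
      ((((t * (P.length + 1)).negOnePow : ℤ) : K) • LinearMap.id)
    simpa only [LinearMap.smul_apply, LinearMap.id_apply, ← units_smul_eq_smul] using this
  refine MultiLin.ext_homogeneous P h1 h2 fun Q L hQ hl => ?_
  rw [twist_of_mem t (F.isAInfty.map_mem Q L hQ),
    map_mapArrows_twist t Q L (F.multiLin X Y) hQ, smul_smul, ← Int.negOnePow_add,
    ← hl, ← HasDegrees.length_eq Q hQ]
  congr 1
  exact negOnePow_congr ⟨-t * L.length, by ring⟩

lemma entrySum_twist {M : Type*} [AddCommGroup M] {A B : BddSeq K C} (P : Path A B) :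
    ∀ (p q t t' : ℤ) (φ : Path (A.X p) (B.X q) → M),
    entrySum P p q (t + t') φ =
      entrySum P p q t' (fun Q => φ (mapArrows (fun f => twist K t f) Q)) := by
  induction P with
  | nil =>
    intro p q t t' φ
    rw [entrySum, entrySum]
    split_ifs with h
    · subst h; rfl
    · rfl
  | cons P f ih =>
    intro p q t t' φ
    rw [entrySum, entrySum]
    refine Finset.sum_congr rfl fun r _ => ?_
    rw [show t + t' + (q - r) = t + (t' + (q - r)) by ring, ih]
    simp only [mapArrows, twist_twist]

lemma prime_apply {A B : BddSeq K C} (P : Path A B) (p q : ℤ) :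
    F.prime P p q = entryFun p q 0 (fun Q => F.map Q) P := by
  rw [entryFun_zero_left]; rfl

lemma twist_entryFun {A B : BddSeq K C} (t : ℤ) (P : Path A B) (p q : ℤ) :
    twist K t (entryFun p q 0 (fun Q => F.map Q) P) = t.negOnePow • entryFun p q t (fun Q => F.map Q) P := by
  have h1 := entrySum_map P p q 0 (fun Q => F.map Q) (twist K t).toAddMonoidHom
  have h2 := entrySum_twist P p q t 0 (fun Q => F.map Q)
  rw [add_zero] at h2
  rw [entryFun_zero_left, entryFun, h2, smul_smul, ← Int.negOnePow_add, ← entrySum_units]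
  refine h1.symm.trans (entrySum_congr_length P p q 0 fun Q hQ => ?_)
  change twist K t (F.map Q) = _
  rw [F.twist_map, hQ]
  congr 2
  ring

lemma multiLin_prime (A B : BddSeq K C) : MultiLin K (fun P : Path A B => F.prime P) where
  add P Q f g := by
    ext p q
    exact (multiLin_entrySum p q 0 (F.multiLin _ _)).add P Q f g
  smul P Q k f := by
    ext p q
    exact (multiLin_entrySum p q 0 (F.multiLin _ _)).smul P Q k f

lemma prime_nil (A : BddSeq K C) : F.prime (Path.nil : Path A A) = 0 := by
  ext p q
  refine (F.prime_apply _ p q).trans ?_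
  by_cases h : p = q
  · subst h
    exact (entryFun_nil (K := K) p 0 (fun Q => F.map Q)).trans (F.isAInfty.map_nil _)
  · exact entryFun_nil_ne (K := K) h 0 (fun Q => F.map Q)

lemma prime_mem {A B : BddSeq K C} (P : Path A B) (L : List ℤ) (hP : HasDegrees K P L) :
    F.prime P ∈ gr (K := K) (F.mapSeq A) (F.mapSeq B) (L.sum - L.length + 1) := by
  intro p q
  have key : ∀ {B : BddSeq K C} (P : Path A B) (L : List ℤ) (_ : HasDegrees K P L)
      (q t : ℤ) {y : D} (φ : Path (A.X p) (B.X q) → (F.obj (A.X p) ⟶ y)) (e : ℤ)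
      (_ : ∀ Q L', HasDegrees K Q L' → L'.sum = L.sum - (q - p) → L'.length = L.length →
        φ Q ∈ gr (K := K) _ _ e), entrySum P p q t φ ∈ gr (K := K) (F.obj (A.X p)) y e := by
    intro B P
    induction P with
    | nil =>
      rintro L rfl q t y φ e h
      rw [entrySum]
      split_ifs with e
      · subst e
        exact h .nil [] rfl (by simp) rfl
      · exact Submodule.zero_mem _
    | cons P f ih =>
      rintro _ ⟨d, L, rfl, hf, hP⟩ q t y φ e h
      rw [entrySum]
      refine Submodule.sum_mem _ fun r _ => smul_mem_gr _ (ih L hP r _ _ e fun Q L' hQ hs hl => ?_)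
      exact h (Q.cons (twist K t (f r q))) ((d - (q - r)) :: L')
        ⟨_, _, rfl, twist_mem t (hf r q), hQ⟩ (by rw [List.sum_cons, List.sum_cons, hs]; ring)
        (by simp [hl])
  refine key P L hP q 0 _ _ fun Q L' hQ hs hl => ?_
  have h := F.isAInfty.map_mem Q L' hQ
  rwa [hs, hl, show L.sum - (q - p) - (L.length : ℤ) + 1 = L.sum - L.length + 1 - (q - p) by ring]
    at h

lemma prime_toPath {A B : BddSeq K C} (f : A ⟶ B) (p q : ℤ) :
    F.prime f.toPath p q = (q - p).negOnePow • F.map (f p q).toPath := by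
  have h : ∀ r, r ≠ p → (0 + (q - r)).negOnePow • entryFun p r (0 + (q - r))
      (fun Q => F.map (Q.cons (twist K 0 (f r q)))) (Path.nil : Path A A) = 0 := fun r hr => by
    rw [entryFun_nil_ne hr.symm, smul_zero]
  have e := entryFun_cons p q 0 (fun Q : Path (A.X p) (B.X q) => F.map Q) Path.nil f
  refine (F.prime_apply _ p q).trans (e.trans ?_)
  rw [sum_eq_single_supp _ p h, entryFun_nil, twist_zero, zero_add]
  · rfl
  · intro hz
    rw [entryFun_nil, hz.eq_of_src (twist K 0 (f p q)) 0, (F.multiLin _ _).cons_zero, smul_zero]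

/-- The product of matrices sums over the position `s` at the cut; an entry path `p → s` followed by
one `s → q` is an entry path `p → q` cut at that vertex. The twist by `q - s` is the sign in the
product of matrices. The functionals `φ` and the shift `t` are arbitrary so that outer arrows can be
absorbed in the induction. -/
lemma cut_prime {A : BddSeq K C} (p : ℤ) {y : D} {B : BddSeq K C} (P : Path A B) : ∀ (q t : ℤ)
    (φ : ∀ W, Path W (B.X q) → (F.obj W ⟶ y)),
    cut K (fun W P₁ P₂ => ∑ s ∈ (F.mapSeq W).supp,
        twist K (q - s + t) (entryFun p s 0 (fun Q => F.map Q) P₁) ≫ entryFun s q t (φ (W.X s)) P₂) P =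
      (q - p + t).negOnePow • entryFun p q t (cut K (fun W Q₁ Q₂ => F.map Q₁ ≫ φ W Q₂)) P := by
  -- For a cut with empty outer piece only `s = q` contributes.
  have key : ∀ {B : BddSeq K C} (P : Path A B) (q t : ℤ) (φ : ∀ W, Path W (B.X q) → (F.obj W ⟶ y)),
      ∑ s ∈ (F.mapSeq B).supp,
        twist K (q - s + t) (entryFun p s 0 (fun Q => F.map Q) P) ≫
          entryFun s q t (φ (B.X s)) .nil =
      twist K t (entryFun p q 0 (fun Q => F.map Q) P) ≫ φ (B.X q) .nil := by
    intro B P q t φ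
    rw [sum_eq_single_supp _ q, entryFun_nil, sub_self, zero_add]
    · intro s hs
      rw [entryFun_nil_ne hs, comp_zero]
    · intro h
      have e : entryFun p q 0 (fun Q => F.map Q) P = (0 : F.obj (A.X p) ⟶ F.obj (B.X q)) :=
        IsZero.eq_of_tgt h _ _
      rw [sub_self, zero_add, e, map_zero, zero_comp]
  induction P with
  | nil =>
    intro q t φ
    rw [cut, key]
    by_cases h : p = q
    · subst h
      rw [entryFun_nil, entryFun_nil, cut, F.isAInfty.map_nil, map_zero, zero_comp, smul_zero]
    · rw [entryFun_nil_ne h, entryFun_nil_ne h, map_zero, zero_comp, smul_zero]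
  | @cons B B' P f ih =>
    intro q t φ
    rw [cut, key, twist_entryFun, entryFun_tauPath _ _ _ _ (F.multiLin _ _), smul_smul,
      ← Int.negOnePow_add, Linear.units_smul_comp, add_comm t, entryFun_cons _ _ _ (cut K _)]
    simp only [cut, entryFun_add, smul_add, Finset.sum_add_distrib]
    congr 1
    · rw [← entryFun_cons p q t (fun Q => F.map (tauPath K Q) ≫ φ _ .nil) P f]
      congr 1
      have h := entrySum_map (P.cons f) p q t (fun Q => F.map (tauPath K Q))
        (Preadditive.rightComp _ (φ (B'.X q) .nil))
      change entrySum _ _ _ _ (fun Q => F.map (tauPath K Q) ≫ φ (B'.X q) .nil) =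
        entrySum _ _ _ _ _ ≫ _ at h
      rw [entryFun, entryFun, h, Linear.units_smul_comp]
    · have e : ∀ (W : BddSeq K C) (P₁ : Path A W) (P₂ : Path W B),
          ∑ s ∈ (F.mapSeq W).supp, twist K (q - s + t) (entryFun p s 0 (fun Q => F.map Q) P₁) ≫
            entryFun s q t (φ (W.X s)) (P₂.cons f) =
          ∑ r ∈ B.supp, (t + (q - r)).negOnePow • ∑ s ∈ (F.mapSeq W).supp,
            twist K (r - s + (t + (q - r))) (entryFun p s 0 (fun Q => F.map Q) P₁) ≫
              entryFun s r (t + (q - r)) (fun Q => φ (W.X s) (Q.cons (twist K t (f r q)))) P₂ := by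
        intro W P₁ P₂
        simp only [Finset.smul_sum]
        rw [Finset.sum_comm]
        refine Finset.sum_congr rfl fun s _ => ?_
        rw [entryFun_cons, Preadditive.comp_sum]
        refine Finset.sum_congr rfl fun r _ => ?_
        rw [Linear.comp_units_smul, show r - s + (t + (q - r)) = q - s + t by ring]
      simp only [e]
      rw [cut_sum, Finset.smul_sum]
      refine Finset.sum_congr rfl fun r _ => ?_
      rw [cut_units, ih r _ (fun W Q => φ W (Q.cons (twist K t (f r q)))), smul_smul, smul_smul,
        ← Int.negOnePow_add, ← Int.negOnePow_add]
      congr 1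
      exact negOnePow_congr ⟨0, by ring⟩

/-- The extension of `F` to matrices satisfies the `A_∞`-relations. -/
lemma prime_relation {A B : BddSeq K C} (P : Path A B) (L : List ℤ) (hP : HasDegrees K P L)
    (hn : 0 < P.length) :
    nabla (K := K) (F.prime (tauPath K P)) + cut K (fun _ P₁ P₂ => F.prime P₁ ≫ F.prime P₂) P =
      barD K (fun Q => F.prime Q) P := by
  ext p q
  have h1 := barD_map (K := K) P (fun Q => F.prime Q)
    (entry (F.mapSeq A) (F.mapSeq B) p q).toAddMonoidHom
  have h2 := cut_map (K := K) P (fun _ P₁ P₂ => F.prime P₁ ≫ F.prime P₂)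
    (entry (F.mapSeq A) (F.mapSeq B) p q).toAddMonoidHom
  change barD K (fun Q => entrySum Q p q 0 (fun Q => F.map Q)) P = (barD K (fun Q => F.prime Q) P) p q at h1
  change cut K (fun _ P₁ P₂ => (F.prime P₁ ≫ F.prime P₂) p q) P =
    (cut K (fun _ P₁ P₂ => F.prime P₁ ≫ F.prime P₂) P) p q at h2
  have h3 := F.cut_prime p P q 0 (fun W Q => F.map Q)
  have h4 := barD_entryFun P p q 0 (F.multiLin _ _)
  rw [add_zero] at h3 h4
  have h5 := entrySum_map P p q 0 (fun Q => F.map (tauPath K Q))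
    (nabla (K := K) (X := F.obj (A.X p)) (Y := F.obj (B.X q))).toAddMonoidHom
  change entrySum P p q 0 (fun Q => nabla (K := K) (F.map (tauPath K Q))) = nabla (K := K) _ at h5
  have h6 := entryFun_tauPath P p q 0 (F.multiLin _ _)
  have h7 : entryFun p q 0 (fun Q => F.map Q) =
      fun P : Path A B => entrySum P p q 0 (fun Q => F.map Q) :=
    funext fun P => entryFun_zero_left p q _ P
  rw [h7] at h4
  simp only [entryFun_zero_left] at h3 h4 h6
  rw [BddSeq.add_apply, ← h1, ← h2]
  change nabla (K := K) (entrySum (tauPath K P) p q 0 (fun Q => F.map Q)) + _ = _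
  rw [h6, nabla_units_smul, ← h5]
  have h8 : cut K (fun _ P₁ P₂ => (F.prime P₁ ≫ F.prime P₂) p q) P =
      (q - p).negOnePow • entrySum P p q 0 (cut K (fun _ Q₁ Q₂ => F.map Q₁ ≫ F.map Q₂)) := by
    refine Eq.trans ?_ h3
    congr 1
    funext W P₁ P₂
    simp only [add_zero]
    rfl
  refine (congrArg₂ _ rfl h8).trans (Eq.trans ?_ h4.symm)
  rw [← smul_add, ← entrySum_add]
  congr 1
  -- Entry paths have the same length as `P`, hence are nonempty, and the relation for `F` applies
  -- to each of them.
  refine entrySum_congr P L hP p q 0 fun Q L' hQ hl _ _ => ?_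
  exact (relation_iff F.toAInftyData F.multiLin F.isAInfty.map_nil Q L' hQ).1
    (F.isAInfty.relation Q L' hQ (hl ▸ hn))

end Prime

end AInftyFunctor

/-! ## Nilpotency for proper functors -/

namespace AInfty

open Quiver BddSeq

section Nilpotent

variable {K : Type w} [CommRing K] {C : Type u} [Category.{v} C] [Preadditive C] [Linear K C]

/-- Some entry of the path has degree `0`. -/
def HasZeroEntry (K : Type w) [CommRing K] {C : Type u} [Category.{v} C] [Preadditive C]
    [Linear K C] [CurvedDG K C] {X : C} : ∀ {Y : C}, Path X Y → Prop
  | _, .nil => False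
  | Y, .cons (b := W) P f => f ∈ gr (K := K) W Y 0 ∨ HasZeroEntry K P

/-- An endomorphism of degree `1` without component of internal degree `0`. -/
structure IsPretwist [CurvedDG K C] (A : BddSeq K C) (δ : A ⟶ A) : Prop where
  mem : δ ∈ gr (K := K) A A 1
  internal_zero (p : ℤ) : δ p p = 0

lemma tau_eq_self [CurvedDG K C] {X : C} {δ : X ⟶ X} (h : δ ∈ gr (K := K) X X 1) :
    tau K δ = δ := by
  rw [tau_of_mem h, show (1 : ℤ) + 1 = 2 * 1 by norm_num, Int.negOnePow_two_mul, one_smul]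

lemma IsPretwist.tau_eq [CurvedDG K C] {A : BddSeq K C} {δ : A ⟶ A} (h : IsPretwist A δ) :
    tau K δ = δ := tau_eq_self h.mem

lemma MultiLin.eq_zero_of_hasZeroEntry [CurvedDG K C] {M : Type*} [AddCommGroup M] [Module K M]
    {X Y : C} (P : Path X Y) : ∀ {φ : Path X Y → M}, MultiLin K φ →
    (∀ Q L, HasDegrees K Q L → 0 ∈ L → Q.length = P.length → φ Q = 0) → HasZeroEntry K P →
    φ P = 0 := by
  induction P with
  | nil => intro φ _ _ h; exact h.elim
  | cons P f ih =>
    rintro φ hφ h (hf | hP)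
    · refine MultiLin.ext_homogeneous (ψ := fun _ => (0 : M)) P (hφ.cons f)
        ⟨fun _ _ _ _ => (add_zero 0).symm, fun _ _ k _ => (smul_zero k).symm⟩ fun Q L hQ hl => ?_
      exact h (Q.cons f) (0 :: L) ⟨0, L, rfl, hf, hQ⟩ List.mem_cons_self
        (by rw [Path.length_cons, Path.length_cons, hl])
    · refine hom_induction (K := K) (P := fun f => φ (P.cons f) = 0) f
        (fun d g hg => ?_) (fun f g hf hg => by rw [hφ.cons_add, hf, hg, add_zero])
      exact ih (hφ.cons g) (fun Q L hQ h0 hl => h (Q.cons g) (d :: L) ⟨d, L, rfl, hg, hQ⟩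
        (List.mem_cons_of_mem _ h0) (by rw [Path.length_cons, Path.length_cons, hl])) hP

variable [CDGCategory K C]

lemma mem_gr_zero_of_le {X Y : C} {n : ℤ} (hn : n ≤ 0) {f : X ⟶ Y} (hf : f ∈ gr (K := K) X Y n) :
    f ∈ gr (K := K) X Y 0 := by
  rcases hn.lt_or_eq with h | rfl
  · rw [CDGCategory.gr_neg X Y n h, Submodule.mem_bot] at hf
    rw [hf]
    exact Submodule.zero_mem _
  · exact hf

/-- The entry has auxiliary degree `1 - (q - r)`. For `r < q` this is at most 0, and negative
degrees vanish; the diagonal is zero by assumption. -/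
lemma IsPretwist.entry_mem {A : BddSeq K C} {δ : A ⟶ A} (h : IsPretwist A δ) {r q : ℤ}
    (hrq : r ≤ q) : δ r q ∈ gr (K := K) (A.X r) (A.X q) 0 := by
  rcases hrq.lt_or_eq with h' | rfl
  · exact mem_gr_zero_of_le (by omega) (h.mem r q)
  · rw [h.internal_zero]
    exact Submodule.zero_mem _

lemma abs_le_of_mem_supp {A : BddSeq K C} {r : ℤ} (hr : r ∈ A.supp) :
    r.natAbs ≤ A.supp.sup Int.natAbs := Finset.le_sup (f := Int.natAbs) hr

/-- A number of consecutive entries `δ` that forces sums over entries to vanish. -/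
noncomputable def nilBound (A : BddSeq K C) (_ : A ⟶ A) : ℕ := 2 * A.supp.sup Int.natAbs + 2

lemma entrySum_eq_zero {M : Type*} [AddCommGroup M] [Module K M] {A B D : BddSeq K C} {δ : B ⟶ B}
    (hδ : IsPretwist B δ) (P : Path A B) {n : ℕ} (hn : nilBound B δ ≤ n) (Q : Path B D) (p : ℤ) :
    ∀ (q t : ℤ) {φ : Path (A.X p) (D.X q) → M},
    (∀ R, 2 ≤ R.length → HasZeroEntry K R → φ R = 0) →
    entrySum ((P.comp (dpow δ n)).comp Q) p q t φ = 0 := by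
  -- An entry `δ r q` that is not of degree 0 has `r > q`, so the position strictly rises on walking
  -- inwards. Positions in the support have absolute value at most `s`, so at most `2s` such entries
  -- can follow one another. Two further arrows produce an entry of degree 0 in a path of length at
  -- least 2.
  have base : ∀ (m : ℕ) (q t : ℤ) {φ : Path (A.X p) (B.X q) → M},
      (∀ R, 2 ≤ R.length → HasZeroEntry K R → φ R = 0) →
      (q ∉ B.supp ∨ ((B.supp.sup Int.natAbs : ℕ) : ℤ) - m ≤ q) →
      entrySum (P.comp (dpow δ (m + 2))) p q t φ = 0 := by
    intro m
    induction m with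
    | zero =>
      intro q t φ hφ hq
      rw [dpow, Path.comp_cons, entrySum]
      refine Finset.sum_eq_zero fun r hr => ?_
      have hmem : twist K t (δ r q) ∈ gr (K := K) (B.X r) (B.X q) 0 := by
        apply twist_mem
        rcases hq with hq | hq
        · rw [(isZero_of_notMem hq).eq_of_tgt (δ r q) 0]
          exact Submodule.zero_mem _
        · have := abs_le_of_mem_supp hr
          exact hδ.entry_mem (by omega)
      rw [entrySum_congr_length _ _ _ _ (ψ := fun _ => 0), entrySum_zero (K := K), smul_zero]
      intro R hR
      refine hφ _ ?_ (Or.inl hmem)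
      rw [Path.length_cons, hR, dpow, Path.comp_cons, Path.length_cons]
      omega
    | succ m ih =>
      intro q t φ hφ hq
      rw [show m + 1 + 2 = (m + 2) + 1 by rfl, dpow, Path.comp_cons, entrySum]
      refine Finset.sum_eq_zero fun r hr => ?_
      by_cases hmem : twist K t (δ r q) ∈ gr (K := K) (B.X r) (B.X q) 0
      · rw [entrySum_congr_length _ _ _ _ (ψ := fun _ => 0), entrySum_zero (K := K), smul_zero]
        intro R hR
        refine hφ _ ?_ (Or.inl hmem)
        rw [Path.length_cons, hR, dpow, Path.comp_cons, Path.length_cons]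
        omega
      · rw [ih r, smul_zero]
        · intro R hR hz
          exact hφ _ (by rw [Path.length_cons]; omega) (Or.inr hz)
        · right
          by_contra hlt
          apply hmem
          apply twist_mem
          rcases hq with hq | hq
          · rw [(isZero_of_notMem hq).eq_of_tgt (δ r q) 0]
            exact Submodule.zero_mem _
          · exact hδ.entry_mem (by push_cast at hq; omega)
  induction Q with
  | nil =>
    intro q t φ hφ
    obtain ⟨m, rfl⟩ := Nat.exists_eq_add_of_le' (show 2 ≤ n by rw [nilBound] at hn; omega)
    refine base m q t hφ ?_
    by_cases hq : q ∈ B.supp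
    · right
      have := abs_le_of_mem_supp hq
      rw [nilBound] at hn
      omega
    · exact Or.inl hq
  | cons Q f ih =>
    intro q t φ hφ
    rw [Path.comp_cons, entrySum]
    refine Finset.sum_eq_zero fun r _ => ?_
    rw [ih r, smul_zero]
    intro R hR hz
    exact hφ _ (by rw [Path.length_cons]; omega) (Or.inr hz)

end Nilpotent

end AInfty

namespace AInftyFunctor

open Quiver AInfty BddSeq

variable {K : Type w} [CommRing K]
  {C : Type u₁} [Category.{v₁} C] [Preadditive C] [Linear K C]
  {D : Type u₂} [Category.{v₂} D] [Preadditive D] [Linear K D]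

lemma IsProper.map_eq_zero [CurvedDG K C] [CurvedDG K D] {F : AInftyFunctor K C D}
    (hF : F.IsProper) {X Y : C} (P : Path X Y) (hP : 2 ≤ P.length) (h : HasZeroEntry K P) :
    F.map P = 0 :=
  (F.multiLin X Y).eq_zero_of_hasZeroEntry P (fun Q L hQ h0 hl => hF Q L hQ (hl ▸ hP) h0) h

lemma IsProper.isNilBy_prime [CDGCategory K C] [CurvedDG K D] {F : AInftyFunctor K C D}
    (hF : F.IsProper) (A B : BddSeq K C) :
    IsNilBy (fun _ δ => IsPretwist _ δ) nilBound (fun P : Path A B => F.prime P) := by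
  intro Z δ hδ n hn P Q
  ext p q
  exact entrySum_eq_zero hδ P hn Q p q 0 fun R hR hz => hF.map_eq_zero R hR hz

end AInftyFunctor

/-! ## Twisting by insertion -/

namespace AInfty

open Quiver BddSeq

section TwInsertion

variable {K : Type w} [CommRing K] {C : Type u} [Category.{v} C] [Preadditive C] [Linear K C]
  [CurvedDG K C] {M : Type*} [AddCommGroup M] [Module K M]

lemma isPretwist (A : Tw K C) : IsPretwist A.seq A.δ := ⟨A.isTwisted.mem, A.isTwisted.internal_zero⟩

lemma deltaPow_eq (A : Tw K C) (k : ℕ) : deltaPow A k = dpow A.δ k := by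
  induction k with
  | zero => rfl
  | succ k ih => rw [deltaPow, dpow, ih]

/-- The matrix underlying a morphism of twisted complexes. -/
abbrev matOf {A B : Tw K C} (f : A ⟶ B) : A.seq ⟶ B.seq := f

/-- The nilpotent functionals on paths of bounded sequences. -/
abbrev NilFun {A B : BddSeq K C} (φ : Path A B → M) : Prop := IsNil (fun _ δ => IsPretwist _ δ) φ

/-- The insertion of the differentials in all positions. -/
noncomputable def insAll {A : Tw K C} {M : Type*} [AddCommGroup M] :
    ∀ {B : Tw K C}, Path A B → (Path A.seq B.seq → M) → M
  | _, .nil, φ => ins A.δ φ .nil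
  | B, .cons P f, φ =>
      insAll P (fun Q => ins B.δ φ (Q.cons (matOf f)))

lemma insAll_add {A B : Tw K C} (P : Path A B) : ∀ {φ ψ : Path A.seq B.seq → M}, NilFun φ →
    NilFun ψ → insAll P (fun Q => φ Q + ψ Q) = insAll P φ + insAll P ψ := by
  induction P with
  | nil =>
    intro φ ψ hφ hψ
    exact hφ.ins_add hψ (isPretwist A) _
  | @cons _ B' P f ih =>
    intro φ ψ hφ hψ
    rw [insAll, insAll, insAll, ← ih ((hφ.ins _).cons _) ((hψ.ins _).cons _)]
    congr 1
    funext Q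
    exact hφ.ins_add hψ (isPretwist B') _

lemma insAll_map {M' : Type*} [AddCommGroup M'] {A B : Tw K C} (P : Path A B) (l : M →+ M') :
    ∀ {φ : Path A.seq B.seq → M}, NilFun φ → insAll P (fun Q => l (φ Q)) = l (insAll P φ) := by
  induction P with
  | nil =>
    intro φ hφ
    exact hφ.ins_map l (isPretwist A) _
  | @cons _ B' P f ih =>
    intro φ hφ
    rw [insAll, insAll, ← ih ((hφ.ins _).cons _)]
    congr 1
    funext Q
    exact hφ.ins_map l (isPretwist B') _

lemma insAll_zero {A B : Tw K C} (P : Path A B) : insAll P (fun _ => (0 : M)) = 0 := by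
  induction P with
  | nil => exact finsum_zero (α := ℕ)
  | cons P f ih =>
    rw [insAll]
    refine Eq.trans ?_ ih
    congr 1
    funext Q
    exact finsum_zero (α := ℕ) (M := M)

/-- The two sides nest the infinite sums in opposite order; nilpotency makes each of them finite, so
they can be interchanged. -/
lemma insertSum_eq {A B : Tw K C} (P : Path A B) : ∀ {φ : Path A.seq B.seq → M}, NilFun φ →
    insertSum P φ = insAll P φ := by
  have hsum : ∀ {A B : Tw K C} (P : Path A B) (s : Finset ℕ) {φ : ℕ → Path A.seq B.seq → M},
      (∀ i, NilFun (φ i)) → insAll P (fun Q => ∑ i ∈ s, φ i Q) = ∑ i ∈ s, insAll P (φ i) := by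
    intro A B P s φ hφ
    induction s using Finset.induction_on with
    | empty => simpa using insAll_zero P
    | insert a s ha ih =>
      simp only [Finset.sum_insert ha]
      rw [insAll_add P (hφ a) (IsNil.sum s fun i _ => hφ i), ih]
  induction P with
  | nil =>
    intro φ hφ
    rw [insertSum, insAll, ins]
    exact finsum_congr fun k => by rw [deltaPow_eq, Path.nil_comp]
  | @cons B' B P f ih =>
    intro φ hφ
    obtain ⟨N, hN⟩ := hφ.exists_bound (isPretwist B)
    obtain ⟨N', hN'⟩ := hφ.exists_ins_eq (isPretwist B)
    have hnil : ∀ k, NilFun (fun Q : Path A.seq B'.seq =>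
        φ ((Q.cons (matOf f)).comp (dpow B.δ k))) := fun k =>
      (hφ.comp_right (dpow B.δ k)).cons (matOf f)
    rw [insertSum, insAll, finsum_eq_sum_of_support_subset (s := Finset.range (max N N'))]
    · rw [funext fun Q => hN' (max N N') (le_max_right _ _) _, hsum P _ hnil]
      refine Finset.sum_congr rfl fun k _ => ?_
      rw [deltaPow_eq, ih (hnil k)]
    · intro k hk
      rw [Finset.coe_range, Set.mem_Iio]
      by_contra hk'
      apply hk
      simp only [deltaPow_eq]
      rw [ih (hnil k), ← insAll_zero P]
      congr 1
      funext Q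
      exact hN k ((le_max_left _ _).trans (not_lt.1 hk')) _

lemma insAll_tauPath {A B : Tw K C} (P : Path A B) : ∀ (φ : Path A.seq B.seq → M),
    insAll P (fun Q => φ (tauPath K Q)) = insAll (tauPath K P) φ := by
  induction P with
  | nil =>
    intro φ
    exact IsNil.ins_tauPath (Δ := fun _ δ => IsPretwist _ δ) (K := K) (fun h => h.tau_eq)
      (isPretwist A) _
  | @cons _ B P f ih =>
    intro φ
    rw [tauPath_cons, insAll, insAll, ← ih]
    congr 1
    funext Q
    exact IsNil.ins_tauPath (Δ := fun _ δ => IsPretwist _ δ) (K := K) (fun h => h.tau_eq)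
      (isPretwist B) _

lemma multiLin_insAll {A B : Tw K C} {φ : Path A.seq B.seq → M} (hφ : NilFun φ)
    (hm : MultiLin K φ) : MultiLin K (fun P : Path A B => insAll P φ) := by
  have hsmul : ∀ {A B : Tw K C} (P : Path A B) {φ : Path A.seq B.seq → M} (k : K), NilFun φ →
      insAll P (fun Q => k • φ Q) = k • insAll P φ := fun P φ k hφ =>
    insAll_map P (DistribSMul.toAddMonoidHom M k) hφ
  constructor
  · intro X Y P Q f g
    induction Q with
    | nil =>
      simp only [Path.comp_nil, insAll]
      rw [← insAll_add P ((hφ.ins _).cons _) ((hφ.ins _).cons _)]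
      congr 1
      funext Q
      exact (hm.ins hφ (isPretwist Y)).cons_add Q _ _
    | @cons B B' Q a ih =>
      exact ih ((hφ.ins _).cons _) ((hm.ins hφ (isPretwist B')).cons _)
  · intro X Y P Q k f
    induction Q with
    | nil =>
      simp only [Path.comp_nil, insAll]
      rw [← hsmul P k ((hφ.ins _).cons _)]
      congr 1
      funext Q
      exact (hm.ins hφ (isPretwist Y)).smul Q .nil k _
    | @cons B B' Q a ih =>
      exact ih ((hφ.ins _).cons _) ((hm.ins hφ (isPretwist B')).cons _)

/-- If some `δ` stands directly inside `f`, then `f` is composed with it. These terms supply the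
summand `f ∘ δ` of the differential of `Tw`. -/
lemma insAll_merge {A B B' : Tw K C} (P : Path A B) (f : B ⟶ B') {φ : Path A.seq B'.seq → M}
    (hφ : NilFun φ) :
    insAll P (merge K (matOf f) (ins B'.δ φ)) =
      merge K f (fun Q : Path A B' => insAll Q φ) P +
      insAll (tauPath K P) (fun Q => ins B'.δ φ (Q.cons (B.δ ≫ (matOf f)))) := by
  have h := fun Q => (hφ.ins B'.δ).ins_merge (K := K) (fun h => h.tau_eq) (isPretwist B)
    (matOf f) Q
  cases P with
  | nil =>
    rw [insAll, h, merge, merge, zero_add]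
    exact (zero_add _).symm
  | @cons X _ P g =>
    rw [insAll, funext fun Q : Path A.seq X.seq => h (Q.cons (matOf g)), merge]
    have h1 : NilFun (fun Q : Path A.seq X.seq => ins B'.δ φ ((tauPath K Q).cons
        (tau K (matOf g) ≫ (matOf f)))) :=
      ((hφ.ins B'.δ).cons _).tauPath (fun h => h.tau_eq)
    have h2 : NilFun (fun Q : Path A.seq X.seq => ins B.δ (fun R : Path A.seq B.seq =>
        ins B'.δ φ (R.cons (B.δ ≫ (matOf f))))
        ((tauPath K Q).cons (tau K (matOf g)))) :=
      ((((hφ.ins B'.δ).cons _).ins B.δ).cons _).tauPath (fun h => h.tau_eq)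
    refine (insAll_add P h1 h2).trans ?_
    rw [insAll_tauPath P (fun Q => ins B'.δ φ (Q.cons
        (tau K (matOf g) ≫ (matOf f)))),
      insAll_tauPath P (fun Q => ins B.δ (fun R : Path A.seq B.seq =>
        ins B'.δ φ (R.cons (B.δ ≫ (matOf f))))
        (Q.cons (tau K (matOf g))))]
    rfl

lemma diff_tau {A B : Tw K C} (f : A.seq ⟶ B.seq) :
    Tw.diff A B (tau K f) = nabla (K := K) (tau K f) + tau K f ≫ B.δ + A.δ ≫ f := by
  rw [Tw.diff_apply, twist_one_tau, Preadditive.comp_neg, sub_neg_eq_add]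

/-- The insertion of the differentials commutes with the bar differential. -/
lemma insAll_barD {A B : Tw K C} (P : Path A B) : ∀ {φ : Path A.seq B.seq → M}, NilFun φ →
    MultiLin K φ → insAll P (barD K φ) = barD K (fun Q : Path A B => insAll Q φ) P := by
  induction P with
  | nil =>
    intro φ hφ hm
    have hz : ∀ X : Path A.seq A.seq, ins A.δ (fun Q => ins A.δ φ (Q.cons 0)) X = 0 := fun X => by
      simp only [(hm.ins hφ (isPretwist A)).cons_zero]
      exact finsum_zero
    rw [insAll, hφ.ins_barD (fun h => h.tau_eq) hm (isPretwist A), A.isTwisted.maurerCartan, hz,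
      barD, barD, merge]
    change _ + 0 - ins A.δ φ (Path.nil.cons _) + 0 = insAll (Path.nil.cons 0) φ
    rw [add_zero, add_zero, sub_self]
    exact (hz _).symm
  | @cons B B' P f ih =>
    intro φ hφ hm
    have hS := hφ.ins B'.δ
    have hSm := hm.ins hφ (isPretwist B')
    rw [insAll, funext fun Q => hφ.ins_barD_cons (fun h => h.tau_eq) hm (isPretwist B')
      B'.isTwisted.maurerCartan Q (matOf f)]
    have n1 := (hS.cons (matOf f)).barD (K := K) (fun h => h.tau_eq)
    have n2 := (hS.cons (nabla (K := K) (tau K (matOf f)) +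
      tau K (matOf f) ≫ B'.δ)).tauPath (K := K) (fun h => h.tau_eq)
    have n3 := hS.merge (K := K) (fun h => h.tau_eq) (matOf f)
    rw [insAll_add P (n1.add n2) n3, insAll_add P n1 n2, ih (hS.cons _) (hSm.cons _),
      insAll_merge P f hφ,
      insAll_tauPath P (fun Q => ins B'.δ φ (Q.cons (nabla (K := K)
        (tau K (matOf f)) + tau K (matOf f) ≫ B'.δ))), barD]
    -- The connection on the left is that of `Tw`. Its three summands come from `∇`, from composing
    -- with the `δ` outside `f`, and from composing with the `δ` inside it.
    have e1 : insAll ((tauPath K P).cons (nabla (K := K) (tau K f))) φ =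
        insAll (tauPath K P) (fun Q => ins B'.δ φ (Q.cons (nabla (K := K)
          (tau K (matOf f)) + tau K (matOf f) ≫ B'.δ))) +
        insAll (tauPath K P) (fun Q => ins B'.δ φ
          (Q.cons (B.δ ≫ (matOf f)))) := by
      rw [← insAll_add _ (hS.cons _) (hS.cons _), insAll]
      congr 1
      funext Q
      rw [← hSm.cons_add]
      congr 2
      exact diff_tau _
    -- The curvature of `Tw` is zero; the curvatures of the underlying sequences have been absorbed
    -- by the Maurer-Cartan equation.
    have e2 : insAll (((tauPath K P).cons (tau K f)).cons (curv K B')) φ = 0 := by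
      have := (multiLin_insAll hφ hm).cons_zero ((tauPath K P).cons (tau K f))
      exact this
    rw [e1, e2]
    change barD K (fun Q : Path A B => insAll (Q.cons f) φ) P + _ + _ = _
    abel

section Cut

variable {D : Type u₂} [Category.{v₂} D] [Preadditive D] [Linear K D] {x y : D}
  {o : BddSeq K C → D} {N : ∀ Z : BddSeq K C, (Z ⟶ Z) → ℕ}

/-- A cut inside a run of inserted `δ` distributes the run over both pieces. Summing over all cuts
thus amounts to choosing a vertex of the original path and inserting independently on its two sides.
-/
lemma insAll_cut {A : Tw K C} {φ₁ : ∀ W, Path A.seq W → (x ⟶ o W)}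
    (h₁ : ∀ W, IsNilBy (fun _ δ => IsPretwist _ δ) N (φ₁ W)) {B : Tw K C} (P : Path A B) :
    ∀ {φ₂ : ∀ W, Path W B.seq → (o W ⟶ y)},
    (∀ W, IsNilBy (fun _ δ => IsPretwist _ δ) N (φ₂ W)) →
    insAll P (cut K (fun W P₁ P₂ => φ₁ W P₁ ≫ φ₂ W P₂)) =
      cut K (fun (W : Tw K C) P₁ P₂ => insAll P₁ (φ₁ W.seq) ≫ insAll P₂ (φ₂ W.seq)) P := by
  induction P with
  | nil =>
    intro φ₂ h₂
    rw [insAll, ins_cut (fun h => h.tau_eq) h₁ h₂ (isPretwist A), cut, cut, Preadditive.sub_comp]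
    exact sub_add_cancel _ _
  | @cons B B' P f ih =>
    intro φ₂ h₂
    have e : ∀ Q : Path A.seq B.seq, ins B'.δ (cut K (fun W P₁ P₂ => φ₁ W P₁ ≫ φ₂ W P₂))
        (Q.cons (matOf f)) =
        ins B'.δ (φ₁ B'.seq) ((tauPath K Q).cons (tau K (matOf f))) ≫
          ins B'.δ (φ₂ B'.seq) .nil +
        cut K (fun W P₁ P₂ => φ₁ W P₁ ≫ ins B'.δ (φ₂ W)
          (P₂.cons (matOf f))) Q := fun Q => by
      rw [ins_cut (fun h => h.tau_eq) h₁ h₂ (isPretwist B'), cut, Preadditive.sub_comp,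
        tauPath_cons]
      abel
    have n0 := (((h₁ B'.seq).isNil.ins B'.δ).cons
      (tau K (matOf f))).tauPath (K := K) (fun h => h.tau_eq)
    have n1 := n0.map (Preadditive.rightComp _ (ins B'.δ (φ₂ B'.seq) .nil))
    have n2 := IsNilBy.cut (K := K) (fun h => h.tau_eq) h₁
      (fun W => ((h₂ W).ins B'.δ).cons (matOf f))
    rw [insAll, funext e]
    refine (insAll_add P n1 n2).trans ?_
    rw [ih (fun W => ((h₂ W).ins B'.δ).cons (matOf f)),
      insAll_map P _ n0, insAll_tauPath P (fun Q => ins B'.δ (φ₁ B'.seq)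
        (Q.cons (tau K (matOf f)))), cut]
    rfl

end Cut

/-- The functional that is zero except on the empty path. -/
def nilPart {D : Type*} [Category D] [Preadditive D] {o : C → D} {X : C} (v : o X ⟶ o X) :
    ∀ {Y : C}, Path X Y → (o X ⟶ o Y)
  | _, .nil => v
  | _, .cons _ _ => 0

lemma HasDegrees.cons {X Y Z : C} {P : Path X Y} {L : List ℤ} (hP : HasDegrees K P L)
    {f : Y ⟶ Z} {d : ℤ} (hf : f ∈ gr (K := K) Y Z d) : HasDegrees K (P.cons f) (d :: L) :=
  ⟨d, L, rfl, hf, hP⟩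

lemma hasDegrees_comp_dpow {X Y : C} {δ : Y ⟶ Y} (hδ : δ ∈ gr (K := K) Y Y 1) (P : Path X Y)
    (L : List ℤ) (hP : HasDegrees K P L) (n : ℕ) :
    HasDegrees K (P.comp (dpow δ n)) (List.replicate n 1 ++ L) := by
  induction n with
  | zero => exact hP
  | succ n ih => exact ⟨1, _, rfl, hδ, ih⟩

/-- Only the inserted sequences of the correct degrees contribute. -/
lemma insAll_congr {A B : Tw K C} (P : Path A B) : ∀ (L : List ℤ) (_ : HasDegrees K P L)
    {φ ψ : Path A.seq B.seq → M} (_ : ∀ Q L', HasDegrees K Q L' → φ Q = ψ Q),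
    insAll P φ = insAll P ψ := by
  induction P with
  | nil =>
    rintro L rfl φ ψ h
    exact finsum_congr fun k => h _ _ (hasDegrees_comp_dpow A.isTwisted.mem .nil [] rfl k)
  | @cons B B' P f ih =>
    rintro _ ⟨d, L, rfl, hf, hP⟩ φ ψ h
    refine ih L hP fun Q L' hQ => finsum_congr fun k => ?_
    exact h ((Q.cons (matOf f)).comp (dpow B'.δ k)) _
      (hasDegrees_comp_dpow B'.isTwisted.mem _ (d :: L') (HasDegrees.cons hQ (f := matOf f) hf) k)

/-- Each inserted `δ` has degree 1 and so leaves the sum of the degrees minus the length unchanged.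
-/
lemma insAll_mem {A B : Tw K C} (S : Submodule K M) (P : Path A B) :
    ∀ (L : List ℤ) (_ : HasDegrees K P L) {φ : Path A.seq B.seq → M}
    (_ : ∀ Q L', HasDegrees K Q L' → L'.sum - L'.length = L.sum - L.length → φ Q ∈ S),
    insAll P φ ∈ S := by
  induction P with
  | nil =>
    rintro L rfl φ h
    refine finsum_induction (· ∈ S) S.zero_mem (fun _ _ => S.add_mem) fun k => ?_
    exact h _ _ (hasDegrees_comp_dpow A.isTwisted.mem .nil [] rfl k) (by simp)
  | @cons B B' P f ih =>
    rintro _ ⟨d, L, rfl, hf, hP⟩ φ h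
    refine ih L hP fun Q L' hQ hs => ?_
    refine finsum_induction (· ∈ S) S.zero_mem (fun _ _ => S.add_mem) fun k => ?_
    refine h ((Q.cons (matOf f)).comp (dpow B'.δ k)) _
      (hasDegrees_comp_dpow B'.isTwisted.mem _ (d :: L') (HasDegrees.cons hQ (f := matOf f) hf) k) ?_
    simp only [List.sum_append, List.sum_replicate, List.length_append, List.length_replicate,
      List.sum_cons, List.length_cons, nsmul_eq_mul, mul_one]
    push_cast
    linarith

end TwInsertion

end AInfty

/-! ## The filtration by internal degree -/

namespace BddSeq

section Filtration

variable {K : Type w} [CommRing K] {C : Type u} [Category.{v} C] [Preadditive C] [Linear K C]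
  [CurvedDG K C]

/-- The morphisms whose components of internal degree greater than `m` vanish. -/
def fil (A B : BddSeq K C) (m : ℤ) : Submodule K (A ⟶ B) where
  carrier := {f | ∀ p q, m < q - p → f p q = 0}
  add_mem' hf hg p q h := by rw [add_apply, hf p q h, hg p q h, add_zero]
  zero_mem' _ _ _ := rfl
  smul_mem' k f hf p q h := by rw [smul_apply, hf p q h, smul_zero]

lemma fil_mono {A B : BddSeq K C} {m m' : ℤ} (h : m ≤ m') {f : A ⟶ B} (hf : f ∈ fil A B m) :
    f ∈ fil A B m' := fun p q hpq => hf p q (h.trans_lt hpq)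

lemma twist_mem_fil {A B : BddSeq K C} {m : ℤ} (a : ℤ) {f : A ⟶ B} (hf : f ∈ fil A B m) :
    twist K a f ∈ fil A B m := fun p q h => by
  rw [twist_apply, hf p q h, map_zero, smul_zero]

lemma nabla_mem_fil {A B : BddSeq K C} {m : ℤ} {f : A ⟶ B} (hf : f ∈ fil A B m) :
    nabla (K := K) f ∈ fil A B m := fun p q h => by
  rw [nabla_apply, hf p q h, map_zero]

lemma comp_mem_fil {A B D : BddSeq K C} {m n : ℤ} {f : A ⟶ B} {g : B ⟶ D} (hf : f ∈ fil A B m)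
    (hg : g ∈ fil B D n) : f ≫ g ∈ fil A D (m + n) := fun p r h => by
  rw [comp_apply]
  refine Finset.sum_eq_zero fun q _ => ?_
  by_cases hq : m < q - p
  · rw [hf p q hq, map_zero, zero_comp]
  · rw [hg q r (by linarith), comp_zero]

lemma id_mem_fil (A : BddSeq K C) : 𝟙 A ∈ fil A A 0 := fun p q h => by
  rw [id_eq, diag_ne]
  rintro rfl
  simp at h

/-- Internal degrees of nonzero entries are differences of positions in two finite supports. Every
induction along the filtration ends because of this bound. -/
lemma exists_le_fil (A B : BddSeq K C) : ∃ m : ℤ, ∀ m' ≤ m, fil A B m' = ⊥ := by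
  refine ⟨-(A.supp.sup Int.natAbs + B.supp.sup Int.natAbs : ℕ) - 1, fun m' hm => ?_⟩
  rw [eq_bot_iff]
  intro f hf
  rw [Submodule.mem_bot]
  ext p q
  by_cases hp : p ∈ A.supp
  · by_cases hq : q ∈ B.supp
    · have h1 : p.natAbs ≤ A.supp.sup Int.natAbs := Finset.le_sup (f := Int.natAbs) hp
      have h2 : q.natAbs ≤ B.supp.sup Int.natAbs := Finset.le_sup (f := Int.natAbs) hq
      exact hf p q (by omega)
    · exact (isZero_of_notMem hq).eq_of_tgt _ _
  · exact (isZero_of_notMem hp).eq_of_src _ _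

end Filtration

section Nonneg

variable {K : Type w} [CommRing K] {C : Type u} [Category.{v} C] [Preadditive C] [Linear K C]
  [CDGCategory K C]

/-- An entry of total degree `n` and internal degree above `n` would have negative auxiliary degree.
-/
lemma mem_fil_of_mem_gr {A B : BddSeq K C} {n : ℤ} {f : A ⟶ B} (hf : f ∈ gr (K := K) A B n) :
    f ∈ fil A B n := fun p q h => by
  have := hf p q
  rwa [CDGCategory.gr_neg _ _ _ (by linarith), Submodule.mem_bot] at this

end Nonneg

end BddSeq

/-! ### Weights of paths of matrices and the filtration. -/

namespace AInfty

open Quiver BddSeq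

section Weight

variable {K : Type w} [CommRing K] {C : Type u} [Category.{v} C] [Preadditive C] [Linear K C]
  [CurvedDG K C] {M : Type*} [AddCommGroup M] [Module K M]

/-- The entries of the matrices have degree `0`, unless their internal degrees are bounded, with sum
of the bounds at most `m`. -/
def HasWeight {A : BddSeq K C} : ∀ {B : BddSeq K C}, Path A B → ℤ → Prop
  | _, .nil, m => 0 ≤ m
  | _, .cons P f, m => ∃ w, (∀ r q, w < q - r → f r q ∈ gr (K := K) _ _ 0) ∧ HasWeight P (m - w)

lemma HasWeight.mono {A B : BddSeq K C} {P : Path A B} : ∀ {m m' : ℤ}, HasWeight P m → m ≤ m' →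
    HasWeight P m' := by
  induction P with
  | nil => intro m m' h h'; exact le_trans h h'
  | cons P f ih =>
    rintro m m' ⟨w, hw, h⟩ h'
    exact ⟨w, hw, ih h (by linarith)⟩

lemma HasWeight.cons {A B D : BddSeq K C} {P : Path A B} {m w : ℤ} (h : HasWeight P m) {f : B ⟶ D}
    (hf : ∀ r q, w < q - r → f r q ∈ gr (K := K) _ _ 0) : HasWeight (P.cons f) (m + w) :=
  ⟨w, hf, by rwa [add_sub_cancel_right]⟩

lemma hasWeight_nil (A : BddSeq K C) : HasWeight (Path.nil : Path A A) 0 := le_refl (0 : ℤ)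

/-- If the internal degrees add up to more than `m`, one of them exceeds its bound. The entry
concerned has degree 0, so the functional vanishes. -/
lemma entrySum_eq_zero_of_hasWeight {A B : BddSeq K C} (P : Path A B) (p : ℤ) : ∀ (q t m : ℤ)
    {φ : Path (A.X p) (B.X q) → M}, HasWeight P m → m < q - p →
    (∀ R, R.length = P.length → HasZeroEntry K R → φ R = 0) → entrySum P p q t φ = 0 := by
  induction P with
  | nil =>
    intro q t m φ h hm _
    change 0 ≤ m at h
    rw [entrySum, dif_neg (by rintro rfl; omega)]
  | cons P f ih =>
    rintro q t m φ ⟨w, hw, h⟩ hm hφ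
    rw [entrySum]
    refine Finset.sum_eq_zero fun r _ => ?_
    by_cases hr : w < q - r
    · rw [entrySum_congr_length (ψ := fun _ => 0), entrySum_zero (K := K), smul_zero]
      intro R hR
      exact hφ _ (by rw [Path.length_cons, Path.length_cons, hR])
        (Or.inl (twist_mem t (hw r q hr)))
    · rw [ih r _ (m - w) h (by linarith) fun R hR hz => hφ (R.cons (twist K t (f r q)))
        (by rw [Path.length_cons, Path.length_cons, hR]) (Or.inr hz), smul_zero]

end Weight

section Pretwist

variable {K : Type w} [CommRing K] {C : Type u} [Category.{v} C] [Preadditive C] [Linear K C]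
  [CDGCategory K C]

/-- The entries of `δ` of internal degree above -1 have auxiliary degree 0. A proper functor
therefore treats every inserted `δ` as if it lowered the internal degree by one, although `δ` may
have entries of internal degree 1. -/
lemma IsPretwist.hasWeight_comp {A B : BddSeq K C} {δ : B ⟶ B} (hδ : IsPretwist B δ)
    {P : Path A B} {m : ℤ} (hP : HasWeight P m) (k : ℕ) :
    HasWeight (P.comp (dpow δ k)) (m - k) := by
  induction k with
  | zero => simpa [dpow] using hP
  | succ k ih =>
    rw [dpow, Path.comp_cons, show (m - (k + 1 : ℕ) : ℤ) = m - k + -1 by push_cast; ring]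
    exact ih.cons fun r q h => hδ.entry_mem (by linarith)

end Pretwist

section NilPart

variable {K : Type w} [CommRing K] {C : Type u} [Category.{v} C] [Preadditive C] [Linear K C]
  [CurvedDG K C]

lemma nilPart_eq_zero {D : Type*} [Category D] [Preadditive D] {o : C → D} {X : C}
    (v : o X ⟶ o X) {Y : C} (P : Path X Y) (hP : 0 < P.length) : nilPart v P = 0 := by
  cases P with
  | nil => simp at hP
  | cons P f => rfl

lemma length_dpow {X : C} (δ : X ⟶ X) (n : ℕ) : (dpow δ n).length = n := by
  induction n with
  | zero => rfl
  | succ n ih => rw [dpow, Path.length_cons, ih]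

lemma isNil_nilPart {D : Type*} [Category D] [Preadditive D] {o : C → D} {X : C}
    (v : o X ⟶ o X) (Y : C) (Δ : ∀ X : C, (X ⟶ X) → Prop) :
    IsNil Δ (fun P : Path X Y => nilPart v P) := fun Z δ _ => by
  refine ⟨1, fun n hn P Q => nilPart_eq_zero v _ ?_⟩
  rw [Path.length_comp, Path.length_comp, length_dpow]
  omega

lemma ins_nilPart_nil {D : Type*} [Category D] [Preadditive D] {o : C → D} {X : C}
    (v : o X ⟶ o X) (δ : X ⟶ X) : ins δ (fun P : Path X X => nilPart v P) .nil = v := by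
  rw [ins, finsum_eq_single _ 0]
  · rfl
  · intro k hk
    refine nilPart_eq_zero v _ ?_
    rw [Path.length_comp, length_dpow]
    omega

lemma insAll_eq_zero_of_pos {M : Type*} [AddCommGroup M] [Module K M] {A B : Tw K C} (P : Path A B)
    (hP : 0 < P.length) {φ : Path A.seq B.seq → M} (h : ∀ Q, 0 < Q.length → φ Q = 0) :
    insAll P φ = 0 := by
  cases P with
  | nil => simp at hP
  | @cons B' _ P f =>
    rw [insAll, ← insAll_zero (M := M) P]
    congr 1
    funext Q
    rw [ins, ← finsum_zero (α := ℕ) (M := M)]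
    refine finsum_congr fun k => h _ ?_
    rw [Path.length_comp, Path.length_cons]
    omega

/-- The bar differential only evaluates functionals on paths of positive length. -/
lemma barD_congr {M : Type*} [AddCommGroup M] {X Y : C} (P : Path X Y) :
    ∀ {φ ψ : Path X Y → M}, (∀ Q, 0 < Q.length → φ Q = ψ Q) → barD K φ P = barD K ψ P := by
  induction P with
  | nil => intro φ ψ h; exact h _ (by simp)
  | cons P f ih =>
    intro φ ψ h
    have hm : merge K f φ P = merge K f ψ P := by
      cases P with
      | nil => rfl
      | cons P g => exact h _ (by simp)
    rw [barD, barD, hm, ih (φ := fun Q => φ (Q.cons f)) (ψ := fun Q => ψ (Q.cons f))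
      fun Q _ => h _ (by simp), h _ (by simp), h _ (by simp)]

/-- The contribution of the trivial decompositions. -/
lemma cut_eq_add {M : Type*} [AddCommGroup M] {X Y : C} (P : Path X Y) :
    ∀ {Θ Θ' : ∀ W : C, Path X W → Path W Y → M}, (∀ W P Q, 0 < P.length → 0 < Q.length →
      Θ W P Q = Θ' W P Q) → (∀ P, Θ' _ P .nil = 0) → (∀ Q, Θ' _ .nil Q = 0) → 0 < P.length →
    cut K Θ P = Θ _ (tauPath K P) .nil + Θ _ .nil P + cut K Θ' P := by
  have key : ∀ {Y : C} (P : Path X Y) {Θ Θ' : ∀ W : C, Path X W → Path W Y → M},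
      (∀ W P Q, 0 < P.length → Θ W P Q = Θ' W P Q) → (∀ Q, Θ' _ .nil Q = 0) →
      cut K Θ P = Θ _ .nil P + cut K Θ' P := by
    intro Y P
    induction P with
    | nil => intro Θ Θ' _ h; rw [cut, cut, h, add_zero]
    | cons P f ih =>
      intro Θ Θ' h h'
      rw [cut, cut, ih (Θ := fun W P Q => Θ W P (Q.cons f)) (Θ' := fun W P Q => Θ' W P (Q.cons f))
        (fun W P Q hP => h W P _ hP) (fun Q => h' _), h _ _ _ (by simp)]
      abel
  intro Θ Θ' h h1 h2 hP
  cases P with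
  | nil => simp at hP
  | cons P f =>
    rw [cut, cut, h1, zero_add, key P (Θ := fun W P Q => Θ W P (Q.cons f))
      (Θ' := fun W P Q => Θ' W P (Q.cons f)) (fun W P Q hP => h W P _ hP (by simp)) fun Q => h2 _]
    abel

end NilPart

end AInfty

namespace AInftyFunctor

open Quiver AInfty BddSeq

variable {K : Type w} [CommRing K]
  {C : Type u₁} [Category.{v₁} C] [Preadditive C] [Linear K C]
  {D : Type u₂} [Category.{v₂} D] [Preadditive D] [Linear K D]

section Prime

variable [CurvedDG K C] [CurvedDG K D] (F : AInftyFunctor K C D)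

lemma prime_toPath_eq_zero {A B : BddSeq K C} {f : A ⟶ B} {p q : ℤ} (h : f p q = 0) :
    F.prime f.toPath p q = 0 := by
  refine (F.prime_toPath f p q).trans ?_
  rw [h, F.map_zero_toPath]
  exact smul_zero (A := F.obj (A.X p) ⟶ F.obj (B.X q)) _

lemma prime_toPath_diag {A B : BddSeq K C} (f : A ⟶ B) (p : ℤ) :
    F.prime f.toPath p p = F.map (f p p).toPath := by
  refine (F.prime_toPath f p p).trans ?_
  rw [sub_self, Int.negOnePow_zero, one_smul]

lemma prime_curv (A : BddSeq K C) : F.prime (curv K A).toPath = curv K (F.mapSeq A) := by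
  ext p q
  rw [curv_eq, curv_eq]
  by_cases h : p = q
  · subst h
    rw [prime_toPath_diag, diag_self, diag_self]
    exact F.isAInfty.map_curv _
  · rw [diag_ne _ _ h]
    exact F.prime_toPath_eq_zero (diag_ne _ _ h)

lemma prime_id (A : BddSeq K C) : F.prime (𝟙 A : A ⟶ A).toPath = 𝟙 (F.mapSeq A) := by
  ext p q
  rw [BddSeq.id_eq, BddSeq.id_eq]
  by_cases h : p = q
  · subst h
    rw [prime_toPath_diag, diag_self, diag_self]
    exact F.isAInfty.map_id _
  · rw [diag_ne _ _ h]
    exact F.prime_toPath_eq_zero (diag_ne _ _ h)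

lemma prime_toPath_mem_fil {A B : BddSeq K C} {m : ℤ} {f : A ⟶ B} (hf : f ∈ fil A B m) :
    F.prime f.toPath ∈ fil (F.mapSeq A) (F.mapSeq B) m := fun p q h =>
  F.prime_toPath_eq_zero (hf p q h)

/-- The `A_∞`-relations for the extension to matrices, with the curvature as the empty term. -/
lemma barD_prime {A B : BddSeq K C} (P : Path A B) (L : List ℤ) (hP : HasDegrees K P L) :
    barD K (fun Q => F.prime Q) P = nabla (K := K) (F.prime (tauPath K P)) +
      cut K (fun _ P₁ P₂ => F.prime P₁ ≫ F.prime P₂) P +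
      nilPart (o := F.mapSeq) (curv K (F.mapSeq A)) P := by
  cases P with
  | nil =>
    rw [barD, tauPath_nil, cut, F.prime_nil, map_zero, zero_comp, zero_add, zero_add]
    exact F.prime_curv A
  | cons P f =>
    rw [← F.prime_relation _ L hP (by simp)]
    exact (add_zero _).symm

end Prime

/-! ### The image of a pretwist under `F`, its Maurer-Cartan expression and its variation. -/

section Push

variable [CDGCategory K C]

lemma IsProper.nilFun_prime [CurvedDG K D] {F : AInftyFunctor K C D} (hF : F.IsProper)
    (A B : BddSeq K C) : NilFun (fun P : Path A B => F.prime P) := (hF.isNilBy_prime A B).isNil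

lemma IsProper.prime_mem_fil [CurvedDG K D] {F : AInftyFunctor K C D} (hF : F.IsProper)
    {A B : BddSeq K C} {P : Path A B} (hl : 2 ≤ P.length) {m : ℤ} (hP : HasWeight P m) :
    F.prime P ∈ fil (F.mapSeq A) (F.mapSeq B) m := fun p q h =>
  entrySum_eq_zero_of_hasWeight P p q 0 m hP h fun R hR hz =>
    hF.map_eq_zero R (hR ▸ hl) hz

/-- The Maurer-Cartan expression `∑ F'(ε, ..., ε)`. -/
noncomputable def push [CurvedDG K D] (F : AInftyFunctor K C D) {A : BddSeq K C} (ε : A ⟶ A) :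
    F.mapSeq A ⟶ F.mapSeq A := ins ε (fun P => F.prime P) .nil

/-- `∑ F'(ε', ..., ε', f, ε, ..., ε)`. -/
noncomputable def push₁ [CurvedDG K D] (F : AInftyFunctor K C D) {A B : BddSeq K C} (ε : A ⟶ A)
    (ε' : B ⟶ B) (f : A ⟶ B) : F.mapSeq A ⟶ F.mapSeq B :=
  ins ε (fun Q => ins ε' (fun P => F.prime P) (Q.cons f)) .nil

variable [CurvedDG K D] {F : AInftyFunctor K C D} (hF : F.IsProper)
include hF

lemma IsProper.push_eq_add {A : BddSeq K C} {ε : A ⟶ A} (hε : IsPretwist A ε) :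
    F.push ε = ins ε (fun P => F.prime P) ε.toPath := by
  rw [push, (hF.nilFun_prime A A).ins_eq_add hε, F.prime_nil, zero_add]
  rfl

/-- The remaining summands have `k ≥ 2` arguments and weight `-k`. -/
lemma IsProper.push_sub_prime_mem {A : BddSeq K C} {ε : A ⟶ A} (hε : IsPretwist A ε) :
    F.push ε - F.prime ε.toPath ∈ fil (F.mapSeq A) (F.mapSeq A) (-2) := by
  rw [hF.push_eq_add hε, (hF.nilFun_prime A A).ins_eq_add hε, add_sub_cancel_left, ins]
  refine finsum_induction (· ∈ fil (F.mapSeq A) (F.mapSeq A) (-2)) (Submodule.zero_mem _)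
    (fun _ _ => Submodule.add_mem _) fun k => hF.prime_mem_fil (by
      simp [Hom.toPath]) (m := -2) ?_
  have h := hε.hasWeight_comp (hasWeight_nil A) (2 + k)
  rw [← dpow_add, ← Path.comp_assoc, Path.nil_comp] at h
  exact h.mono (by push_cast; linarith)

lemma IsProper.push_mem {A : BddSeq K C} {ε : A ⟶ A} (hε : IsPretwist A ε) :
    F.push ε ∈ gr (K := K) (F.mapSeq A) (F.mapSeq A) 1 := by
  rw [push, ins]
  refine finsum_induction (· ∈ gr (K := K) (F.mapSeq A) (F.mapSeq A) 1) (Submodule.zero_mem _)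
    (fun _ _ => Submodule.add_mem _) fun k => ?_
  have h := F.prime_mem _ _ (hasDegrees_comp_dpow hε.mem .nil [] rfl k)
  simpa using h

lemma IsProper.isPretwist_push {A : BddSeq K C} {ε : A ⟶ A} (hε : IsPretwist A ε) :
    IsPretwist (F.mapSeq A) (F.push ε) where
  mem := hF.push_mem hε
  internal_zero p := by
    have h := hF.push_sub_prime_mem hε p p (by simp)
    rw [BddSeq.sub_apply, F.prime_toPath_eq_zero (hε.internal_zero p)] at h
    exact sub_eq_zero.1 h

/-- The Maurer-Cartan expression of the image of `ε`. -/
lemma IsProper.push_maurerCartan {A : BddSeq K C} {ε : A ⟶ A} (hε : IsPretwist A ε) :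
    nabla (K := K) (F.push ε) + F.push ε ≫ F.push ε + curv K (F.mapSeq A) =
      F.push₁ ε ε (nabla (K := K) ε + ε ≫ ε + curv K A) := by
  have hΔ : ∀ {X : BddSeq K C} {δ : X ⟶ X}, IsPretwist X δ → tau K δ = δ := fun h => h.tau_eq
  -- The value at the empty path of the bar differential with insertions is computed twice: here by
  -- commuting it past the insertion, in `h2` by the A∞-relations.
  have h1 := (hF.nilFun_prime A A).ins_barD (K := K) hΔ (F.multiLin_prime A A) hε .nil
  have h2 : ins ε (barD K fun P : Path A A => F.prime P) .nil =
      ins ε (fun P : Path A A => nabla (K := K) (F.prime (tauPath K P)) +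
        cut K (fun _ P₁ P₂ => F.prime P₁ ≫ F.prime P₂) P +
        nilPart (o := F.mapSeq) (curv K (F.mapSeq A)) P) .nil :=
    finsum_congr fun k => F.barD_prime _ _ (hasDegrees_comp_dpow hε.mem .nil [] rfl k)
  have n1 : NilFun (fun P : Path A A => nabla (K := K) (F.prime (tauPath K P))) :=
    ((hF.nilFun_prime A A).tauPath (K := K) hΔ).map
      (nabla (K := K) (X := F.mapSeq A) (Y := F.mapSeq A)).toAddMonoidHom
  have n2 := IsNilBy.cut (K := K) (o := F.mapSeq) hΔ (fun W => hF.isNilBy_prime A W)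
    (fun W => hF.isNilBy_prime W A)
  have e1 : ins ε (fun P : Path A A => nabla (K := K) (F.prime (tauPath K P))) .nil =
      nabla (K := K) (F.push ε) := by
    have := ((hF.nilFun_prime A A).tauPath (K := K) hΔ).ins_map
      (nabla (K := K) (X := F.mapSeq A) (Y := F.mapSeq A)).toAddMonoidHom hε .nil
    refine this.trans ?_
    rw [IsNil.ins_tauPath (Δ := fun X δ => IsPretwist (K := K) X δ) hΔ hε]
    rfl
  have e2 := ins_cut (K := K) (o := F.mapSeq) hΔ (fun W => hF.isNilBy_prime A W)
    (fun W => hF.isNilBy_prime W A) hε .nil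
  rw [(n1.add n2).ins_add (isNil_nilPart (o := F.mapSeq) _ A _) hε, n1.ins_add n2 hε, e1, e2, ins_nilPart_nil, cut,
    tauPath_nil, F.prime_nil, sub_zero, zero_comp, add_zero] at h2
  refine h2.symm.trans (h1.trans ?_)
  rw [barD, merge, add_zero, tauPath_nil, sub_self, zero_add]
  rfl

/-- A telescoping identity: the copies of `ε` in `F'(ε, ..., ε)` are replaced by `ε'` one at a time,
and each replacement contributes one summand with argument `ε' - ε`. -/
lemma IsProper.push_sub_push {A : BddSeq K C} {ε ε' : A ⟶ A} (hε : IsPretwist A ε)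
    (hε' : IsPretwist A ε') : F.push ε' - F.push ε = F.push₁ ε' ε (ε' - ε) := by
  have hn := hF.nilFun_prime A A
  have hm := F.multiLin_prime A A
  have e := IsNil.ins_eq_of_sub (Δ := fun X δ => IsPretwist (K := K) X δ) (hn.ins ε) hε'
    (φ := fun P => F.prime P - ins ε (fun P => F.prime P) (P.cons (ε' - ε))) (fun P => by
      rw [hn.ins_eq_add hε P, ← sub_add_cancel ε' ε, (hm.ins hn hε).cons_add, sub_add_cancel]
      abel) .nil
  have e' : ins ε' (fun P => F.prime P - ins ε (fun P => F.prime P) (P.cons (ε' - ε))) .nil =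
      F.push ε' - F.push₁ ε' ε (ε' - ε) := by
    simp only [sub_eq_add_neg (F.prime _)]
    have := hn.ins_add ((hn.ins ε).cons (ε' - ε)).neg hε' .nil
    refine this.trans ?_
    have h2 := ((hn.ins ε).cons (ε' - ε)).ins_map (-AddMonoidHom.id _) hε' .nil
    exact (congrArg₂ _ rfl h2).trans (sub_eq_add_neg _ _).symm
  rw [e'] at e
  rw [← sub_eq_zero, ← sub_eq_zero.2 e, push, push]
  abel

/-- Every inserted pretwist lowers the weight by one, so all summands except `F'(f)` lie at least
one step lower. The hypothesis restricts only the entries of degree other than 0, since the others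
do not survive in these summands. -/
lemma IsProper.push₁_sub_prime_mem {A B : BddSeq K C} {ε : A ⟶ A} {ε' : B ⟶ B}
    (hε : IsPretwist A ε) (hε' : IsPretwist B ε') {f : A ⟶ B} {m : ℤ}
    (hf : ∀ r q, m < q - r → f r q ∈ gr (K := K) _ _ 0) :
    F.push₁ ε ε' f - F.prime f.toPath ∈ fil (F.mapSeq A) (F.mapSeq B) (m - 1) := by
  have hn := hF.nilFun_prime A B
  have key : ∀ k l : ℕ, 0 < k + l →
      F.prime ((((Path.nil : Path A A).comp (dpow ε k)).cons f).comp (dpow ε' l)) ∈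
        fil (F.mapSeq A) (F.mapSeq B) (m - 1) := fun k l hkl => by
    refine hF.prime_mem_fil (by
      rw [Path.length_comp, Path.length_cons, Path.length_comp, length_dpow, length_dpow]
      simp; omega) ?_
    have h := hε'.hasWeight_comp ((hε.hasWeight_comp (hasWeight_nil A) k).cons hf) l
    exact h.mono (by omega)
  have h1 : ∀ k : ℕ, ins ε' (fun P => F.prime P) ((((Path.nil : Path A A).comp
      (dpow ε k)).cons f).cons ε') ∈ fil (F.mapSeq A) (F.mapSeq B) (m - 1) := fun k => by
    refine finsum_induction (· ∈ fil (F.mapSeq A) (F.mapSeq B) (m - 1)) (Submodule.zero_mem _)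
      (fun _ _ => Submodule.add_mem _) fun l => ?_
    rw [← comp_dpow_succ]
    exact key k (l + 1) (by omega)
  rw [push₁, ((hn.ins ε').cons f).ins_eq_add hε, hn.ins_eq_add hε']
  change F.prime f.toPath + _ + _ - _ ∈ _
  rw [add_assoc, add_sub_cancel_left]
  refine Submodule.add_mem _ (h1 0) ?_
  refine finsum_induction (· ∈ fil (F.mapSeq A) (F.mapSeq B) (m - 1)) (Submodule.zero_mem _)
    (fun _ _ => Submodule.add_mem _) fun k => ?_
  rw [← comp_dpow_succ]
  beta_reduce
  rw [hn.ins_eq_add hε']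
  exact Submodule.add_mem _ (key (k + 1) 0 (by omega)) (h1 (k + 1))

end Push

end AInftyFunctor

/-! ## The induced functor on twisted complexes -/

namespace AInftyFunctor

open Quiver AInfty BddSeq

variable {K : Type w} [CommRing K]
  {C : Type u₁} [Category.{v₁} C] [Preadditive C] [Linear K C] [CDGCategory K C]
  {D : Type u₂} [Category.{v₂} D] [Preadditive D] [Linear K D] [CurvedDG K D]
  {F : AInftyFunctor K C D} (hF : F.IsProper)
include hF

lemma IsProper.twDelta_eq (A : Tw K C) : F.twDelta A = F.push A.δ := by
  rw [hF.push_eq_add (isPretwist A), twDelta, ins]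
  refine finsum_congr fun k => ?_
  have h := comp_dpow_succ A.δ .nil k
  rw [Path.nil_comp] at h
  rw [deltaPow_eq, h]
  rfl

lemma IsProper.isTwisted_twDelta (A : Tw K C) :
    IsTwistedDifferential (F.mapSeq A.seq) (F.twDelta A) := by
  have h := hF.isPretwist_push (isPretwist A)
  rw [hF.twDelta_eq]
  refine ⟨h.mem, h.internal_zero, ?_⟩
  have hz : ∀ X : Path A.seq A.seq, ins A.δ (fun Q : Path A.seq A.seq =>
      ins A.δ (fun P => F.prime P) (Q.cons 0)) X = 0 := fun X => by
    simp only [((F.multiLin_prime A.seq A.seq).ins (hF.nilFun_prime _ _)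
      (isPretwist A)).cons_zero]
    exact finsum_zero
  rw [hF.push_maurerCartan (isPretwist A), A.isTwisted.maurerCartan]
  exact hz _

lemma IsProper.twData_map {A B : Tw K C} (P : Path A B) (hP : 0 < P.length) :
    (F.twData hF.isTwisted_twDelta).map P = insAll P (fun Q => F.prime Q) := by
  cases P with
  | nil => simp at hP
  | @cons B' _ P f =>
    exact insertSum_eq (K := K) (M := F.mapSeq A.seq ⟶ F.mapSeq B.seq) (P.cons f)
      (hF.nilFun_prime _ _)

lemma IsProper.twData_map_toPath {A B : Tw K C} (f : A ⟶ B) :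
    (F.twData hF.isTwisted_twDelta).map f.toPath = F.push₁ A.δ B.δ (matOf f) :=
  hF.twData_map f.toPath (by simp [Hom.toPath])

lemma IsProper.multiLin_twData (A B : Tw K C) :
    MultiLin K (fun P : Path A B => (F.twData hF.isTwisted_twDelta).map P) := by
  have h := multiLin_insAll (hF.nilFun_prime A.seq B.seq) (F.multiLin_prime A.seq B.seq)
  constructor
  · intro X Y P Q f g
    rw [hF.twData_map _ (by simp), hF.twData_map _ (by simp), hF.twData_map _ (by simp)]
    exact h.add P Q f g
  · intro X Y P Q k f
    rw [hF.twData_map _ (by simp), hF.twData_map _ (by simp)]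
    exact h.smul P Q k f

lemma IsProper.insAll_mem_gr {A B : Tw K C} (P : Path A B) (L : List ℤ) (hP : HasDegrees K P L) :
    insAll P (fun Q => F.prime Q) ∈
      gr (K := K) (F.mapSeq A.seq) (F.mapSeq B.seq) (L.sum - L.length + 1) := by
  refine insAll_mem _ P L hP fun Q L' hQ h => ?_
  have := F.prime_mem Q L' hQ
  rwa [h] at this

/-- All entries of the identity matrix have degree 0, so properness leaves only the summand without
insertions. -/
lemma IsProper.push₁_id {A : BddSeq K C} (ε : A ⟶ A) :
    F.push₁ ε ε (𝟙 A) = 𝟙 (F.mapSeq A) := by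
  have hd : ∀ (k l : ℕ), 0 < k + l →
      F.prime ((((Path.nil : Path A A).comp (dpow ε k)).cons (𝟙 A)).comp (dpow ε l)) = 0 := by
    intro k l hkl
    have key : ∀ (l : ℕ) (p q t : ℤ) {y : D} {φ : Path (A.X p) (A.X q) → (F.obj (A.X p) ⟶ y)},
        (∀ R, R.length = k + 1 + l → HasZeroEntry K R → φ R = 0) →
        entrySum ((((Path.nil : Path A A).comp (dpow ε k)).cons (𝟙 A)).comp (dpow ε l)) p q t φ
          = 0 := by
      intro l
      induction l with
      | zero =>
        intro p q t y φ hφ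
        rw [dpow, Path.comp_nil, entrySum]
        refine Finset.sum_eq_zero fun r _ => ?_
        rw [entrySum_congr_length (ψ := fun _ => 0), entrySum_zero (K := K), smul_zero]
        intro R hR
        refine hφ _ (by simp [hR, length_dpow]) (Or.inl (twist_mem t ?_))
        rw [BddSeq.id_eq]
        by_cases h : r = q
        · subst h
          rw [diag_self]
          exact id_mem _
        · rw [diag_ne _ _ h]
          exact Submodule.zero_mem _
      | succ l ih =>
        intro p q t y φ hφ
        rw [dpow, Path.comp_cons, entrySum]
        refine Finset.sum_eq_zero fun r _ => ?_
        rw [ih, smul_zero]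
        intro R hR hz
        exact hφ _ (by rw [Path.length_cons, hR]; rfl) (Or.inr hz)
    ext p q
    exact key l p q 0 fun R hR hz => hF.map_eq_zero R (by omega) hz
  rw [push₁, ins, finsum_eq_single _ 0, ins, finsum_eq_single _ 0]
  · exact F.prime_id A
  · intro l hl
    exact hd 0 l (by omega)
  · intro k hk
    rw [ins, ← finsum_zero (α := ℕ) (M := F.mapSeq A ⟶ F.mapSeq A)]
    exact finsum_congr fun l => hd k l (by omega)

/-- `Tw(F)` is an `A_∞`-functor. -/
theorem IsProper.isAInfty_twData : (F.twData hF.isTwisted_twDelta).IsAInfty K where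
  map_nil _ := rfl
  map_add P Q f g := (hF.multiLin_twData _ _).add P Q f g
  map_smul P Q k f := (hF.multiLin_twData _ _).smul P Q k f
  map_mem P L hP := by
    cases P with
    | nil => exact Submodule.zero_mem _
    | cons P f =>
      rw [hF.twData_map _ (by simp)]
      exact hF.insAll_mem_gr _ L hP
  map_id A := (hF.twData_map_toPath _).trans (hF.push₁_id A.δ)
  map_curv A := (hF.multiLin_twData A A).cons_zero .nil
  relation {A B} P L hP hn := by
    rw [relation_iff _ hF.multiLin_twData (fun _ => rfl) P L hP]
    have hΔ : ∀ {X : BddSeq K C} {δ : X ⟶ X}, IsPretwist X δ → tau K δ = δ := fun h => h.tau_eq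
    have hnil := hF.nilFun_prime A.seq B.seq
    have hlin := F.multiLin_prime A.seq B.seq
    have n1 : NilFun (fun P : Path A.seq B.seq => nabla (K := K) (F.prime (tauPath K P))) :=
      (hnil.tauPath (K := K) hΔ).map
        (nabla (K := K) (X := F.mapSeq A.seq) (Y := F.mapSeq B.seq)).toAddMonoidHom
    have n2 := IsNilBy.cut (K := K) (o := F.mapSeq) hΔ (fun W => hF.isNilBy_prime A.seq W)
      (fun W => hF.isNilBy_prime W B.seq)
    have n3 := isNil_nilPart (o := F.mapSeq) (curv K (F.mapSeq A.seq)) B.seq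
      (fun X δ => IsPretwist (K := K) X δ)
    have e0 := insAll_barD P hnil hlin
    have e1 : insAll P (barD K fun Q => F.prime Q) =
        nabla (K := K) (insAll (tauPath K P) fun Q => F.prime Q) +
        cut K (fun (W : Tw K C) P₁ P₂ => insAll P₁ (fun Q : Path A.seq W.seq => F.prime Q) ≫
          insAll P₂ (fun Q : Path W.seq B.seq => F.prime Q)) P := by
      refine (insAll_congr P L hP fun Q L' hQ => F.barD_prime Q L' hQ).trans ?_
      have a1 := insAll_add P (n1.add n2) n3
      have a2 := insAll_add P n1 n2
      have a3 := insAll_eq_zero_of_pos (K := K) (M := F.mapSeq A.seq ⟶ F.mapSeq B.seq) P hn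
        (fun Q hQ => nilPart_eq_zero (o := F.mapSeq) (curv K (F.mapSeq A.seq)) Q hQ)
      have a4 := insAll_map P
        (nabla (K := K) (X := F.mapSeq A.seq) (Y := F.mapSeq B.seq)).toAddMonoidHom
        (hnil.tauPath (K := K) hΔ)
      have a5 := insAll_cut (o := F.mapSeq) (fun W => hF.isNilBy_prime A.seq W) P
        (fun W => hF.isNilBy_prime W B.seq)
      rw [insAll_tauPath P] at a4
      rw [a1, a2, a3, add_zero]
      exact congrArg₂ _ a4 a5
    have e2 : barD K (fun Q : Path A B => (F.twData hF.isTwisted_twDelta).map Q) P =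
        barD K (fun Q : Path A B => insAll Q fun R => F.prime R) P :=
      barD_congr P fun Q hQ => hF.twData_map Q hQ
    -- Insertion into the empty path gives the twisted differential of the image. The two cuts with
    -- an empty piece are therefore the terms by which the differential of `Tw(D)` differs from `∇`,
    -- as `e4` shows.
    have e3 := cut_eq_add (K := K) P
      (Θ := fun (W : Tw K C) P₁ P₂ => insAll P₁ (fun Q : Path A.seq W.seq => F.prime Q) ≫
          insAll P₂ (fun Q : Path W.seq B.seq => F.prime Q))
      (Θ' := fun W P₁ P₂ => (F.twData hF.isTwisted_twDelta).map P₁ ≫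
        (F.twData hF.isTwisted_twDelta).map P₂)
      (fun W P₁ P₂ h1 h2 => by
        rw [hF.twData_map P₁ h1, hF.twData_map P₂ h2]; rfl)
      (fun P₁ => comp_zero) (fun P₂ => zero_comp) hn
    have e4 : nabla (K := K) ((F.twData hF.isTwisted_twDelta).map (tauPath K P)) =
        nabla (K := K) (insAll (tauPath K P) fun Q => F.prime Q) +
        (insAll (tauPath K P) fun Q => F.prime Q) ≫ F.push B.δ +
        F.push A.δ ≫ insAll P (fun Q => F.prime Q) := by
      rw [hF.twData_map _ (by simpa using hn)]
      refine (Tw.diff_apply ((F.twData hF.isTwisted_twDelta).obj A)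
        ((F.twData hF.isTwisted_twDelta).obj B) _).trans ?_
      have hm := hF.insAll_mem_gr P L hP
      have ht : insAll (tauPath K P) (fun Q => F.prime Q) =
          tau K (insAll P (fun Q => F.prime Q)) := by
        rw [tau_of_mem hm]
        exact map_tauPath P L (multiLin_insAll hnil hlin) hP
      have ht' : twist K 1 (insAll (tauPath K P) (fun Q => F.prime Q)) =
          -insAll P (fun Q => F.prime Q) := by
        rw [ht, twist_one_tau]
      change nabla (K := K) (insAll (tauPath K P) fun Q => F.prime Q) +
        (insAll (tauPath K P) fun Q => F.prime Q) ≫ F.twDelta B -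
        F.twDelta A ≫ twist K 1 (insAll (tauPath K P) fun Q => F.prime Q) = _
      rw [ht', hF.twDelta_eq, hF.twDelta_eq]
      refine (congrArg₂ _ rfl (Preadditive.comp_neg _ _)).trans (sub_neg_eq_add _ _)
    rw [e4, e2, ← e0, e1, e3]
    change _ + _ + F.push A.δ ≫ insAll P (fun Q => F.prime Q) + _ = _ + (_ ≫ F.push B.δ + F.push A.δ ≫ insAll P (fun Q => F.prime Q) + _)
    abel

end AInftyFunctor

/-! ## Homotopy equivalences and quasi-isomorphisms -/

namespace CurvedDG

section Homotopy

variable {K : Type w} [CommRing K] {C : Type u} [Category.{v} C] [Preadditive C] [Linear K C]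
  [CurvedDG K C]

lemma mem_cocycles {X Y : C} {n : ℤ} {f : X ⟶ Y} :
    f ∈ cocycles K X Y n ↔ f ∈ gr (K := K) X Y n ∧ nabla (K := K) f = 0 := Iff.rfl

lemma comp_mem_cocycles {X Y Z : C} {m n : ℤ} {f : X ⟶ Y} {g : Y ⟶ Z}
    (hf : f ∈ cocycles K X Y m) (hg : g ∈ cocycles K Y Z n) : f ≫ g ∈ cocycles K X Z (m + n) := by
  have h1 : nabla (K := K) f = 0 := hf.2
  have h2 : nabla (K := K) g = 0 := hg.2
  refine mem_cocycles.2 ⟨comp_mem hf.1 hg.1, ?_⟩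
  rw [leibniz', h1, h2, comp_zero, zero_comp, add_zero]

lemma id_mem_cocycles (X : C) : 𝟙 X ∈ cocycles K X X 0 := ⟨id_mem X, nabla_id X⟩

lemma comp_mem_coboundaries {X Y Z : C} {m n : ℤ} {f : X ⟶ Y} {g : Y ⟶ Z}
    (hf : f ∈ cocycles K X Y m) (hg : g ∈ coboundaries K Y Z n) :
    f ≫ g ∈ coboundaries K X Z (m + n) := by
  obtain ⟨g, hg, rfl⟩ := hg
  have h1 : nabla (K := K) f = 0 := hf.2
  refine ⟨f ≫ g, ?_, ?_⟩
  · rw [add_sub_assoc]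
    exact comp_mem hf.1 hg
  · rw [leibniz', h1, zero_comp, add_zero]

lemma coboundaries_comp_mem {X Y Z : C} {m n : ℤ} {f : X ⟶ Y} {g : Y ⟶ Z}
    (hf : f ∈ coboundaries K X Y m) (hg : g ∈ cocycles K Y Z n) :
    f ≫ g ∈ coboundaries K X Z (m + n) := by
  obtain ⟨f, hf, rfl⟩ := hf
  have h1 : nabla (K := K) g = 0 := hg.2
  refine ⟨n.negOnePow • (f ≫ g), ?_, ?_⟩
  · rw [add_sub_right_comm]
    exact smul_mem_gr _ (comp_mem hf hg.1)
  · rw [nabla_units_smul, leibniz f hg.1, h1, comp_zero, zero_add, smul_smul, Int.units_mul_self,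
      one_smul]

lemma HomotopyEquivalent.symm {X Y : C} (h : HomotopyEquivalent K X Y) :
    HomotopyEquivalent K Y X := by
  obtain ⟨f, hf, g, hg, h1, h2⟩ := h
  exact ⟨g, hg, f, hf, h2, h1⟩

lemma homotopy_comp {X Y Z : C} {f : X ⟶ Y} {g : Y ⟶ X} {f' : Y ⟶ Z} {g' : Z ⟶ Y}
    (hf : f ∈ cocycles K X Y 0) (hg : g ∈ cocycles K Y X 0)
    (h : f ≫ g - 𝟙 X ∈ coboundaries K X X 0) (h' : f' ≫ g' - 𝟙 Y ∈ coboundaries K Y Y 0) :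
    (f ≫ f') ≫ g' ≫ g - 𝟙 X ∈ coboundaries K X X 0 := by
  have e : (f ≫ f') ≫ g' ≫ g - 𝟙 X = f ≫ (f' ≫ g' - 𝟙 Y) ≫ g + (f ≫ g - 𝟙 X) := by
    simp only [Preadditive.comp_sub, Preadditive.sub_comp, Category.assoc, Category.id_comp]
    abel
  rw [e]
  exact Submodule.add_mem _ (by simpa using comp_mem_coboundaries hf (coboundaries_comp_mem h' hg)) h

lemma HomotopyEquivalent.trans {X Y Z : C} (h : HomotopyEquivalent K X Y)
    (h' : HomotopyEquivalent K Y Z) : HomotopyEquivalent K X Z := by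
  obtain ⟨f, hf, g, hg, h1, h2⟩ := h
  obtain ⟨f', hf', g', hg', h1', h2'⟩ := h'
  exact ⟨f ≫ f', by simpa using comp_mem_cocycles hf hf', g' ≫ g,
    by simpa using comp_mem_cocycles hg' hg, homotopy_comp hf hg h1 h1', homotopy_comp hg' hf' h2' h2⟩

end Homotopy

end CurvedDG

namespace AInftyData

open Quiver AInfty

variable {K : Type w} [CommRing K]
  {C : Type u₁} [Category.{v₁} C] [Preadditive C] [Linear K C] [CurvedDG K C]
  {D : Type u₂} [Category.{v₂} D] [Preadditive D] [Linear K D] [CurvedDG K D]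

/-- The linear component of an `A_∞`-functor. -/
def IsAInfty.lin {G : AInftyData C D} (hG : G.IsAInfty K) (X Y : C) :
    (X ⟶ Y) →ₗ[K] (G.obj X ⟶ G.obj Y) :=
  MultiLin.lastHom (φ := fun P : Path X Y => G.map P) ⟨hG.map_add, hG.map_smul⟩ .nil

lemma IsAInfty.lin_apply {G : AInftyData C D} (hG : G.IsAInfty K) {X Y : C} (f : X ⟶ Y) :
    hG.lin X Y f = G.map f.toPath := rfl

lemma IsAInfty.lin_mem {G : AInftyData C D} (hG : G.IsAInfty K) {X Y : C} {n : ℤ} {f : X ⟶ Y}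
    (hf : f ∈ gr (K := K) X Y n) : hG.lin X Y f ∈ gr (K := K) (G.obj X) (G.obj Y) n := by
  simpa [lin_apply] using hG.map_mem f.toPath [n] ⟨n, [], rfl, hf, rfl⟩

lemma IsAInfty.lin_id {G : AInftyData C D} (hG : G.IsAInfty K) (X : C) :
    hG.lin X X (𝟙 X) = 𝟙 (G.obj X) := hG.map_id X

/-- The relation for one argument. It is evaluated at `tau K f` so that the signs cancel. -/
lemma IsAInfty.lin_nabla {G : AInftyData C D} (hG : G.IsAInfty K) {X Y : C}
    (hX : curv K X = 0) (hY : curv K Y = 0) {n : ℤ} {f : X ⟶ Y} (hf : f ∈ gr (K := K) X Y n) :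
    hG.lin X Y (nabla (K := K) f) = nabla (K := K) (hG.lin X Y f) := by
  have hm : ∀ X Y : C, MultiLin K (fun P : Path X Y => G.map P) :=
    fun X Y => ⟨hG.map_add, hG.map_smul⟩
  have hP : HasDegrees K (tau K f).toPath [n] := ⟨n, [], rfl, tau_mem hf, rfl⟩
  have h := (relation_iff G hm hG.map_nil _ _ hP).1 (hG.relation _ _ hP (by simp [Hom.toPath]))
  rw [Hom.toPath, tauPath_cons, tau_tau, tauPath_nil, cut, cut, hG.map_nil, hG.map_nil, comp_zero,
    zero_comp, barD, barD, merge, tau_tau, tauPath_nil, hX, hY, (hm X Y).cons_zero, add_zero,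
    add_zero, add_zero, add_zero, ((hm X Y).cons (tau K f)).cons_zero, add_zero] at h
  exact h.symm

variable (hC : ∀ X : C, curv K X = 0)
include hC

lemma IsAInfty.lin_mem_cocycles {G : AInftyData C D} (hG : G.IsAInfty K) {X Y : C} {n : ℤ}
    {f : X ⟶ Y} (hf : f ∈ cocycles K X Y n) :
    hG.lin X Y f ∈ cocycles K (G.obj X) (G.obj Y) n := by
  refine mem_cocycles.2 ⟨hG.lin_mem hf.1, ?_⟩
  rw [← hG.lin_nabla (hC X) (hC Y) hf.1, show nabla (K := K) f = 0 from hf.2, map_zero]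

lemma IsAInfty.lin_mem_coboundaries {G : AInftyData C D} (hG : G.IsAInfty K) {X Y : C} {n : ℤ}
    {f : X ⟶ Y} (hf : f ∈ coboundaries K X Y n) :
    hG.lin X Y f ∈ coboundaries K (G.obj X) (G.obj Y) n := by
  obtain ⟨f, hf, rfl⟩ := hf
  exact ⟨_, hG.lin_mem hf, (hG.lin_nabla (hC X) (hC Y) hf).symm⟩

/-- The relation for two closed arguments: the binary component of `G` is the primitive, with the
inner argument replaced by its `tau` to absorb the sign. -/
lemma IsAInfty.lin_comp {G : AInftyData C D} (hG : G.IsAInfty K) {X Y Z : C} {m n : ℤ} {f : X ⟶ Y}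
    {g : Y ⟶ Z} (hf : f ∈ cocycles K X Y m) (hg : g ∈ cocycles K Y Z n) :
    hG.lin X Z (f ≫ g) - hG.lin X Y f ≫ hG.lin Y Z g ∈
      coboundaries K (G.obj X) (G.obj Z) (m + n) := by
  have hm : ∀ X Y : C, MultiLin K (fun P : Path X Y => G.map P) :=
    fun X Y => ⟨hG.map_add, hG.map_smul⟩
  have h1 : nabla (K := K) f = 0 := hf.2
  have h2 : nabla (K := K) g = 0 := hg.2
  have h1' : nabla (K := K) (tau K f) = 0 := by rw [tau_of_mem hf.1, nabla_units_smul, h1, smul_zero]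
  have h2' : nabla (K := K) (tau K g) = 0 := by rw [tau_of_mem hg.1, nabla_units_smul, h2, smul_zero]
  have hP : HasDegrees K ((tau K f).toPath.cons g) [n, m] :=
    ⟨n, [m], rfl, hg.1, m, [], rfl, tau_mem hf.1, rfl⟩
  have h := (relation_iff G hm hG.map_nil _ _ hP).1 (hG.relation _ _ hP (by simp [Hom.toPath]))
  rw [Hom.toPath, tauPath_cons, tauPath_cons, tau_tau, tauPath_nil, cut, cut, cut, hG.map_nil,
    hG.map_nil, comp_zero, zero_comp, barD, barD, barD, merge, merge, tauPath_cons, tau_tau,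
    tauPath_nil, h1, h2', hC, hC, hC, (hm X Z).cons_zero, (hm X Z).cons_zero,
    ((hm X Z).cons g).cons_zero, ((hm X Z).cons g).cons_zero,
    (((hm X Z).cons g).cons (tau K f)).cons_zero] at h
  simp only [add_zero, zero_add] at h
  have h3 := hG.map_mem ((Path.nil.cons f).cons (tau K g)) [n, m]
    ⟨n, [m], rfl, tau_mem hg.1, m, [], rfl, hf.1, rfl⟩
  refine ⟨G.map ((Path.nil.cons f).cons (tau K g)), ?_, eq_sub_of_add_eq h⟩
  have e : ([n, m] : List ℤ).sum - ([n, m] : List ℤ).length + 1 = m + n - 1 := by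
    simp
    ring
  rw [← e]
  exact h3

/-- `G` induces a bijection from the cohomology of `Hom(X, Y)` to that of `Hom(G X, G Y)`. -/
structure IsQuasiIsoOn (K : Type w) [CommRing K]
    {C : Type u₁} [Category.{v₁} C] [Preadditive C] [Linear K C] [CurvedDG K C]
    {D : Type u₂} [Category.{v₂} D] [Preadditive D] [Linear K D] [CurvedDG K D]
    (G : AInftyData C D) (X Y : C) : Prop where
  injective (n : ℤ) (f : X ⟶ Y) (hf : f ∈ cocycles K X Y n)
    (h : G.map f.toPath ∈ coboundaries K (G.obj X) (G.obj Y) n) : f ∈ coboundaries K X Y n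
  surjective (n : ℤ) (g : G.obj X ⟶ G.obj Y) (hg : g ∈ cocycles K (G.obj X) (G.obj Y) n) :
    ∃ f ∈ cocycles K X Y n, G.map f.toPath - g ∈ coboundaries K (G.obj X) (G.obj Y) n

/-- The linear part of `G` is a functor on cohomology, so composing with the homotopy equivalences
on both sides intertwines the two maps on cohomology. -/
lemma IsAInfty.isQuasiIsoOn_of_homotopyEquivalent {G : AInftyData C D} (hG : G.IsAInfty K)
    {X X' Y Y' : C} (hX : HomotopyEquivalent K X X') (hY : HomotopyEquivalent K Y Y')
    (h : G.IsQuasiIsoOn K X' Y') : G.IsQuasiIsoOn K X Y := by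
  obtain ⟨a, ha, a', ha', haa, -⟩ := hX
  obtain ⟨b, hb, b', hb', hbb, -⟩ := hY
  -- A cocycle is cohomologous to the result of carrying it over to `X' ⟶ Y'` and back.
  have move : ∀ (n : ℤ) (f : X ⟶ Y), f ∈ cocycles K X Y n →
      f - a ≫ (a' ≫ f ≫ b) ≫ b' ∈ coboundaries K X Y n := fun n f hf => by
    have e : f - a ≫ (a' ≫ f ≫ b) ≫ b' = -((a ≫ a' - 𝟙 X) ≫ f ≫ b ≫ b' + f ≫ (b ≫ b' - 𝟙 Y)) := by
      simp only [Preadditive.comp_sub, Preadditive.sub_comp, Category.assoc, Category.id_comp,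
        Category.comp_id]
      abel
    rw [e]
    refine Submodule.neg_mem _ (Submodule.add_mem _ ?_ ?_)
    · simpa using coboundaries_comp_mem haa (comp_mem_cocycles hf (comp_mem_cocycles hb hb'))
    · simpa using comp_mem_coboundaries hf hbb
  have hGaa : ∀ {X X' : C} {a : X ⟶ X'} {a' : X' ⟶ X}, a ∈ cocycles K X X' 0 →
      a' ∈ cocycles K X' X 0 → a ≫ a' - 𝟙 X ∈ coboundaries K X X 0 →
      hG.lin X X' a ≫ hG.lin X' X a' - 𝟙 (G.obj X) ∈ coboundaries K (G.obj X) (G.obj X) 0 := by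
    intro X X' a a' ha ha' h
    have h1 := hG.lin_comp hC ha ha'
    have h2 := hG.lin_mem_coboundaries hC h
    rw [map_sub, hG.lin_id] at h2
    have h3 := Submodule.sub_mem _ h2 h1
    simpa using h3
  have hL : ∀ {n : ℤ} {X Y : C} {f : X ⟶ Y}, f ∈ cocycles K X Y n →
    hG.lin X Y f ∈ cocycles K (G.obj X) (G.obj Y) n := fun hf => hG.lin_mem_cocycles hC hf
  have comp3 : ∀ {X X' Y Y' : C} {a' : X' ⟶ X} {b : Y ⟶ Y'} {n : ℤ} {f : X ⟶ Y},
      a' ∈ cocycles K X' X 0 → b ∈ cocycles K Y Y' 0 → f ∈ cocycles K X Y n →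
      hG.lin X' Y' (a' ≫ f ≫ b) - hG.lin X' X a' ≫ hG.lin X Y f ≫ hG.lin Y Y' b ∈
        coboundaries K (G.obj X') (G.obj Y') n := by
    intro X X' Y Y' a' b n f ha' hb hf
    have h1 := hG.lin_comp hC ha' (comp_mem_cocycles hf hb)
    have h2 := comp_mem_coboundaries (hL ha') (hG.lin_comp hC hf hb)
    have h3 := Submodule.add_mem _ h1 h2
    rw [Preadditive.comp_sub, sub_add_sub_cancel] at h3
    simpa using h3
  constructor
  · intro n f hf hGf
    have h1 : a' ≫ f ≫ b ∈ cocycles K X' Y' n := by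
      simpa using comp_mem_cocycles ha' (comp_mem_cocycles hf hb)
    have h2 : G.map (a' ≫ f ≫ b).toPath ∈ coboundaries K (G.obj X') (G.obj Y') n := by
      have h3 := comp_mem_coboundaries (hL ha') (coboundaries_comp_mem hGf (hL hb))
      have h4 := comp3 ha' hb hf
      rw [zero_add, add_zero] at h3
      simpa [lin_apply] using Submodule.add_mem _ h4 h3
    have h3 := comp_mem_coboundaries ha (coboundaries_comp_mem (h.injective n _ h1 h2) hb')
    rw [zero_add, add_zero] at h3
    simpa using Submodule.add_mem _ (move n f hf) h3
  · intro n g hg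
    have h1 : hG.lin X' X a' ≫ g ≫ hG.lin Y Y' b ∈ cocycles K (G.obj X') (G.obj Y') n := by
      simpa using comp_mem_cocycles (hL ha') (comp_mem_cocycles hg (hL hb))
    obtain ⟨f, hf, h2⟩ := h.surjective n _ h1
    refine ⟨a ≫ f ≫ b', by simpa using comp_mem_cocycles ha (comp_mem_cocycles hf hb'), ?_⟩
    have h3 := comp3 ha hb' hf
    have h4 := comp_mem_coboundaries (hL ha) (coboundaries_comp_mem h2 (hL hb'))
    rw [zero_add, add_zero] at h4
    have h5 := coboundaries_comp_mem (hGaa ha ha' haa) (comp_mem_cocycles hg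
      (comp_mem_cocycles (hL hb) (hL hb')))
    have h6 := comp_mem_coboundaries hg (hGaa hb hb' hbb)
    rw [zero_add, add_zero, add_zero] at h5
    rw [add_zero] at h6
    have h7 := Submodule.add_mem _ (Submodule.add_mem _ h3 h4) (Submodule.add_mem _ h5 h6)
    convert h7 using 1
    rw [hG.lin_apply, hG.lin_apply f]
    simp only [Preadditive.comp_sub, Preadditive.sub_comp, Category.assoc, Category.id_comp,
      Category.comp_id]
    abel

end AInftyData

/-! ## Quasi-full faithfulness on minimal twisted complexes -/

/-- A twisted complex is minimal if its terms are uncurved and its differential strictly decreases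
the internal degree. -/
structure Tw.IsMinimal {K : Type w} [CommRing K] {C : Type u} [Category.{v} C] [Preadditive C]
    [Linear K C] [CurvedDG K C] (A : Tw K C) : Prop where
  curv_eq_zero (n : ℤ) : curv K (A.seq.X n) = 0
  mem_fil : A.δ ∈ BddSeq.fil A.seq A.seq (-1)

/-- Composing with differentials that lower the internal degree only affects lower terms, so on the
associated graded the differential is `∇`. -/
lemma Tw.diff_sub_nabla_mem {K : Type w} [CommRing K] {C : Type u} [Category.{v} C] [Preadditive C]
    [Linear K C] [CurvedDG K C] {A B : Tw K C} (hA : A.δ ∈ BddSeq.fil A.seq A.seq (-1))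
    (hB : B.δ ∈ BddSeq.fil B.seq B.seq (-1)) {m : ℤ} {f : A.seq ⟶ B.seq}
    (hf : f ∈ BddSeq.fil A.seq B.seq m) :
    Tw.diff A B f - nabla (K := K) f ∈ BddSeq.fil A.seq B.seq (m - 1) := by
  rw [Tw.diff_apply, add_sub_assoc, add_sub_cancel_left]
  refine Submodule.sub_mem _ (BddSeq.comp_mem_fil hf hB) ?_
  rw [sub_eq_neg_add]
  exact BddSeq.comp_mem_fil hA (BddSeq.twist_mem_fil 1 hf)

namespace AInftyFunctor

open Quiver AInfty BddSeq

variable {K : Type w} [CommRing K]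
  {C : Type u₁} [Category.{v₁} C] [Preadditive C] [Linear K C]
  {D : Type u₂} [Category.{v₂} D] [Preadditive D] [Linear K D]

section Leading

variable [CurvedDG K C] [CurvedDG K D] {F : AInftyFunctor K C D}
  (hF₀ : F.uncurved.IsQuasiFullyFaithful K)
include hF₀

/-- The cones of the maps `Hom(X, Y) ⟶ Hom(F X, F Y)` are acyclic. -/
lemma exists_cone_primitive {X Y : C} (hX : curv K X = 0) (hY : curv K Y = 0) {n : ℤ} {f : X ⟶ Y}
    (hf : f ∈ gr (K := K) X Y n) (hf' : nabla (K := K) f = 0) {g : F.obj X ⟶ F.obj Y}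
    (hg : g ∈ gr (K := K) (F.obj X) (F.obj Y) (n - 1))
    (h : F.map f.toPath = nabla (K := K) g) :
    ∃ f₁ ∈ gr (K := K) X Y (n - 1), ∃ g₁ ∈ gr (K := K) (F.obj X) (F.obj Y) (n - 2),
      nabla (K := K) f₁ = f ∧ F.map f₁.toPath - g = nabla (K := K) g₁ := by
  obtain ⟨f₁, hf₁, rfl⟩ : f ∈ coboundaries K X Y n :=
    hF₀.injective ⟨X, hX⟩ ⟨Y, hY⟩ n f ⟨hf, hf'⟩ ⟨g, hg, h.symm⟩
  have hG := F.isAInfty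
  have h' := hG.lin_nabla hX hY hf₁
  have hc : g - hG.lin X Y f₁ ∈ cocycles K (F.obj X) (F.obj Y) (n - 1) := by
    refine mem_cocycles.2 ⟨Submodule.sub_mem _ hg (hG.lin_mem hf₁), ?_⟩
    rw [map_sub, ← h', sub_eq_zero]
    exact h.symm
  -- A primitive of `f` is determined only up to a cocycle. Surjectivity on cohomology supplies the
  -- cocycle `f₂` which makes `f₁ + f₂` match `g` up to an exact term.
  obtain ⟨f₂, hf₂, g₁, hg₁, h₂⟩ :=
    hF₀.surjective ⟨X, hX⟩ ⟨Y, hY⟩ (n - 1) (g - hG.lin X Y f₁) hc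
  change X ⟶ Y at f₂
  change f₂ ∈ cocycles K X Y (n - 1) at hf₂
  change F.obj X ⟶ F.obj Y at g₁
  change nabla (K := K) g₁ = hG.lin X Y f₂ - (g - hG.lin X Y f₁) at h₂
  refine ⟨f₁ + f₂, Submodule.add_mem _ hf₁ hf₂.1, g₁, ?_, ?_, ?_⟩
  · rw [show n - 2 = n - 1 - 1 by ring]
    exact hg₁
  · rw [map_add, (mem_cocycles.1 hf₂).2, add_zero]
  · rw [h₂, ← hG.lin_apply, map_add]
    abel

/-- The cone of the extension of `F` to matrices is acyclic on leading terms. -/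
lemma exists_leading_primitive {A B : BddSeq K C} (hA : ∀ n, curv K (A.X n) = 0)
    (hB : ∀ n, curv K (B.X n) = 0) {n m : ℤ} {f : A ⟶ B} (hf : f ∈ gr (K := K) A B n)
    (hfm : f ∈ fil A B m) (hf' : nabla (K := K) f ∈ fil A B (m - 1))
    {g : F.mapSeq A ⟶ F.mapSeq B} (hg : g ∈ gr (K := K) (F.mapSeq A) (F.mapSeq B) (n - 1))
    (hgm : g ∈ fil (F.mapSeq A) (F.mapSeq B) m)
    (h : F.prime f.toPath - nabla (K := K) g ∈ fil (F.mapSeq A) (F.mapSeq B) (m - 1)) :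
    ∃ f₁ : A ⟶ B, ∃ g₁ : F.mapSeq A ⟶ F.mapSeq B, f₁ ∈ gr (K := K) A B (n - 1) ∧ f₁ ∈ fil A B m ∧
      g₁ ∈ gr (K := K) (F.mapSeq A) (F.mapSeq B) (n - 2) ∧ g₁ ∈ fil (F.mapSeq A) (F.mapSeq B) m ∧
      nabla (K := K) f₁ - f ∈ fil A B (m - 1) ∧
      F.prime f₁.toPath - g - nabla (K := K) g₁ ∈ fil (F.mapSeq A) (F.mapSeq B) (m - 1) := by
  obtain ⟨γ, hγe⟩ : ∃ γ : ∀ p q, F.obj (A.X p) ⟶ F.obj (B.X q), γ = g := ⟨g, rfl⟩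
  have hγ : ∀ p q, γ p q ∈ gr (K := K) (F.obj (A.X p)) (F.obj (B.X q)) (n - 1 - (q - p)) :=
    hγe ▸ hg
  -- Only the entries of internal degree exactly `m` matter modulo lower ones. There the problem is
  -- solved entry by entry, up to the sign in `prime_toPath`; all other entries are set to zero.
  have key : ∀ p q : ℤ, ∃ (f₁ : A.X p ⟶ B.X q) (g₁ : F.obj (A.X p) ⟶ F.obj (B.X q)),
      f₁ ∈ gr (K := K) (A.X p) (B.X q) (n - 1 - (q - p)) ∧
      g₁ ∈ gr (K := K) (F.obj (A.X p)) (F.obj (B.X q)) (n - 2 - (q - p)) ∧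
      (q - p = m → nabla (K := K) f₁ = f p q ∧
        (q - p).negOnePow • F.map f₁.toPath - γ p q = nabla (K := K) g₁) ∧
      (q - p ≠ m → f₁ = 0 ∧ g₁ = 0) := fun p q => by
    by_cases hm : q - p = m
    · have h1 : nabla (K := K) (f p q) = 0 := hf' p q (by omega)
      have h2 : (q - p).negOnePow • F.map (f p q).toPath - nabla (K := K)
          (γ p q) = 0 := by
        have := h p q (by omega)
        rw [BddSeq.sub_apply, ← hγe] at this
        rw [← prime_toPath]
        exact this
      have h3 : F.map (f p q).toPath = nabla (K := K)
          ((q - p).negOnePow • γ p q) := by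
        have e := nabla_units_smul (K := K)
          (q - p).negOnePow (γ p q)
        refine Eq.trans ?_ e.symm
        rw [← sub_eq_zero.1 h2, smul_smul, Int.units_mul_self, one_smul]
      obtain ⟨f₁, hf₁, g₁, hg₁, e₁, e₂⟩ := exists_cone_primitive hF₀ (hA p) (hB q) (hf p q) h1
        (g := (q - p).negOnePow • γ p q) (smul_mem_gr _ (by
          have := hγ p q
          rwa [sub_right_comm] at this)) h3
      refine ⟨f₁, (q - p).negOnePow • g₁, ?_, ?_, fun _ => ⟨e₁, ?_⟩, fun h => absurd hm h⟩
      · rwa [sub_right_comm]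
      · rw [sub_right_comm]
        exact smul_mem_gr _ hg₁
      · rw [nabla_units_smul, ← e₂, smul_sub]
        congr 1
        refine Eq.symm ((smul_smul _ _ _).trans ?_)
        rw [Int.units_mul_self]
        exact one_smul _ _
    · exact ⟨0, 0, Submodule.zero_mem _, Submodule.zero_mem _, fun h => absurd h hm,
        fun _ => ⟨rfl, rfl⟩⟩
  choose f₁ g₁ hf₁ hg₁ h1 h2 using key
  change A ⟶ B at f₁
  have hf₁m : (f₁ : A ⟶ B) ∈ fil A B m := fun p q hpq => (h2 p q (by omega)).1
  have hg₁m : (g₁ : F.mapSeq A ⟶ F.mapSeq B) ∈ fil (F.mapSeq A) (F.mapSeq B) m :=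
    fun p q hpq => (h2 p q (by omega)).2
  refine ⟨f₁, g₁, hf₁, hf₁m, hg₁, hg₁m, ?_, ?_⟩
  · intro p q hpq
    by_cases hm : q - p = m
    · exact sub_eq_zero.2 (h1 p q hm).1
    · exact Submodule.sub_mem _ (nabla_mem_fil hf₁m) hfm p q (by omega)
  · intro p q hpq
    by_cases hm : q - p = m
    · have h3 := (h1 p q hm).2
      rw [← prime_toPath, hγe] at h3
      exact sub_eq_zero.2 h3
    · exact Submodule.sub_mem _ (Submodule.sub_mem _ (F.prime_toPath_mem_fil hf₁m) hgm)
        (nabla_mem_fil hg₁m) p q (by omega)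

end Leading

section Minimal

variable [CDGCategory K C]

lemma IsProper.push_mem_fil [CurvedDG K D] {F : AInftyFunctor K C D} (hF : F.IsProper)
    {A : BddSeq K C} {ε : A ⟶ A} (hε : IsPretwist A ε) (h : ε ∈ fil A A (-1)) :
    F.push ε ∈ fil (F.mapSeq A) (F.mapSeq A) (-1) := by
  have := Submodule.add_mem _ (fil_mono (by norm_num) (hF.push_sub_prime_mem hε))
    (F.prime_toPath_mem_fil h)
  rwa [sub_add_cancel] at this

lemma IsProper.push₁_sub_prime_mem_fil [CurvedDG K D] {F : AInftyFunctor K C D} (hF : F.IsProper)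
    {A B : BddSeq K C} {ε : A ⟶ A} {ε' : B ⟶ B}
    (hε : IsPretwist A ε) (hε' : IsPretwist B ε') {f : A ⟶ B} {m : ℤ} (hf : f ∈ fil A B m) :
    F.push₁ ε ε' f - F.prime f.toPath ∈ fil (F.mapSeq A) (F.mapSeq B) (m - 1) :=
  hF.push₁_sub_prime_mem hε hε' fun r q h => by
    rw [hf r q h]
    exact Submodule.zero_mem _

variable [CDGCategory K D] {F : AInftyFunctor K C D} (hF : F.IsProper)
  (hF₀ : F.uncurved.IsQuasiFullyFaithful K)
include hF hF₀

/-- Acyclicity of the cone of `Tw(F)` on `Hom(A, B)`. The leading term of a cocycle of the cone is a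
cocycle for `F` itself, hence has a primitive; subtracting the differential of this primitive moves
the cocycle one filtration step down. The resulting induction is finite. -/
lemma IsProper.exists_primitive_of_isMinimal {A B : Tw K C} (hA : A.IsMinimal) (hB : B.IsMinimal)
    {n : ℤ} {f : A.seq ⟶ B.seq} (hf : f ∈ gr (K := K) A.seq B.seq n) (hf' : Tw.diff A B f = 0)
    {g : F.mapSeq A.seq ⟶ F.mapSeq B.seq}
    (hg : g ∈ gr (K := K) (F.mapSeq A.seq) (F.mapSeq B.seq) (n - 1))
    (h : F.push₁ A.δ B.δ f = Tw.diff ((F.twData hF.isTwisted_twDelta).obj A)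
      ((F.twData hF.isTwisted_twDelta).obj B) g) :
    ∃ f₁ ∈ gr (K := K) A.seq B.seq (n - 1),
      ∃ g₁ ∈ gr (K := K) (F.mapSeq A.seq) (F.mapSeq B.seq) (n - 2),
      Tw.diff A B f₁ = f ∧ F.push₁ A.δ B.δ f₁ - g = Tw.diff ((F.twData hF.isTwisted_twDelta).obj A)
      ((F.twData hF.isTwisted_twDelta).obj B) g₁ := by
  set G := F.twData hF.isTwisted_twDelta with hGdef
  have hG : G.IsAInfty K := hF.isAInfty_twData
  set L : (A.seq ⟶ B.seq) →ₗ[K] (F.mapSeq A.seq ⟶ F.mapSeq B.seq) := hG.lin A B with hL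
  set d : (F.mapSeq A.seq ⟶ F.mapSeq B.seq) →ₗ[K] (F.mapSeq A.seq ⟶ F.mapSeq B.seq) :=
    Tw.diff (G.obj A) (G.obj B) with hd
  have hLp : ∀ f, F.push₁ A.δ B.δ f = L f := fun f => (hF.twData_map_toPath f).symm
  have hLd : ∀ {n : ℤ} {f : A.seq ⟶ B.seq}, f ∈ gr (K := K) A.seq B.seq n →
      L (Tw.diff A B f) = d (L f) := fun {n f} hf => hG.lin_nabla (X := A) (Y := B) rfl rfl hf
  have hdd : ∀ g, d (d g) = 0 := fun g => Tw.diff_diff (G.obj A) (G.obj B) g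
  have hδ : ∀ {A : Tw K C}, A.IsMinimal → (G.obj A).δ ∈ fil (G.obj A).seq (G.obj A).seq (-1) :=
    fun {A} hA => by
      change F.twDelta A ∈ fil (F.mapSeq A.seq) (F.mapSeq A.seq) (-1)
      rw [hF.twDelta_eq]
      exact hF.push_mem_fil (isPretwist A) hA.mem_fil
  have hdm : ∀ {m : ℤ} {g : F.mapSeq A.seq ⟶ F.mapSeq B.seq},
      g ∈ fil (F.mapSeq A.seq) (F.mapSeq B.seq) m →
      d g - nabla (K := K) g ∈ fil (F.mapSeq A.seq) (F.mapSeq B.seq) (m - 1) :=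
    fun hg => Tw.diff_sub_nabla_mem (A := G.obj A) (B := G.obj B) (hδ hA) (hδ hB) hg
  have hLm : ∀ {m : ℤ} {f : A.seq ⟶ B.seq}, f ∈ fil A.seq B.seq m →
      L f - F.prime f.toPath ∈ fil (F.mapSeq A.seq) (F.mapSeq B.seq) (m - 1) := fun {m f} hf => by
    rw [← hLp]
    exact hF.push₁_sub_prime_mem_fil (isPretwist A) (isPretwist B) hf
  simp only [hLp] at h ⊢
  obtain ⟨m₀, hm₀⟩ := exists_le_fil A.seq B.seq
  obtain ⟨m₁, hm₁⟩ := exists_le_fil (F.mapSeq A.seq) (F.mapSeq B.seq)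
  have key : ∀ m : ℤ, min m₀ m₁ ≤ m → ∀ (f : A.seq ⟶ B.seq)
      (g : F.mapSeq A.seq ⟶ F.mapSeq B.seq), f ∈ gr (K := K) A.seq B.seq n → f ∈ fil A.seq B.seq m →
      Tw.diff A B f = 0 → g ∈ gr (K := K) (F.mapSeq A.seq) (F.mapSeq B.seq) (n - 1) →
      g ∈ fil (F.mapSeq A.seq) (F.mapSeq B.seq) m → L f = d g →
      ∃ f₁ ∈ gr (K := K) A.seq B.seq (n - 1),
        ∃ g₁ ∈ gr (K := K) (F.mapSeq A.seq) (F.mapSeq B.seq) (n - 2),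
        Tw.diff A B f₁ = f ∧ L f₁ - g = d g₁ := by
    intro m hm
    induction m, hm using Int.leInduction with
    | base =>
      intro f g _ hf _ _ hg _
      rw [hm₀ _ (min_le_left _ _), Submodule.mem_bot] at hf
      rw [hm₁ _ (min_le_right _ _), Submodule.mem_bot] at hg
      refine ⟨0, Submodule.zero_mem _, 0, Submodule.zero_mem _, ?_, ?_⟩
      · rw [hf, map_zero]
      · rw [hg, map_zero, map_zero, sub_zero]
    | succ m _ ih =>
      intro f g hf hfm hf' hg hgm h
      have e1 := Tw.diff_sub_nabla_mem hA.mem_fil hB.mem_fil hfm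
      have e2 : F.prime f.toPath - nabla (K := K) g ∈
          fil (F.mapSeq A.seq) (F.mapSeq B.seq) (m + 1 - 1) := by
        have := Submodule.sub_mem _ (hdm hgm) (hLm hfm)
        rw [h] at this
        convert this using 1
        abel
      rw [hf', zero_sub] at e1
      obtain ⟨f₀, g₀, hf₀, hf₀m, hg₀, hg₀m, c1, c2⟩ := exists_leading_primitive hF₀
        hA.curv_eq_zero hB.curv_eq_zero hf hfm (by simpa using Submodule.neg_mem _ e1) hg hgm e2
      rw [add_sub_cancel_right] at c1 c2
      have e3 := Tw.diff_sub_nabla_mem hA.mem_fil hB.mem_fil hf₀m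
      have e4 := hdm hg₀m
      have e5 := hLm hf₀m
      rw [add_sub_cancel_right] at e3 e4 e5
      have d1 : Tw.diff A B f₀ ∈ gr (K := K) A.seq B.seq n := by
        have := nabla_mem (K := K) (X := A) (Y := B) hf₀
        rwa [sub_add_cancel] at this
      have d2 : d g₀ ∈ gr (K := K) (F.mapSeq A.seq) (F.mapSeq B.seq) (n - 1) := by
        have := nabla_mem (K := K) (X := G.obj A) (Y := G.obj B) hg₀
        rwa [show n - 2 + 1 = n - 1 by ring] at this
      -- The pair `(f, g)` minus the cone differential of `(f₀, g₀)`.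
      obtain ⟨f₁, hf₁, g₁, hg₁, i1, i2⟩ := ih (f - Tw.diff A B f₀) (g - L f₀ + d g₀)
        (Submodule.sub_mem _ hf d1) (by
          have := Submodule.neg_mem _ (Submodule.add_mem _ c1 e3)
          convert this using 1
          abel) (by rw [map_sub, hf', Tw.diff_diff, sub_zero])
        (Submodule.add_mem _ (Submodule.sub_mem _ hg (hG.lin_mem (X := A) (Y := B) hf₀)) d2) (by
          have := Submodule.sub_mem _ (Submodule.sub_mem _ e4 c2) e5
          convert this using 1
          abel) (by rw [map_sub, hLd hf₀, h, map_add, map_sub, hdd, add_zero])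
      refine ⟨f₀ + f₁, Submodule.add_mem _ hf₀ hf₁, g₀ + g₁, Submodule.add_mem _ hg₀ hg₁, ?_, ?_⟩
      · rw [map_add, i1, add_sub_cancel]
      · rw [map_add, map_add, ← i2]
        abel
  -- By non-negativity the total degree bounds the internal degree from above, so level `n` contains
  -- both `f` and `g`.
  exact key (max (min m₀ m₁) n) (le_max_left _ _) f g hf
    (fil_mono (le_max_right _ _) (mem_fil_of_mem_gr hf)) hf' hg
    (fil_mono ((sub_le_self n zero_le_one).trans (le_max_right _ _)) (mem_fil_of_mem_gr hg)) h

lemma IsProper.isQuasiIsoOn_of_isMinimal {A B : Tw K C} (hA : A.IsMinimal) (hB : B.IsMinimal) :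
    (F.twData hF.isTwisted_twDelta).IsQuasiIsoOn K A B := by
  have hG : (F.twData hF.isTwisted_twDelta).IsAInfty K := hF.isAInfty_twData
  constructor
  · rintro n f hf ⟨g, hg, h⟩
    obtain ⟨f₁, hf₁, -, -, h₁, -⟩ := hF.exists_primitive_of_isMinimal hF₀ hA hB (mem_cocycles.1 hf).1
      (mem_cocycles.1 hf).2 hg ((hF.twData_map_toPath f).symm.trans h.symm)
    exact ⟨f₁, hf₁, h₁⟩
  · intro n g hg
    have hz : F.push₁ A.δ B.δ (0 : A.seq ⟶ B.seq) = 0 :=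
      (hF.twData_map_toPath 0).symm.trans (map_zero (hG.lin A B))
    -- Surjectivity is acyclicity of the cone at the cocycle `(0, g)`, whose first component has
    -- degree `n + 1`.
    obtain ⟨f₁, hf₁, g₁, hg₁, h₁, h₂⟩ := hF.exists_primitive_of_isMinimal hF₀ hA hB
      (n := n + 1) (f := 0) (Submodule.zero_mem _) (map_zero _) (g := g)
      (by rw [add_sub_cancel_right]; exact (mem_cocycles.1 hg).1)
      (hz.trans (mem_cocycles.1 hg).2.symm)
    rw [add_sub_cancel_right] at hf₁
    rw [show n + 1 - 2 = n - 1 by ring] at hg₁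
    refine ⟨f₁, mem_cocycles.2 ⟨hf₁, h₁⟩, g₁, hg₁, ?_⟩
    rw [hF.twData_map_toPath]
    exact h₂.symm

end Minimal

end AInftyFunctor

/-! ## Invertible matrices -/

namespace BddSeq

section Invertible

variable {K : Type w} [CommRing K] {C : Type u} [Category.{v} C] [Preadditive C] [Linear K C]
  [CurvedDG K C]

lemma pow_mem_gr {A : BddSeq K C} {f : End A} (hf : f ∈ gr (K := K) A A 0) (k : ℕ) :
    (f ^ k : End A) ∈ gr (K := K) A A 0 := by
  induction k with
  | zero => exact id_mem A
  | succ k ih =>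
    rw [pow_succ]
    simpa using comp_mem hf ih

lemma pow_mem_fil {A : BddSeq K C} {f : End A} {m : ℤ} (hf : f ∈ fil A A m) (k : ℕ) :
    (f ^ k : End A) ∈ fil A A (k * m) := by
  induction k with
  | zero => simpa using id_mem_fil A
  | succ k ih =>
    rw [pow_succ, show ((k + 1 : ℕ) : ℤ) * m = m + k * m by push_cast; ring]
    exact comp_mem_fil hf ih

lemma exists_pow_eq_zero {A : BddSeq K C} {f : End A} (hf : f ∈ fil A A (-1)) :
    ∃ N : ℕ, f ^ N = 0 := by
  obtain ⟨m, hm⟩ := exists_le_fil A A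
  refine ⟨m.natAbs, ?_⟩
  have h := pow_mem_fil hf m.natAbs
  rwa [hm _ (by omega), Submodule.mem_bot] at h

/-- Matrices that are congruent to the identity modulo the filtration are invertible. -/
lemma exists_inverse {A : BddSeq K C} {f : A ⟶ A} (hf : f ∈ gr (K := K) A A 0)
    (h : f - 𝟙 A ∈ fil A A (-1)) : ∃ g ∈ gr (K := K) A A 0, g - 𝟙 A ∈ fil A A (-1) ∧
      f ≫ g = 𝟙 A ∧ g ≫ f = 𝟙 A := by
  let x : End A := 𝟙 A - f
  have hx : x ∈ gr (K := K) A A 0 := Submodule.sub_mem _ (id_mem A) hf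
  have hx' : x ∈ fil A A (-1) := by
    have := Submodule.neg_mem _ h
    rwa [neg_sub] at this
  obtain ⟨N, hN⟩ := exists_pow_eq_zero hx'
  let g : End A := ∑ i ∈ Finset.range N, x ^ i
  have e1 : (1 - x) * g = 1 := by rw [mul_neg_geom_sum, hN, sub_zero]
  have e2 : g * (1 - x) = 1 := by rw [geom_sum_mul_neg, hN, sub_zero]
  have e3 : (1 - x : End A) = f := sub_sub_cancel (𝟙 A) f
  rw [e3] at e1 e2
  have hg : g ∈ fil A A 0 := Submodule.sum_mem _ fun i _ =>
    fil_mono (by simp) (pow_mem_fil hx' i)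
  refine ⟨g, Submodule.sum_mem _ fun i _ => pow_mem_gr hx i, ?_, e2, e1⟩
  change (show A ⟶ A from g) - 𝟙 A ∈ fil A A (-1)
  have e4 : (show A ⟶ A from g) - 𝟙 A = (show A ⟶ A from g) ≫ (𝟙 A - f) := by
    rw [Preadditive.comp_sub, Category.comp_id]
    exact congrArg₂ _ rfl (Eq.symm e1)
  rw [e4]
  exact comp_mem_fil hg hx'

/-- Diagonal matrices. -/
def diagHom {A B : BddSeq K C} (φ : ∀ p, A.X p ⟶ B.X p) : A ⟶ B := fun p q =>
  if h : p = q then φ p ≫ eqToHom (congrArg B.X h) else 0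

lemma diagHom_self {A B : BddSeq K C} (φ : ∀ p, A.X p ⟶ B.X p) (p : ℤ) :
    diagHom φ p p = φ p := by
  simp [diagHom]

lemma diagHom_ne {A B : BddSeq K C} (φ : ∀ p, A.X p ⟶ B.X p) {p q : ℤ} (h : p ≠ q) :
    diagHom φ p q = 0 := by
  simp [diagHom, h]

lemma diagHom_mem {A B : BddSeq K C} {φ : ∀ p, A.X p ⟶ B.X p}
    (h : ∀ p, φ p ∈ gr (K := K) (A.X p) (B.X p) 0) : diagHom φ ∈ gr (K := K) A B 0 := fun p q => by
  by_cases hpq : p = q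
  · subst hpq
    rw [diagHom_self, sub_self, sub_zero]
    exact h p
  · rw [diagHom_ne φ hpq]
    exact Submodule.zero_mem _

lemma diagHom_mem_fil {A B : BddSeq K C} (φ : ∀ p, A.X p ⟶ B.X p) : diagHom φ ∈ fil A B 0 :=
  fun p q h => diagHom_ne φ (by omega)

lemma comp_diagHom {A B D : BddSeq K C} (f : A ⟶ B) (φ : ∀ p, B.X p ⟶ D.X p) (p r : ℤ) :
    (f ≫ diagHom φ) p r = f p r ≫ φ r := by
  rw [comp_apply, sum_eq_single_supp _ r]
  · rw [diagHom_self, sub_self, twist_zero]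
  · intro q hq
    rw [diagHom_ne φ hq, comp_zero]
  · intro h
    exact (h.eq_of_tgt (f p r) 0) ▸ by rw [map_zero, zero_comp]

lemma diagHom_comp {A B D : BddSeq K C} {φ : ∀ p, A.X p ⟶ B.X p}
    (h : ∀ p, φ p ∈ gr (K := K) (A.X p) (B.X p) 0) (f : B ⟶ D) (p r : ℤ) :
    (diagHom φ ≫ f) p r = φ p ≫ f p r := by
  rw [comp_apply, sum_eq_single_supp _ p]
  · rw [diagHom_self, twist_of_mem _ (h p), mul_zero, Int.negOnePow_zero, one_smul]
  · intro q hq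
    rw [diagHom_ne φ hq.symm, map_zero, zero_comp]
  · intro hz
    rw [hz.eq_of_src (f p r) 0, comp_zero]

lemma nabla_diagHom {A B : BddSeq K C} (φ : ∀ p, A.X p ⟶ B.X p) :
    nabla (K := K) (diagHom φ) = diagHom fun p => nabla (K := K) (φ p) := by
  ext p q
  rw [nabla_apply]
  by_cases hpq : p = q
  · subst hpq
    rw [diagHom_self, diagHom_self]
  · rw [diagHom_ne _ hpq, diagHom_ne _ hpq, map_zero]

lemma diagHom_mem_cocycles {A B : BddSeq K C} {φ : ∀ p, A.X p ⟶ B.X p}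
    (h : ∀ p, φ p ∈ cocycles K (A.X p) (B.X p) 0) : diagHom φ ∈ cocycles K A B 0 := by
  refine mem_cocycles.2 ⟨diagHom_mem fun p => (h p).1, ?_⟩
  rw [nabla_diagHom]
  ext p q
  by_cases hpq : p = q
  · subst hpq
    rw [diagHom_self]
    exact (h p).2
  · exact diagHom_ne _ hpq

lemma diagHom_eq_id {A : BddSeq K C} : diagHom (fun p => 𝟙 (A.X p)) = 𝟙 A := rfl

lemma diagHom_comp_diagHom {A B D : BddSeq K C} {φ : ∀ p, A.X p ⟶ B.X p}
    (h : ∀ p, φ p ∈ gr (K := K) (A.X p) (B.X p) 0) (ψ : ∀ p, B.X p ⟶ D.X p) :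
    diagHom φ ≫ diagHom ψ = diagHom fun p => φ p ≫ ψ p := by
  ext p q
  rw [diagHom_comp h]
  by_cases hpq : p = q
  · subst hpq
    rw [diagHom_self, diagHom_self]
  · rw [diagHom_ne _ hpq, diagHom_ne _ hpq, comp_zero]

lemma curv_eq_zero {A : BddSeq K C} (h : ∀ n, curv K (A.X n) = 0) : curv K A = 0 := by
  ext p q
  rw [curv_eq]
  by_cases hpq : p = q
  · subst hpq
    rw [diag_self, h]
    rfl
  · rw [diag_ne _ _ hpq]
    rfl

end Invertible

end BddSeq

namespace CurvedDG

/-- Differentiating `f ≫ g = 𝟙` with `f` closed and invertible shows that `g` is closed. -/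
lemma homotopyEquivalent_of_inverse {K : Type w} [CommRing K] {C : Type u} [Category.{v} C]
    [Preadditive C] [Linear K C] [CurvedDG K C] {X Y : C} {f : X ⟶ Y} {g : Y ⟶ X}
    (hf : f ∈ cocycles K X Y 0) (hg : g ∈ gr (K := K) Y X 0) (h : f ≫ g = 𝟙 X)
    (h' : g ≫ f = 𝟙 Y) : HomotopyEquivalent K X Y := by
  have hd : nabla (K := K) g = 0 := by
    have e := leibniz f hg
    rw [h, nabla_id, (mem_cocycles.1 hf).2, zero_comp, smul_zero, add_zero] at e
    rw [← Category.id_comp (nabla (K := K) g), ← h', Category.assoc, ← e, comp_zero]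
  exact ⟨f, hf, g, mem_cocycles.2 ⟨hg, hd⟩, by rw [h, sub_self]; exact Submodule.zero_mem _,
    by rw [h', sub_self]; exact Submodule.zero_mem _⟩

end CurvedDG

/-! ## Essential surjectivity onto minimal twisted complexes -/

namespace AInftyFunctor

open Quiver AInfty BddSeq

variable {K : Type w} [CommRing K]
  {C : Type u₁} [Category.{v₁} C] [Preadditive C] [Linear K C] [CDGCategory K C]
  {D : Type u₂} [Category.{v₂} D] [Preadditive D] [Linear K D] [CDGCategory K D]
  {F : AInftyFunctor K C D}

/-- Uncurved objects of the target are isomorphic, by closed morphisms, to images of uncurved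
objects. -/
lemma exists_obj_iso (h₀ : F.uncurved.IsQuasiEssSurj K) {Y : D} (hY : curv K Y = 0) :
    ∃ X : C, curv K X = 0 ∧ (IsZero Y → IsZero X) ∧ ∃ θ ∈ cocycles K (F.obj X) Y 0,
      ∃ θ' ∈ cocycles K Y (F.obj X) 0, θ ≫ θ' = 𝟙 _ ∧ θ' ≫ θ = 𝟙 _ := by
  -- Zero objects are lifted to zero objects, so that a lifted sequence is again bounded.
  by_cases hz : IsZero Y
  · obtain ⟨Z, hZ⟩ := (CDGCategory.hasZeroObject (K := K) (C := C)).zero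
    exact ⟨Z, hZ.eq_of_src _ _, fun _ => hZ, 0, Submodule.zero_mem _, 0, Submodule.zero_mem _,
      (F.isZero_obj hZ).eq_of_src _ _, hz.eq_of_src _ _⟩
  · obtain ⟨X, f, hf, g, hg, ⟨h₁, hh₁, e₁⟩, h₂, hh₂, e₂⟩ := h₀ ⟨Y, hY⟩
    -- The homotopies have degree -1 and therefore vanish: a homotopy equivalence of uncurved
    -- objects is an isomorphism.
    have z₁ : h₁ = 0 := by
      have : h₁ ∈ gr (K := K) (F.obj X.of) (F.obj X.of) (0 - 1) := hh₁
      rw [CDGCategory.gr_neg _ _ _ (by norm_num)] at this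
      exact (Submodule.mem_bot K).1 this
    have z₂ : h₂ = 0 := by
      have : h₂ ∈ gr (K := K) Y Y (0 - 1) := hh₂
      rw [CDGCategory.gr_neg _ _ _ (by norm_num)] at this
      exact (Submodule.mem_bot K).1 this
    rw [z₁, map_zero] at e₁
    rw [z₂, map_zero] at e₂
    exact ⟨X.of, X.curv_eq_zero, fun h => absurd h hz, f, hf, g, hg, (sub_eq_zero.1 e₁.symm),
      (sub_eq_zero.1 e₂.symm)⟩

/-- The Maurer-Cartan expression. -/
noncomputable def mcTerm {C : Type u} [Category.{v} C] [Preadditive C] [Linear K C]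
    [CurvedDG K C] {A : BddSeq K C} (ε : A ⟶ A) : A ⟶ A :=
  nabla (K := K) ε + ε ≫ ε + curv K A

lemma mcTerm_mem {C : Type u} [Category.{v} C] [Preadditive C] [Linear K C]
    [CurvedDG K C] {A : BddSeq K C} {ε : A ⟶ A} (hε : ε ∈ gr (K := K) A A 1) :
    mcTerm ε ∈ gr (K := K) A A 2 := by
  have h1 := nabla_mem hε
  have h2 := comp_mem hε hε
  rw [one_add_one_eq_two] at h1 h2
  exact Submodule.add_mem _ (Submodule.add_mem _ h1 h2) (curv_mem A)

/-- The defect of `φ` to be a closed morphism. -/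
noncomputable def defect (F : AInftyFunctor K C D) {A : BddSeq K C} {B : BddSeq K D} (δ : B ⟶ B)
    (ε : A ⟶ A) (φ : F.mapSeq A ⟶ B) : F.mapSeq A ⟶ B :=
  nabla (K := K) φ + φ ≫ δ - F.push ε ≫ φ

lemma isPretwist_of_mem_fil {C : Type u} [Category.{v} C] [Preadditive C] [Linear K C]
    [CurvedDG K C] {A : BddSeq K C} {ε : A ⟶ A} (hε : ε ∈ gr (K := K) A A 1)
    (h : ε ∈ fil A A (-1)) : IsPretwist A ε := ⟨hε, fun p => h p p (by simp)⟩

lemma leibniz_one {C : Type u} [Category.{v} C] [Preadditive C] [Linear K C]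
    [CurvedDG K C] {X Y Z : C} (f : X ⟶ Y) {g : Y ⟶ Z} (hg : g ∈ gr (K := K) Y Z 1) :
    nabla (K := K) (f ≫ g) = f ≫ nabla (K := K) g - nabla (K := K) f ≫ g := by
  rw [leibniz f hg, Int.negOnePow_one, Units.neg_smul, one_smul, sub_eq_add_neg]

lemma leibniz_zero {C : Type u} [Category.{v} C] [Preadditive C] [Linear K C]
    [CurvedDG K C] {X Y Z : C} (f : X ⟶ Y) {g : Y ⟶ Z} (hg : g ∈ gr (K := K) Y Z 0) :
    nabla (K := K) (f ≫ g) = f ≫ nabla (K := K) g + nabla (K := K) f ≫ g := by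
  rw [leibniz f hg, Int.negOnePow_zero, one_smul]

/-- The Bianchi identity. -/
lemma nabla_mcTerm {C : Type u} [Category.{v} C] [Preadditive C] [Linear K C]
    [CurvedDG K C] {A : BddSeq K C} (hA : curv K A = 0) {ε : A ⟶ A} (hε : ε ∈ gr (K := K) A A 1) :
    nabla (K := K) (mcTerm ε) = ε ≫ mcTerm ε - mcTerm ε ≫ ε := by
  simp only [mcTerm, hA, map_add, leibniz_one ε hε, nabla_nabla, Preadditive.comp_add,
    Preadditive.add_comp, comp_zero, zero_comp, map_zero, Category.assoc]
  abel

/-- The defect is the twisted differential of `φ`, so its own twisted differential would vanish if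
`ε` satisfied the Maurer-Cartan equation. The last term is the image of the Maurer-Cartan expression
of `ε`. -/
lemma IsProper.nabla_defect (hF : F.IsProper) {A : BddSeq K C} {B : BddSeq K D}
    (hA : curv K (F.mapSeq A) = 0) (hB : curv K B = 0) {δ : B ⟶ B} (hδ : δ ∈ gr (K := K) B B 1)
    (hδ' : mcTerm δ = 0) {ε : A ⟶ A} (hε : IsPretwist A ε) {φ : F.mapSeq A ⟶ B}
    (hφ : φ ∈ gr (K := K) _ _ 0) : nabla (K := K) (F.defect δ ε φ) =
      -(F.defect δ ε φ ≫ δ + F.push ε ≫ F.defect δ ε φ) - F.push₁ ε ε (mcTerm ε) ≫ φ := by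
  have m1 := hF.push_maurerCartan hε
  rw [mcTerm, hB, add_zero] at hδ'
  rw [hA, add_zero] at m1
  have m3 : F.push₁ ε ε (mcTerm ε) = nabla (K := K) (F.push ε) + F.push ε ≫ F.push ε := m1.symm
  rw [m3, defect, map_sub, map_add, leibniz_one φ hδ, leibniz_zero (F.push ε) hφ,
    nabla_nabla, hA, hB, eq_neg_of_add_eq_zero_left hδ']
  simp only [Preadditive.comp_add, Preadditive.add_comp, comp_zero, zero_comp,
    Preadditive.comp_sub, Preadditive.sub_comp, Preadditive.comp_neg, Category.assoc]
  abel

variable (hF : F.IsProper) (hF₀ : F.uncurved.IsQuasiFullyFaithful K)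
include hF hF₀

/-- One step of the construction of a twisted complex with prescribed image. -/
lemma IsProper.exists_lift_succ {A : BddSeq K C} (hA : ∀ n, curv K (A.X n) = 0) {Y : Tw K D}
    (hY : Y.IsMinimal) {θ : F.mapSeq A ⟶ Y.seq} {θ' : Y.seq ⟶ F.mapSeq A}
    (hθ : θ ∈ cocycles K _ _ 0) (hθ' : θ' ∈ cocycles K _ _ 0) (e : θ ≫ θ' = 𝟙 _)
    (e' : θ' ≫ θ = 𝟙 _) {M : ℤ} (hM : M ≤ -1) {ε : A ⟶ A} {φ : F.mapSeq A ⟶ Y.seq}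
    (hε : ε ∈ gr (K := K) A A 1) (hεm : ε ∈ fil A A (-1)) (hφ : φ ∈ gr (K := K) _ _ 0)
    (hφm : φ - θ ∈ fil _ _ (-1)) (h₁ : mcTerm ε ∈ fil A A M)
    (h₂ : F.defect Y.δ ε φ ∈ fil _ _ M) :
    ∃ (ε' : A ⟶ A) (φ' : F.mapSeq A ⟶ Y.seq), ε' ∈ gr (K := K) A A 1 ∧ ε' ∈ fil A A (-1) ∧
      φ' ∈ gr (K := K) _ _ 0 ∧ φ' - θ ∈ fil _ _ (-1) ∧ mcTerm ε' ∈ fil A A (M - 1) ∧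
      F.defect Y.δ ε' φ' ∈ fil _ _ (M - 1) := by
  have hPε := isPretwist_of_mem_fil hε hεm
  have hcA := curv_eq_zero hA
  have hcY := curv_eq_zero hY.curv_eq_zero
  have hcF : curv K (F.mapSeq A) = 0 := by
    rw [← F.prime_curv, hcA]
    exact (F.multiLin_prime A A).cons_zero .nil
  have hθm : θ ∈ fil _ _ 0 := mem_fil_of_mem_gr hθ.1
  have hθm' : θ' ∈ fil _ _ 0 := mem_fil_of_mem_gr hθ'.1
  have hφ0 : φ ∈ fil _ _ 0 := mem_fil_of_mem_gr hφ
  set p := F.push ε with hp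
  have hpg : p ∈ gr (K := K) _ _ 1 := hF.push_mem hPε
  have hpm : p ∈ fil _ _ (-1) := hF.push_mem_fil hPε hεm
  set Φ := F.defect Y.δ ε φ with hΦ
  have hmg : mcTerm ε ∈ gr (K := K) A A 2 := mcTerm_mem hε
  have hΦg : Φ ∈ gr (K := K) _ _ 1 := by
    have k1 : nabla (K := K) φ ∈ gr (K := K) _ _ 1 := by simpa using nabla_mem hφ
    have k2 : φ ≫ Y.δ ∈ gr (K := K) _ _ 1 := by simpa using comp_mem hφ Y.isTwisted.mem
    have k3 : p ≫ φ ∈ gr (K := K) _ _ 1 := by simpa using comp_mem hpg hφ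
    exact Submodule.sub_mem _ (Submodule.add_mem _ k1 k2) k3
  have c1 := nabla_mcTerm hcA hε
  have c2 : nabla (K := K) Φ = -(Φ ≫ Y.δ + p ≫ Φ) - F.push₁ ε ε (mcTerm ε) ≫ φ :=
    hF.nabla_defect hcF hcY Y.isTwisted.mem Y.isTwisted.maurerCartan hPε hφ
  have hg : Φ ≫ θ' ∈ gr (K := K) _ _ 1 := by simpa using comp_mem hΦg hθ'.1
  have hgm : Φ ≫ θ' ∈ fil _ _ M := by simpa using comp_mem_fil h₂ hθm'
  have hL : ∀ f : A ⟶ A, F.prime f.toPath = (F.multiLin_prime A A).lastHom .nil f := fun _ => rfl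
  -- The obstruction is the pair `(-mcTerm ε, Φ ≫ θ')`. To leading order it is a cocycle of the cone
  -- of `F`, by the Bianchi identity and by `nabla_defect`; its primitive `(α, β)` gives the
  -- corrections of `ε` and `φ`.
  obtain ⟨α, β, hα, hαm, hβ, hβm, d1, d2⟩ := exists_leading_primitive hF₀ hA hA
    (f := -mcTerm ε) (g := Φ ≫ θ') (n := 2) (m := M) (Submodule.neg_mem _ hmg)
    (Submodule.neg_mem _ h₁) (by
      have j1 := comp_mem_fil hεm h₁
      rw [neg_add_eq_sub] at j1
      have j := Submodule.neg_mem _ (Submodule.sub_mem _ j1 (comp_mem_fil h₁ hεm))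
      rw [map_neg, c1]
      exact j) hg hgm (by
      have i1 : Φ ≫ Y.δ ∈ fil _ _ (M - 1) := comp_mem_fil h₂ hY.mem_fil
      have i2 : p ≫ Φ ∈ fil _ _ (M - 1) := by
        rw [sub_eq_neg_add]
        exact comp_mem_fil hpm h₂
      have i3 := hF.push₁_sub_prime_mem_fil hPε hPε h₁
      have i4 := F.prime_toPath_mem_fil h₁
      have i5 : (φ - θ) ≫ θ' ∈ fil _ _ (-1) := by simpa using comp_mem_fil hφm hθm'
      have i6 : F.prime (-mcTerm ε).toPath - nabla (K := K) (Φ ≫ θ') =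
          (Φ ≫ Y.δ + p ≫ Φ) ≫ θ' +
          (F.push₁ ε ε (mcTerm ε) - F.prime (mcTerm ε).toPath) ≫ φ ≫ θ' +
          F.prime (mcTerm ε).toPath ≫ (φ - θ) ≫ θ' := by
        rw [leibniz_zero Φ hθ'.1, (mem_cocycles.1 hθ').2, comp_zero, zero_add, c2, hL, map_neg, ← hL]
        simp only [Preadditive.add_comp, Preadditive.comp_sub, Preadditive.sub_comp,
          Preadditive.neg_comp, Category.assoc, e, Category.comp_id]
        abel
      have j1 := comp_mem_fil (Submodule.add_mem _ i1 i2) hθm'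
      have j2 := comp_mem_fil i3 (comp_mem_fil hφ0 hθm')
      have j3 := comp_mem_fil i4 i5
      rw [add_zero] at j1
      rw [add_zero, add_zero] at j2
      have j := Submodule.add_mem _ (Submodule.add_mem _ j1 j2) j3
      rw [i6]
      exact j)
  have hα1 : α ∈ gr (K := K) A A 1 := hα
  have hαm1 : α ∈ fil A A (-1) := fil_mono hM hαm
  have hβ0 : β ∈ gr (K := K) (F.mapSeq A) (F.mapSeq A) 0 := hβ
  have hεα : ε + α ∈ gr (K := K) A A 1 := Submodule.add_mem _ hε hα1
  have hεαm : ε + α ∈ fil A A (-1) := Submodule.add_mem _ hεm hαm1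
  have hPεα := isPretwist_of_mem_fil hεα hεαm
  have hβθ : β ≫ θ ∈ gr (K := K) _ _ 0 := by simpa using comp_mem hβ0 hθ.1
  have hβθm : β ≫ θ ∈ fil _ _ M := by simpa using comp_mem_fil hβm hθm
  have hφβ : φ + β ≫ θ ∈ gr (K := K) (F.mapSeq A) Y.seq 0 := Submodule.add_mem _ hφ hβθ
  have hφβm : φ + β ≫ θ - θ ∈ fil (F.mapSeq A) Y.seq (-1) := by
    have j := Submodule.add_mem _ hφm (fil_mono hM hβθm)
    rw [← add_sub_right_comm] at j
    exact j
  -- To leading order the Maurer-Cartan expression changes by `∇α` and the defect by `(∇β - F'(α)) ≫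
  -- θ`. These cancel the old errors by `d1` and `d2`.
  refine ⟨ε + α, φ + β ≫ θ, hεα, hεαm, hφβ, hφβm, ?_, ?_⟩
  · have i1 : ε ≫ α ∈ fil A A (M - 1) := by
      rw [sub_eq_neg_add]
      exact comp_mem_fil hεm hαm
    have i2 : α ≫ ε ∈ fil A A (M - 1) := comp_mem_fil hαm hεm
    have i3 : α ≫ α ∈ fil A A (M - 1) := comp_mem_fil hαm hαm1
    have i4 : mcTerm (ε + α) = nabla (K := K) α - -mcTerm ε + (ε ≫ α + α ≫ ε + α ≫ α) := by
      simp only [mcTerm, map_add, Preadditive.comp_add, Preadditive.add_comp]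
      abel
    rw [i4]
    exact Submodule.add_mem _ d1 (Submodule.add_mem _ (Submodule.add_mem _ i1 i2) i3)
  · have i1 : (β ≫ θ) ≫ Y.δ ∈ fil _ _ (M - 1) := comp_mem_fil hβθm hY.mem_fil
    have i2 : F.push (ε + α) ≫ β ≫ θ ∈ fil _ _ (M - 1) := by
      rw [sub_eq_neg_add]
      exact comp_mem_fil (hF.push_mem_fil hPεα hεαm) hβθm
    have i3 := hF.push₁_sub_prime_mem_fil hPεα hPε hαm
    have i4 := hF.push_sub_push hPε hPεα
    rw [add_sub_cancel_left] at i4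
    have i5 := comp_mem_fil (F.prime_toPath_mem_fil hαm) hφm
    have i6 : F.defect Y.δ (ε + α) (φ + β ≫ θ) =
        -((F.prime α.toPath - Φ ≫ θ' - nabla (K := K) β) ≫ θ) + (β ≫ θ) ≫ Y.δ -
          F.push (ε + α) ≫ β ≫ θ - (F.push₁ (ε + α) ε α - F.prime α.toPath) ≫ φ -
          F.prime α.toPath ≫ (φ - θ) := by
      rw [← i4, hΦ, defect, defect, map_add, leibniz_zero β hθ.1, (mem_cocycles.1 hθ).2]
      simp only [Preadditive.comp_add, Preadditive.add_comp, comp_zero,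
        Preadditive.comp_sub, Preadditive.sub_comp, Category.assoc, e', Category.comp_id]
      abel
    have j1 := comp_mem_fil d2 hθm
    have j2 := comp_mem_fil i3 hφ0
    rw [add_zero] at j1 j2
    have j := Submodule.sub_mem _ (Submodule.sub_mem _ (Submodule.sub_mem _ (Submodule.add_mem _
      (Submodule.neg_mem _ j1) i1) i2) j2) i5
    rw [i6]
    exact j

/-- Start with zero differential and the termwise isomorphism `Θ`, and improve both until the errors
leave the finite filtration. The resulting closed map is congruent to `Θ`, hence invertible. -/
lemma IsProper.exists_homotopyEquivalent_of_isMinimal (h₀ : F.uncurved.IsQuasiEssSurj K)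
    {Y : Tw K D} (hY : Y.IsMinimal) :
    ∃ X : Tw K C, HomotopyEquivalent K ((F.twData hF.isTwisted_twDelta).obj X) Y := by
  choose X hX hXz θ hθ θ' hθ' e e' using fun n => exists_obj_iso h₀ (hY.curv_eq_zero n)
  let A : BddSeq K C := ⟨X, Y.seq.finite.subset fun n hn h => hn (hXz n h)⟩
  let Θ : F.mapSeq A ⟶ Y.seq := diagHom (A := F.mapSeq A) (B := Y.seq) θ
  let Θ' : Y.seq ⟶ F.mapSeq A := diagHom (A := Y.seq) (B := F.mapSeq A) θ'
  have hΘ : Θ ∈ cocycles K _ _ 0 := diagHom_mem_cocycles hθ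
  have hΘ' : Θ' ∈ cocycles K _ _ 0 := diagHom_mem_cocycles hθ'
  have eΘ : Θ ≫ Θ' = 𝟙 _ := by
    refine (diagHom_comp_diagHom (fun p => (hθ p).1) _).trans ?_
    rw [← diagHom_eq_id]
    congr 1
    funext p
    exact e p
  have eΘ' : Θ' ≫ Θ = 𝟙 _ := by
    refine (diagHom_comp_diagHom (fun p => (hθ' p).1) _).trans ?_
    rw [← diagHom_eq_id]
    congr 1
    funext p
    exact e' p
  have key : ∀ m : ℕ, ∃ (ε : A ⟶ A) (φ : F.mapSeq A ⟶ Y.seq), ε ∈ gr (K := K) A A 1 ∧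
      ε ∈ fil A A (-1) ∧ φ ∈ gr (K := K) _ _ 0 ∧ φ - Θ ∈ fil _ _ (-1) ∧
      mcTerm ε ∈ fil A A (-1 - m) ∧ F.defect Y.δ ε φ ∈ fil _ _ (-1 - m) := by
    intro m
    induction m with
    | zero =>
      have hz : IsPretwist A (0 : A ⟶ A) := ⟨Submodule.zero_mem _, fun _ => rfl⟩
      refine ⟨0, Θ, Submodule.zero_mem _, Submodule.zero_mem _, hΘ.1, ?_, ?_, ?_⟩
      · rw [sub_self]
        exact Submodule.zero_mem _
      · rw [mcTerm, map_zero, curv_eq_zero hX, zero_comp, add_zero, add_zero]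
        exact Submodule.zero_mem _
      · have hΘm : Θ ∈ fil _ _ 0 := mem_fil_of_mem_gr hΘ.1
        rw [defect, (mem_cocycles.1 hΘ).2, zero_add, Nat.cast_zero, sub_zero]
        refine Submodule.sub_mem _ ?_ ?_
        · simpa using comp_mem_fil hΘm hY.mem_fil
        · simpa using comp_mem_fil (hF.push_mem_fil hz (Submodule.zero_mem _)) hΘm
    | succ m ih =>
      obtain ⟨ε, φ, hε, hεm, hφ, hφm, h₁, h₂⟩ := ih
      obtain ⟨ε', φ', h⟩ := hF.exists_lift_succ hF₀ hX hY hΘ hΘ' eΘ eΘ' (by omega) hε hεm hφ hφm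
        h₁ h₂
      refine ⟨ε', φ', ?_⟩
      rwa [show (-1 - ((m + 1 : ℕ) : ℤ)) = -1 - m - 1 by push_cast; ring]
  obtain ⟨m₀, hm₀⟩ := exists_le_fil A A
  obtain ⟨m₁, hm₁⟩ := exists_le_fil (F.mapSeq A) Y.seq
  -- After this many steps both errors lie below the levels at which the two filtrations vanish.
  obtain ⟨ε, φ, hε, hεm, hφ, hφm, h₁, h₂⟩ := key (m₀.natAbs + m₁.natAbs)
  rw [hm₀ _ (by omega), Submodule.mem_bot] at h₁
  rw [hm₁ _ (by omega), Submodule.mem_bot] at h₂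
  let Z : Tw K C := ⟨A, ε, hε, fun p => hεm p p (by simp), h₁⟩
  have hn : φ ≫ Θ' - 𝟙 _ ∈ fil (F.mapSeq A) (F.mapSeq A) (-1) := by
    rw [← eΘ, ← Preadditive.sub_comp]
    simpa using comp_mem_fil hφm (mem_fil_of_mem_gr hΘ'.1)
  obtain ⟨g, hg, -, e₁, e₂⟩ := exists_inverse (by simpa using comp_mem hφ hΘ'.1) hn
  refine ⟨Z, homotopyEquivalent_of_inverse (X := (F.twData hF.isTwisted_twDelta).obj Z) (Y := Y)
    (f := φ) (g := (show Y.seq ⟶ F.mapSeq A from Θ' ≫ g)) (mem_cocycles.2 ⟨hφ, ?_⟩) ?_ ?_ ?_⟩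
  · refine Eq.trans ?_ h₂
    change nabla (K := K) φ + φ ≫ Y.δ - F.twDelta Z ≫ twist K 1 φ = _
    rw [hF.twDelta_eq, twist_of_mem 1 hφ, mul_zero, Int.negOnePow_zero, one_smul]
    rfl
  · have := comp_mem hΘ'.1 hg
    rwa [add_zero] at this
  · refine Eq.trans ?_ e₁
    exact (Category.assoc φ Θ' g).symm
  · change (Θ' ≫ g) ≫ φ = 𝟙 Y.seq
    rw [← Category.comp_id ((Θ' ≫ g) ≫ φ), ← eΘ', Category.assoc, Category.assoc,
      ← Category.assoc φ, ← Category.assoc g, e₂, Category.id_comp]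

end AInftyFunctor

/-! ## Splitting of complexes -/

section Splitting

variable {K : Type w} [CommRing K] {C : Type u} [Category.{v} C] [Preadditive C] [Linear K C]
  [CurvedDG K C]

/-- A factorization of a closed morphism `f` of degree `0` through its image `B`, together with
splittings of `0 ⟶ Z ⟶ X ⟶ B ⟶ 0`, where `Z` is the kernel of `f`. -/
structure SplitImage (K : Type w) [CommRing K] {C : Type u} [Category.{v} C] [Preadditive C]
    [Linear K C] [CurvedDG K C] {X Y : C} (f : X ⟶ Y) where
  Z : C
  B : C
  ι : Z ⟶ X
  π : X ⟶ B
  j : B ⟶ Y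
  r : X ⟶ Z
  s : B ⟶ X
  ι_mem : ι ∈ cocycles K Z X 0
  π_mem : π ∈ cocycles K X B 0
  j_mem : j ∈ cocycles K B Y 0
  r_mem : r ∈ gr (K := K) X Z 0
  s_mem : s ∈ gr (K := K) B X 0
  π_j : π ≫ j = f
  ι_π : ι ≫ π = 0
  ι_r : ι ≫ r = 𝟙 Z
  s_π : s ≫ π = 𝟙 B
  add_eq : r ≫ ι + π ≫ s = 𝟙 X
  mono {W : C} (x : W ⟶ B) : x ∈ cocycles K W B 0 → x ≫ j = 0 → x = 0

namespace SplitImage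

variable {X Y : C} {f : X ⟶ Y} (S : SplitImage K f)

lemma ι_comp : S.ι ≫ f = 0 :=
  (congrArg (fun z => S.ι ≫ z) S.π_j).symm.trans (by rw [← Category.assoc, S.ι_π, zero_comp])

lemma s_comp : S.s ≫ f = S.j :=
  (congrArg (fun z => S.s ≫ z) S.π_j).symm.trans (by rw [← Category.assoc, S.s_π, Category.id_comp])

lemma π_j_assoc {W : C} (g : Y ⟶ W) : S.π ≫ S.j ≫ g = f ≫ g := by
  rw [← Category.assoc, S.π_j]

end SplitImage

/-- The image is taken to be the cokernel of the kernel of `f`. That `j` is a monomorphism must be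
derived from normality of epimorphisms without using products. -/
lemma IsSplitCDG.nonempty_splitImage (hC : IsSplitCDG K C) {X Y : C} {f : X ⟶ Y}
    (hf : f ∈ cocycles K X Y 0) : Nonempty (SplitImage K f) := by
  have := hC.hasKernels
  have := hC.hasCokernels
  have := hC.normalEpi
  let f' : (⟨X⟩ : ZeroCocycleCat K C) ⟶ ⟨Y⟩ := ⟨f, hf⟩
  let ι := kernel.ι f'
  let π := cokernel.π ι
  let j : cokernel ι ⟶ ⟨Y⟩ := cokernel.desc ι f' (kernel.condition f')
  have hιπ : ι ≫ π = 0 := cokernel.condition ι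
  have hπj : π ≫ j = f' := cokernel.π_desc _ _ _
  have hi : IsLimit (KernelFork.ofι ι hιπ) :=
    KernelFork.IsLimit.ofι _ _
      (fun g hg => kernel.lift f' g (by rw [← hπj, ← Category.assoc, hg, zero_comp]))
      (fun g hg => kernel.lift_ι _ _ _)
      (fun g hg m hm => by
        rw [← cancel_mono (kernel.ι f'), kernel.lift_ι]
        exact hm)
  obtain ⟨r, s, hr, hs, e1, e2, e3⟩ := hC.split ι π hιπ ⟨hi⟩ ⟨cokernelIsCokernel ι⟩
  -- If `x ≫ j = 0`, then `j` factors through the cokernel `q` of `x`. The epimorphism `π ≫ q` is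
  -- the cokernel of some `N.g`; this map is killed by `f'`, hence also by `π`. So `π` factors
  -- through `π ≫ q`, which makes `q` a split monomorphism and forces `x = 0`.
  have hj : ∀ (W : ZeroCocycleCat K C) (x : W ⟶ cokernel ι), x ≫ j = 0 → x = 0 := fun W x hx => by
    let q := cokernel.π x
    have hqj : q ≫ cokernel.desc x j hx = j := cokernel.π_desc _ _ _
    obtain ⟨N⟩ := IsNormalEpiCategory.normalEpiOfEpi (π ≫ q)
    have hk : N.g ≫ π = 0 := by
      have h1 : N.g ≫ f' = 0 := by
        have h2 := congrArg (fun z => z ≫ cokernel.desc x j hx) N.w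
        simp only [Category.assoc, hqj, zero_comp] at h2
        exact (congrArg (fun z => N.g ≫ z) hπj).symm.trans h2
      have h2 : N.g = kernel.lift f' N.g h1 ≫ ι := (kernel.lift_ι _ _ _).symm
      rw [h2, Category.assoc, hιπ, comp_zero]
    obtain ⟨l, hl⟩ := CokernelCofork.IsColimit.desc' N.isColimit π hk
    have h3 : (π ≫ q) ≫ l = π := hl
    have h4 : q ≫ l = 𝟙 _ := by
      rw [← cancel_epi π, ← Category.assoc, h3, Category.comp_id]
    rw [← Category.comp_id x, ← h4, ← Category.assoc, cokernel.condition, zero_comp]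
  exact ⟨⟨(kernel f').of, (cokernel ι).of, ι.1, π.1, j.1, r, s, ι.2, π.2, j.2, hr, hs,
    congrArg Subtype.val hπj, congrArg Subtype.val hιπ, e1, e2, e3,
    fun {W} x hx h => congrArg Subtype.val (hj ⟨W⟩ ⟨x, hx⟩ (Subtype.ext h))⟩⟩

/-- Monomorphisms split, up to the connection. -/
lemma IsSplitCDG.exists_split_mono (hC : IsSplitCDG K C) {X Y : C} {f : X ⟶ Y}
    (hf : f ∈ cocycles K X Y 0)
    (h : ∀ (W : C) (x : W ⟶ X), x ∈ cocycles K W X 0 → x ≫ f = 0 → x = 0) :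
    ∃ (H : C) (c : Y ⟶ H) (r : Y ⟶ X) (s : H ⟶ Y), c ∈ cocycles K Y H 0 ∧
      r ∈ gr (K := K) Y X 0 ∧ s ∈ gr (K := K) H Y 0 ∧ f ≫ c = 0 ∧ f ≫ r = 𝟙 X ∧ s ≫ c = 𝟙 H ∧
      r ≫ f + c ≫ s = 𝟙 Y := by
  have := hC.hasKernels
  have := hC.hasCokernels
  have := hC.normalMono
  let f' : (⟨X⟩ : ZeroCocycleCat K C) ⟶ ⟨Y⟩ := ⟨f, hf⟩
  have : Mono f' := Preadditive.mono_of_cancel_zero _ fun {W} x hx =>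
    Subtype.ext (h W.of x.1 x.2 (congrArg Subtype.val hx))
  obtain ⟨N⟩ := IsNormalMonoCategory.normalMonoOfMono f'
  have hi : IsLimit (KernelFork.ofι f' (cokernel.condition f')) :=
    KernelFork.IsLimit.ofι' _ _ fun {W} g hg => by
      refine KernelFork.IsLimit.lift' N.isLimit g ?_
      rw [← cokernel.π_desc f' N.g N.w, ← Category.assoc, hg, zero_comp]
  obtain ⟨r, s, hr, hs, e1, e2, e3⟩ := hC.split f' (cokernel.π f') (cokernel.condition f') ⟨hi⟩
    ⟨cokernelIsCokernel f'⟩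
  exact ⟨_, (cokernel.π f').1, r, s, (cokernel.π f').2, hr, hs,
    congrArg Subtype.val (cokernel.condition f'), e1, e2, e3⟩

/-- The cohomology of `X ⟶ Y ⟶ W`, with a contraction of `Y` onto it. -/
lemma IsSplitCDG.exists_contraction (hC : IsSplitCDG K C) {X Y W : C} {f : X ⟶ Y} {g : Y ⟶ W}
    (S : SplitImage K f) (T : SplitImage K g) (hfg : f ≫ g = 0) :
    ∃ (H : C) (i : H ⟶ Y) (p : Y ⟶ H) (k : Y ⟶ X), i ∈ gr (K := K) H Y 0 ∧
      p ∈ gr (K := K) Y H 0 ∧ k ∈ gr (K := K) Y X 0 ∧ i ≫ p = 𝟙 H ∧ i ≫ g = 0 ∧ f ≫ p = 0 ∧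
      nabla (K := K) i ≫ p = 0 ∧ p ≫ i + k ≫ f + T.π ≫ T.s = 𝟙 Y ∧ f ≫ k = S.π ≫ S.s := by
  have hjg : S.j ≫ g = 0 := by
    rw [← Category.id_comp (S.j ≫ g), ← S.s_π, Category.assoc, ← Category.assoc S.π, S.π_j, hfg,
      comp_zero]
  have hjπ : S.j ≫ T.π = 0 := T.mono _ (by simpa using comp_mem_cocycles S.j_mem T.π_mem) (by
    rw [Category.assoc, T.π_j, hjg])
  -- `S.j ≫ T.r` is the inclusion of the boundaries into the cycles. It is closed although `T.r`
  -- need not be, because its composite with the closed split monomorphism `T.ι` is closed.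
  have hb : (S.j ≫ T.r) ≫ T.ι = S.j := by
    have h := congrArg (fun z => S.j ≫ z) T.add_eq
    simp only [Preadditive.comp_add, Category.comp_id] at h
    rwa [← Category.assoc S.j T.π, hjπ, zero_comp, add_zero, ← Category.assoc] at h
  have hbm : S.j ≫ T.r ∈ cocycles K S.B T.Z 0 := by
    refine mem_cocycles.2 ⟨by simpa using comp_mem S.j_mem.1 T.r_mem, ?_⟩
    have h := AInftyFunctor.leibniz_zero (S.j ≫ T.r) T.ι_mem.1
    rw [hb, (mem_cocycles.1 S.j_mem).2, (mem_cocycles.1 T.ι_mem).2, comp_zero, zero_add] at h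
    rw [← Category.comp_id (nabla (K := K) (S.j ≫ T.r)), ← T.ι_r, ← Category.assoc, ← h, zero_comp]
  obtain ⟨H, c, r, s, hc, hr, hs, e1, e2, e3, e4⟩ := hC.exists_split_mono hbm fun V x hx h =>
    S.mono x hx (by rw [← hb, ← Category.assoc, h, zero_comp])
  -- `H` is cycles modulo boundaries. The contraction `k` projects to cycles, then to boundaries,
  -- and lifts these to `X`.
  refine ⟨H, s ≫ T.ι, T.r ≫ c, T.r ≫ r ≫ S.s, by simpa using comp_mem hs T.ι_mem.1,
    by simpa using comp_mem T.r_mem hc.1, by simpa using comp_mem T.r_mem (comp_mem hr S.s_mem),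
    ?_, ?_, ?_, ?_, ?_, ?_⟩
  · rw [Category.assoc, ← Category.assoc T.ι, T.ι_r, Category.id_comp, e3]
  · rw [Category.assoc, T.ι_comp, comp_zero]
  · rw [← S.π_j_assoc, ← Category.assoc S.j, e1, comp_zero]
  · rw [AInftyFunctor.leibniz_zero s T.ι_mem.1, (mem_cocycles.1 T.ι_mem).2, comp_zero, zero_add,
      Category.assoc, ← Category.assoc T.ι, T.ι_r, Category.id_comp]
    have h := AInftyFunctor.leibniz_zero s hc.1
    rwa [e3, nabla_id, (mem_cocycles.1 hc).2, comp_zero, zero_add, eq_comm] at h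
  · have h : (T.r ≫ r ≫ S.s) ≫ f = T.r ≫ (r ≫ S.j ≫ T.r) ≫ T.ι := by
      simp only [Category.assoc] at hb ⊢
      rw [S.s_comp, hb]
    rw [h, show (T.r ≫ c) ≫ s ≫ T.ι = T.r ≫ (c ≫ s) ≫ T.ι by simp only [Category.assoc],
      ← Preadditive.comp_add, ← Preadditive.add_comp, add_comm (c ≫ s), e4, Category.id_comp,
      T.add_eq]
  · rw [← S.π_j_assoc, ← Category.assoc S.j, ← Category.assoc _ r, e2, Category.id_comp]

end Splitting

/-! ## Lifting of exact idempotents -/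

-- The left-hand polynomial corrects idempotents modulo nilpotents. It agrees with `X` at 0 and at
-- 1, so the correction is a multiple of `X² - X`; this is what keeps a corrected exact element
-- exact.
open Polynomial in
lemma exists_one_sub_one_sub_pow_pow_eq {N : ℕ} (hN : N ≠ 0) :
    ∃ Q : ℤ[X], 1 - (1 - X ^ N) ^ N = X + Q * (X * X - X) := by
  have h : (X * (X - C 1) : ℤ[X]) ∣ 1 - (1 - X ^ N) ^ N - X := by
    refine IsCoprime.mul_dvd ⟨1, -1, by rw [C_1]; ring⟩ (X_dvd_iff.2 ?_) (dvd_iff_isRoot.2 ?_)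
    · simp [coeff_zero_eq_eval_zero, hN]
    · simp [hN]
  obtain ⟨Q, hQ⟩ := h
  refine ⟨Q, ?_⟩
  rw [show Q * (X * X - X : ℤ[X]) = X * (X - C 1) * Q by rw [C_1]; ring, ← hQ]
  ring

namespace CurvedDG

variable {K : Type w} [CommRing K] {C : Type u} [Category.{v} C] [Preadditive C] [Linear K C]
  [CurvedDG K C]

/-- The ring of closed endomorphisms of degree `0`. -/
def cocycleSubring (K : Type w) [CommRing K] {C : Type u} [Category.{v} C] [Preadditive C]
    [Linear K C] [CurvedDG K C] (X : C) : Subring (End X) where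
  carrier := {f | f ∈ cocycles K X X 0}
  mul_mem' {f g} hf hg := by
    have := comp_mem_cocycles (K := K) hg hf
    rwa [add_zero] at this
  one_mem' := id_mem_cocycles X
  add_mem' hf hg := (cocycles K X X 0).add_mem hf hg
  zero_mem' := (cocycles K X X 0).zero_mem
  neg_mem' hf := (cocycles K X X 0).neg_mem hf

lemma mem_cocycleSubring {X : C} {f : End X} :
    f ∈ cocycleSubring K X ↔ f ∈ (cocycles K X X 0 : Set (X ⟶ X)) := Iff.rfl

/-- An exact endomorphism that is idempotent up to nilpotents can be corrected to an exact
idempotent. -/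
lemma exists_exact_idempotent {X : C} {u : X ⟶ X} (hu : u ∈ cocycles K X X 0)
    (hu' : u ∈ coboundaries K X X 0) {N : ℕ} (hN : (show End X from u ≫ u - u) ^ N = 0) :
    ∃ w ∈ cocycles K X X 0, u + (u ≫ u - u) ≫ w ∈ coboundaries K X X 0 ∧
      (u + (u ≫ u - u) ≫ w) ≫ (u + (u ≫ u - u) ≫ w) = u + (u ≫ u - u) ≫ w := by
  -- The exponent is raised by one, since the polynomial identity needs it to be nonzero.
  obtain ⟨N, h0, hN⟩ : ∃ M : ℕ, M ≠ 0 ∧ (show End X from u ≫ u - u) ^ M = 0 :=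
    ⟨N + 1, by omega, by rw [pow_succ, hN, zero_mul]⟩
  obtain ⟨Q, hQ⟩ := exists_one_sub_one_sub_pow_pow_eq h0
  let x : cocycleSubring K X := ⟨u, mem_cocycleSubring.2 hu⟩
  have hx : (x - x ^ 2) ^ N = 0 := by
    refine Subtype.ext ?_
    have e : ((x - x ^ 2 : cocycleSubring K X) : End X) = -(show End X from u ≫ u - u) := by
      rw [pow_two]
      exact (neg_sub (show End X from u ≫ u) (show End X from u)).symm
    rw [SubmonoidClass.coe_pow, e, neg_pow, hN, mul_zero]
    rfl
  have hid := isIdempotentElem_one_sub_one_sub_pow_pow x N hx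
  have hQ' := congrArg (Polynomial.aeval x) hQ
  simp only [map_sub, map_add, map_mul, map_pow, map_one, Polynomial.aeval_X] at hQ'
  rw [hQ'] at hid
  have hw := mem_cocycleSubring.1 (Polynomial.aeval x Q).2
  obtain ⟨w, e⟩ : ∃ w : X ⟶ X, w = (Polynomial.aeval x Q).1 := ⟨_, rfl⟩
  have hid' := congrArg Subtype.val hid.eq
  change (u + (u ≫ u - u) ≫ (Polynomial.aeval x Q).1) ≫
    (u + (u ≫ u - u) ≫ (Polynomial.aeval x Q).1) =
      u + (u ≫ u - u) ≫ (Polynomial.aeval x Q).1 at hid'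
  change (Polynomial.aeval x Q).1 ∈ cocycles K X X 0 at hw
  rw [← e] at hid' hw
  refine ⟨w, hw, Submodule.add_mem _ hu' ?_, hid'⟩
  -- The correction is `u ≫ (u - 𝟙) ≫ w`: an exact morphism followed by closed ones.
  have h := coboundaries_comp_mem hu' (Submodule.sub_mem _ hu (id_mem_cocycles X))
  have h1 := coboundaries_comp_mem h hw
  rw [Preadditive.comp_sub, Category.comp_id] at h1
  simpa using h1

end CurvedDG

/-! ## Reduction to minimal twisted complexes -/

namespace CurvedDG

/-- A split closed idempotent homotopic to the identity yields a homotopy equivalence. -/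
lemma homotopyEquivalent_of_splitting {K : Type w} [CommRing K] {C : Type u} [Category.{v} C]
    [Preadditive C] [Linear K C] [CurvedDG K C] {X Y : C} {i : Y ⟶ X} {p : X ⟶ Y}
    (hi : i ∈ cocycles K Y X 0) (hp : p ∈ gr (K := K) X Y 0) (hip : i ≫ p = 𝟙 Y)
    (hpi : nabla (K := K) (p ≫ i) = 0) (h : p ≫ i - 𝟙 X ∈ coboundaries K X X 0) :
    HomotopyEquivalent K X Y := by
  refine ⟨p, mem_cocycles.2 ⟨hp, ?_⟩, i, hi, h, ?_⟩
  · rw [AInftyFunctor.leibniz_zero p hi.1, (mem_cocycles.1 hi).2, comp_zero, zero_add] at hpi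
    rw [← Category.comp_id (nabla (K := K) p), ← hip, ← Category.assoc, hpi, zero_comp]
  · rw [hip, sub_self]
    exact Submodule.zero_mem _

end CurvedDG

section Reduction

open BddSeq

variable {K : Type w} [CommRing K] {C : Type u} [Category.{v} C] [Preadditive C] [Linear K C]

section General

variable [CurvedDG K C]

lemma BddSeq.comp_sub_comp_mem {A B D : BddSeq K C} {f f' : A ⟶ B} {g g' : B ⟶ D}
    (hf : f ∈ fil A B 0) (hg : g' ∈ fil B D 0) (h : f - f' ∈ fil A B (-1))
    (h' : g - g' ∈ fil B D (-1)) : f ≫ g - f' ≫ g' ∈ fil A D (-1) := by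
  have e : f ≫ g - f' ≫ g' = f ≫ (g - g') + (f - f') ≫ g' := by
    rw [Preadditive.comp_sub, Preadditive.sub_comp]
    abel
  have h1 := comp_mem_fil hf h'
  have h2 := comp_mem_fil h hg
  rw [zero_add] at h1
  rw [add_zero] at h2
  rw [e]
  exact Submodule.add_mem _ h1 h2

lemma BddSeq.eq_zero_of_idempotent {A : BddSeq K C} {q : A ⟶ A} (h : q ≫ q = q)
    (hq : q ∈ fil A A (-1)) : q = 0 := by
  obtain ⟨N, hN⟩ := exists_pow_eq_zero (f := q) hq
  have h1 : IsIdempotentElem (show End A from q) := h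
  have h2 := h1.pow_succ_eq N
  rw [pow_succ, hN, zero_mul] at h2
  exact h2.symm

/-- Idempotents congruent to a split idempotent split. -/
lemma BddSeq.exists_splitting {A H : BddSeq K C} {i : H ⟶ A} {p : A ⟶ H} {e : A ⟶ A}
    (hi : i ∈ gr (K := K) H A 0) (hi' : i ∈ fil H A 0) (hp : p ∈ gr (K := K) A H 0)
    (hp' : p ∈ fil A H 0) (hip : i ≫ p = 𝟙 H) (he : e ∈ gr (K := K) A A 0) (hee : e ≫ e = e)
    (h : e - p ≫ i ∈ fil A A (-1)) :
    ∃ (I : H ⟶ A) (P : A ⟶ H), I ∈ gr (K := K) H A 0 ∧ P ∈ gr (K := K) A H 0 ∧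
      I - i ∈ fil H A (-1) ∧ P - p ∈ fil A H (-1) ∧ I ≫ P = 𝟙 H ∧ P ≫ I = e := by
  have hpi : p ≫ i ∈ fil A A 0 := comp_mem_fil hp' hi'
  have he' : e ∈ fil A A 0 := by
    have := Submodule.add_mem _ (fil_mono (by norm_num) h) hpi
    rwa [sub_add_cancel] at this
  have hI : i ≫ e - i ∈ fil H A (-1) := by
    have := comp_sub_comp_mem (f' := i) hi' hpi (by rw [sub_self]; exact Submodule.zero_mem _) h
    rwa [← Category.assoc, hip, Category.id_comp] at this
  have hP : e ≫ p - p ∈ fil A H (-1) := by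
    have := comp_sub_comp_mem (g := p) he' hp' h (by rw [sub_self]; exact Submodule.zero_mem _)
    rwa [Category.assoc, hip, Category.comp_id] at this
  have hI0 : i ≫ e ∈ fil H A 0 := by simpa using comp_mem_fil hi' he'
  have hP0 : e ≫ p ∈ fil A H 0 := by simpa using comp_mem_fil he' hp'
  have hIg : i ≫ e ∈ gr (K := K) H A 0 := by simpa using comp_mem hi he
  have hPg : e ≫ p ∈ gr (K := K) A H 0 := by simpa using comp_mem he hp
  -- Cutting `i` and `p` down by `e` gives a composite that is only congruent to `i ≫ p = 𝟙`; its
  -- inverse `V` repairs this.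
  obtain ⟨V, hV, hV', e1, e2⟩ := exists_inverse (f := (i ≫ e) ≫ e ≫ p)
    (by simpa using comp_mem hIg hPg) (by
      have := comp_sub_comp_mem hI0 hp' hI hP
      rwa [hip] at this)
  have hP' : (e ≫ p) ≫ V - p ∈ fil A H (-1) := by
    have := comp_sub_comp_mem hP0 (id_mem_fil H) hP hV'
    rwa [Category.comp_id] at this
  have hIP : (i ≫ e) ≫ (e ≫ p) ≫ V = 𝟙 H := by rw [← Category.assoc, e1]
  refine ⟨i ≫ e, (e ≫ p) ≫ V, hIg, by simpa using comp_mem hPg hV, hI, hP', hIP, ?_⟩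
  have hP0' : (e ≫ p) ≫ V ∈ fil A H 0 := by
    have := Submodule.add_mem _ (fil_mono (by norm_num) hP') hp'
    rwa [sub_add_cancel] at this
  have hPI : ((e ≫ p) ≫ V) ≫ i ≫ e - p ≫ i ∈ fil A A (-1) := comp_sub_comp_mem hP0' hi' hP' hI
  obtain ⟨I, hIe⟩ : ∃ I, I = i ≫ e := ⟨_, rfl⟩
  obtain ⟨P, hPe⟩ : ∃ P, P = (e ≫ p) ≫ V := ⟨_, rfl⟩
  have k1 : I ≫ e = I := by rw [hIe, Category.assoc, hee]
  have k2 : e ≫ P = P := by rw [hPe, Category.assoc, ← Category.assoc, hee]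
  rw [← hIe, ← hPe] at hPI hIP ⊢
  have k3 : ∀ {W : BddSeq K C} (x : H ⟶ W), I ≫ P ≫ x = x := fun x => by
    rw [← Category.assoc, hIP, Category.id_comp]
  have k4 : ∀ {W : BddSeq K C} (x : H ⟶ W), e ≫ P ≫ x = P ≫ x := fun x => by
    rw [← Category.assoc, k2]
  -- `P ≫ I` is an idempotent absorbed by `e` on both sides, so `e - P ≫ I` is idempotent; it is
  -- also nilpotent, hence zero.
  refine (sub_eq_zero.1 (eq_zero_of_idempotent ?_ ?_)).symm
  · simp only [Preadditive.comp_sub, Preadditive.sub_comp, Category.assoc, hee, k1, k3, k4]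
    abel
  · have := Submodule.sub_mem _ h hPI
    rwa [sub_sub_sub_cancel_right] at this

/-- Transfer of a twisted differential along a splitting of a closed idempotent. -/
lemma Tw.transfer {A : Tw K C} {H : BddSeq K C} {I : H ⟶ A.seq} {P : A.seq ⟶ H}
    (hI : I ∈ gr (K := K) H A.seq 0) (hIP : I ≫ P = 𝟙 H)
    (hPg : P ∈ gr (K := K) A.seq H 0) (he : Tw.diff A A (P ≫ I) = 0) {δ : H ⟶ H}
    (hδ : δ = (nabla (K := K) I + I ≫ A.δ) ≫ P) :
    nabla (K := K) δ + δ ≫ δ + curv K H = 0 ∧ nabla (K := K) I + I ≫ A.δ = δ ≫ I := by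
  have hPI : P ≫ I ∈ gr (K := K) A.seq A.seq 0 := by simpa using comp_mem hPg hI
  have e1 : nabla (K := K) I + I ≫ A.δ = δ ≫ I := by
    rw [Tw.diff_apply, twist_of_mem 1 hPI, mul_zero, Int.negOnePow_zero, one_smul, sub_eq_zero] at he
    have h1 := AInftyFunctor.leibniz_zero I hPI
    rw [← Category.assoc, hIP, Category.id_comp] at h1
    -- Precomposing the closedness of `P ≫ I` with `I` says that the differential of `I` factors
    -- through `I`.
    have h2 := congrArg (fun z => I ≫ z) he
    simp only [Preadditive.comp_add] at h2
    rw [Category.assoc P, ← Category.assoc I P, hIP, Category.id_comp] at h2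
    rw [hδ, Category.assoc, Preadditive.add_comp, Category.assoc I A.δ, ← h2]
    nth_rw 1 [h1]
    abel
  refine ⟨?_, e1⟩
  have h1 := congrArg (nabla (K := K)) e1
  have hA : nabla (K := K) A.δ = -(A.δ ≫ A.δ) - curv K A.seq := by
    have := A.isTwisted.maurerCartan
    rw [← sub_eq_zero, ← this]
    abel
  rw [map_add, nabla_nabla, AInftyFunctor.leibniz_one I A.isTwisted.mem,
    AInftyFunctor.leibniz_zero δ hI, hA, eq_sub_of_add_eq e1] at h1
  -- `I` intertwines `δ` with `A.δ`, so it carries the Maurer-Cartan expression of `δ` to that of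
  -- `A.δ`, which is zero. Since `I` has the retraction `P`, the expression itself vanishes.
  have h2 : (nabla (K := K) δ + δ ≫ δ + curv K H) ≫ I = 0 := by
    simp only [Preadditive.add_comp, Preadditive.comp_sub, Preadditive.sub_comp,
      Preadditive.comp_neg, Category.assoc] at h1 ⊢
    rw [← sub_eq_zero] at h1
    rw [← neg_eq_zero, ← h1]
    abel
  rw [← Category.comp_id (nabla (K := K) δ + δ ≫ δ + curv K H), ← hIP, ← Category.assoc, h2,
    zero_comp]

/-- This puts the transferred differential into filtration -1. The delicate part is the leading term
`d`, which raises the internal degree by one but is annihilated by `i` and `p`. -/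
lemma BddSeq.nabla_add_comp_mem {A H : BddSeq K C} {i I : H ⟶ A} {p P : A ⟶ H} {d δ : A ⟶ A}
    (hI : I ∈ fil H A 0) (hi : i ∈ fil H A 0) (hP : P ∈ fil A H 0) (hδ : δ ∈ fil A A 1)
    (hIi : I - i ∈ fil H A (-1)) (hPp : P - p ∈ fil A H (-1)) (hd : δ - d ∈ fil A A (-1))
    (hid : i ≫ d = 0) (hdp : d ≫ p = 0) (hip : nabla (K := K) i ≫ p = 0) :
    (nabla (K := K) I + I ≫ δ) ≫ P ∈ fil H H (-1) := by
  have fd : d ∈ fil A A 1 := by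
    have := Submodule.sub_mem _ hδ (fil_mono (by norm_num) hd)
    rwa [sub_sub_cancel] at this
  have g1 : I ≫ (δ - d) ≫ P ∈ fil H H (-1) := by
    have := comp_mem_fil hI (comp_mem_fil hd hP)
    rwa [add_zero, zero_add] at this
  have g2 : I ≫ d ≫ P ∈ fil H H (-1) := by
    -- Both factors around `d` lower the internal degree by one, so the product has internal degree
    -- at most `-1 + 1 - 1`.
    have h1 : I ≫ d ≫ P = (I - i) ≫ d ≫ (P - p) := by
      rw [Preadditive.comp_sub, hdp, sub_zero, Preadditive.sub_comp, ← Category.assoc i, hid,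
        zero_comp, sub_zero]
    have := comp_mem_fil hIi (comp_mem_fil fd hPp)
    rw [add_neg_cancel, add_zero] at this
    rwa [h1]
  have g3 : nabla (K := K) (I - i) ≫ P ∈ fil H H (-1) := by
    have := comp_mem_fil (nabla_mem_fil hIi) hP
    rwa [add_zero] at this
  have g4 : nabla (K := K) i ≫ P ∈ fil H H (-1) := by
    have := comp_mem_fil (nabla_mem_fil hi) hPp
    rwa [zero_add, Preadditive.comp_sub, hip, sub_zero] at this
  have e : (nabla (K := K) I + I ≫ δ) ≫ P = I ≫ (δ - d) ≫ P + I ≫ d ≫ P +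
      (nabla (K := K) (I - i) ≫ P + nabla (K := K) i ≫ P) := by
    rw [map_sub, Preadditive.sub_comp δ, Preadditive.comp_sub, Preadditive.sub_comp (nabla I),
      Preadditive.add_comp, Category.assoc]
    abel
  rw [e]
  exact Submodule.add_mem _ (Submodule.add_mem _ g1 g2) (Submodule.add_mem _ g3 g4)

/-- On the diagonal both `∇δ` and `δ ≫ δ` vanish for reasons of internal degree, so the
Maurer-Cartan equation reduces to the curvature. -/
lemma BddSeq.curv_X_eq_zero {A : BddSeq K C} {δ : A ⟶ A} (hδ : δ ∈ fil A A (-1))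
    (h : nabla (K := K) δ + δ ≫ δ + curv K A = 0) (n : ℤ) : curv K (A.X n) = 0 := by
  have h1 := congrFun (congrFun h n) n
  have h2 : (δ ≫ δ) n n = 0 := comp_mem_fil hδ hδ n n (by simp)
  rw [BddSeq.add_apply, BddSeq.add_apply, nabla_apply, h2, hδ n n (by simp), map_zero, add_zero,
    zero_add, curv_eq, diag_self] at h1
  exact h1

end General

variable [CDGCategory K C]

/-- A twisted complex whose leading part contracts onto a complex with vanishing differential is
homotopy equivalent to a minimal one. -/
lemma Tw.exists_isMinimal_of_contraction {A : Tw K C} {H : BddSeq K C} {i : H ⟶ A.seq}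
    {p : A.seq ⟶ H} {d u : A.seq ⟶ A.seq} (hi : i ∈ gr (K := K) H A.seq 0)
    (hp : p ∈ gr (K := K) A.seq H 0) (hip : i ≫ p = 𝟙 H) (hd : A.δ - d ∈ fil A.seq A.seq (-1))
    (hid : i ≫ d = 0) (hdp : d ≫ p = 0) (hi' : nabla (K := K) i ≫ p = 0)
    (hu : u ∈ coboundaries K A A 0) (hu' : u - (𝟙 A.seq - p ≫ i) ∈ fil A.seq A.seq (-1)) :
    ∃ A' : Tw K C, A'.IsMinimal ∧ HomotopyEquivalent K A A' := by
  have fi := mem_fil_of_mem_gr hi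
  have fp := mem_fil_of_mem_gr hp
  have fδ := mem_fil_of_mem_gr A.isTwisted.mem
  obtain ⟨h, hh, rfl⟩ := hu
  obtain ⟨u, hu⟩ : ∃ u : A.seq ⟶ A.seq, u = Tw.diff A A h := ⟨_, rfl⟩
  have hub : u ∈ coboundaries K A A 0 := ⟨h, hh, hu.symm⟩
  have huc : u ∈ cocycles K A A 0 := by
    have k := nabla_mem (X := A) (Y := A) hh
    rw [sub_add_cancel] at k
    rw [hu]
    exact mem_cocycles.2 ⟨k, Tw.diff_diff A A h⟩
  have hu' : u - (𝟙 A.seq - p ≫ i) ∈ fil A.seq A.seq (-1) := hu ▸ hu'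
  have fq : 𝟙 A.seq - p ≫ i ∈ fil A.seq A.seq 0 :=
    Submodule.sub_mem _ (id_mem_fil _) (comp_mem_fil fp fi)
  have fu : u ∈ fil A.seq A.seq 0 := by
    have := Submodule.add_mem _ (fil_mono (by norm_num) hu') fq
    rwa [sub_add_cancel] at this
  have hpip : ∀ {W : BddSeq K C} (x : H ⟶ W), i ≫ p ≫ x = x := fun x => by
    rw [← Category.assoc, hip, Category.id_comp]
  -- `u` is congruent to the idempotent `𝟙 - p ≫ i`, so its failure to be idempotent has negative
  -- internal degree and is nilpotent.
  have huu : u ≫ u - u ∈ fil A.seq A.seq (-1) := by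
    have h1 := Submodule.sub_mem _ (comp_sub_comp_mem fu fq hu' hu') hu'
    have e : (𝟙 A.seq - p ≫ i) ≫ (𝟙 A.seq - p ≫ i) = 𝟙 A.seq - p ≫ i := by
      simp only [Preadditive.comp_sub, Preadditive.sub_comp, Category.assoc, hpip,
        Category.id_comp, Category.comp_id, sub_self, sub_zero]
    rwa [e, sub_sub_sub_cancel_right] at h1
  obtain ⟨N, hN⟩ := exists_pow_eq_zero (f := u ≫ u - u) huu
  obtain ⟨w, hw, hπ, hππ⟩ := exists_exact_idempotent (X := A) huc hub hN
  change A.seq ⟶ A.seq at w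
  -- The complement of the corrected exact idempotent: a closed idempotent, homotopic to the
  -- identity and congruent to `p ≫ i`.
  obtain ⟨e, he⟩ : ∃ e : A.seq ⟶ A.seq, e = 𝟙 A.seq - (u + (u ≫ u - u) ≫ w) := ⟨_, rfl⟩
  have heb : e - 𝟙 A.seq ∈ coboundaries K A A 0 := by
    have h1 := Submodule.neg_mem _ hπ
    rw [he, sub_sub_cancel_left]
    exact h1
  have hec : e ∈ cocycles K A A 0 := by
    have k1 := comp_mem_cocycles huc huc
    rw [add_zero] at k1
    have h1 := comp_mem_cocycles (Submodule.sub_mem _ k1 huc) hw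
    rw [add_zero] at h1
    rw [he]
    exact Submodule.sub_mem _ (id_mem_cocycles A) (Submodule.add_mem _ huc h1)
  have hee : e ≫ e = e := by
    have h1 : (u + (u ≫ u - u) ≫ w) ≫ (u + (u ≫ u - u) ≫ w) = u + (u ≫ u - u) ≫ w := hππ
    rw [he]
    generalize u + (u ≫ u - u) ≫ w = x at h1 ⊢
    rw [Preadditive.comp_sub, Category.comp_id, Preadditive.sub_comp, Category.id_comp, h1,
      sub_self, sub_zero]
  have hei : e - p ≫ i ∈ fil A.seq A.seq (-1) := by
    have h1 : (u ≫ u - u) ≫ w ∈ fil A.seq A.seq (-1) := by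
      have h2 := comp_mem_fil huu (mem_fil_of_mem_gr (show w ∈ gr (K := K) A.seq A.seq 0 from hw.1))
      rwa [add_zero] at h2
    have h2 := Submodule.neg_mem _ (Submodule.add_mem _ hu' h1)
    have e1 : -(u - (𝟙 A.seq - p ≫ i) + (u ≫ u - u) ≫ w) = e - p ≫ i := by
      rw [he]
      abel
    rwa [e1] at h2
  have heg : e ∈ gr (K := K) A.seq A.seq 0 := hec.1
  obtain ⟨I, P, hI, hP, fI, fP, hIP, hPI⟩ := exists_splitting hi fi hp fp hip heg hee hei
  obtain ⟨δ, hδ⟩ : ∃ δ, δ = (nabla (K := K) I + I ≫ A.δ) ≫ P := ⟨_, rfl⟩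
  have hdiff : Tw.diff A A (P ≫ I) = 0 := by
    rw [hPI]
    exact hec.2
  obtain ⟨hMC, hID⟩ := Tw.transfer hI hIP hP hdiff hδ
  have hδg : δ ∈ gr (K := K) H H 1 := by
    have k1 := nabla_mem hI
    have k2 := comp_mem hI A.isTwisted.mem
    rw [zero_add] at k1 k2
    have k3 := comp_mem (Submodule.add_mem _ k1 k2) hP
    rwa [add_zero, ← hδ] at k3
  have hδm : δ ∈ fil H H (-1) := by
    rw [hδ]
    exact nabla_add_comp_mem (mem_fil_of_mem_gr hI) fi (mem_fil_of_mem_gr hP) fδ fI fP hd hid hdp hi'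
  let A' : Tw K C := ⟨H, δ, hδg, fun q => hδm q q (by rw [sub_self]; exact neg_one_lt_zero), hMC⟩
  refine ⟨A', ⟨fun n => ?_, hδm⟩, ?_⟩
  · exact curv_X_eq_zero hδm hMC n
  · have hIc : I ∈ cocycles K A' A 0 := by
      refine mem_cocycles.2 ⟨hI, ?_⟩
      change Tw.diff A' A I = 0
      rw [Tw.diff_apply, twist_of_mem 1 hI, mul_zero, Int.negOnePow_zero, one_smul, hID]
      exact sub_self _
    exact homotopyEquivalent_of_splitting (X := A) (Y := A') hIc hP hIP hdiff (hPI ▸ heb)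

end Reduction

/-! ## Minimal models of twisted complexes -/

section MinimalModel

open BddSeq

variable {K : Type w} [CommRing K] {C : Type u} [Category.{v} C] [Preadditive C] [Linear K C]
  [CDGCategory K C]

namespace Tw

variable (A : Tw K C)

lemma δ_mem_gr_zero (p : ℤ) : A.δ p (p + 1) ∈ gr (K := K) (A.seq.X p) (A.seq.X (p + 1)) 0 := by
  have := A.isTwisted.mem p (p + 1)
  rwa [add_sub_cancel_left, sub_self] at this

lemma δ_mem_fil : A.δ ∈ fil A.seq A.seq 1 := mem_fil_of_mem_gr A.isTwisted.mem

lemma maurerCartan_apply {p q : ℤ} (h : p ≠ q) :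
    nabla (K := K) (A.δ p q) + (A.δ ≫ A.δ) p q = 0 := by
  have := congrFun (congrFun A.isTwisted.maurerCartan p) q
  rw [BddSeq.add_apply, BddSeq.add_apply, nabla_apply, curv_eq, diag_ne _ _ h, add_zero] at this
  exact this

lemma comp_apply_succ {B : BddSeq K C} {f : A.seq ⟶ A.seq} {g : A.seq ⟶ B} {p r : ℤ}
    (hf : ∀ q, q ≠ p + 1 → f p q = 0 ∨ g q r = 0)
    (h : f p (p + 1) ∈ gr (K := K) (A.seq.X p) (A.seq.X (p + 1)) 0) :
    (f ≫ g) p r = f p (p + 1) ≫ g (p + 1) r := by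
  rw [BddSeq.comp_apply, sum_eq_single_supp _ (p + 1)]
  · rw [twist_of_mem _ h, mul_zero, Int.negOnePow_zero, one_smul]
  · intro q hq
    rcases hf q hq with h | h
    · rw [h, map_zero, zero_comp]
    · rw [h, comp_zero]
  · intro hz
    rw [hz.eq_of_src (g (p + 1) r) 0, comp_zero]

/-- The Maurer-Cartan equation in internal degree 1. Internal degrees above 1 do not occur in `δ`,
so a product of two entries would involve one of internal degree 0, which vanishes. -/
lemma δ_mem_cocycles (p : ℤ) : A.δ p (p + 1) ∈ cocycles K (A.seq.X p) (A.seq.X (p + 1)) 0 := by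
  refine mem_cocycles.2 ⟨A.δ_mem_gr_zero p, ?_⟩
  have h := A.maurerCartan_apply (p := p) (q := p + 1) (by omega)
  have h1 : (A.δ ≫ A.δ) p (p + 1) = 0 := by
    rw [A.comp_apply_succ (fun q hq => ?_) (A.δ_mem_gr_zero p), A.isTwisted.internal_zero,
      comp_zero]
    by_cases hq' : q = p
    · subst hq'
      exact Or.inl (A.isTwisted.internal_zero q)
    · by_cases hq'' : p + 1 < q
      · exact Or.inl (A.δ_mem_fil p q (by omega))
      · exact Or.inr (A.δ_mem_fil q (p + 1) (by omega))
  rwa [h1, add_zero] at h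

/-- The Maurer-Cartan equation in internal degree 2, where `δ` has no entry. The leading part of `δ`
is thus a complex in `Z⁰`. -/
lemma δ_comp_δ (p : ℤ) : A.δ p (p + 1) ≫ A.δ (p + 1) (p + 1 + 1) = 0 := by
  have h := A.maurerCartan_apply (p := p) (q := p + 1 + 1) (by omega)
  have h0 : A.δ p (p + 1 + 1) = 0 := A.δ_mem_fil _ _ (by omega)
  rw [h0, map_zero, zero_add] at h
  rw [← h, A.comp_apply_succ (fun q hq => ?_) (A.δ_mem_gr_zero p)]
  by_cases hq' : p + 1 < q
  · exact Or.inl (A.δ_mem_fil p q (by omega))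
  · exact Or.inr (A.δ_mem_fil q _ (by omega))

end Tw

/-- Contractions of the terms of a twisted complex onto the cohomology of its leading part. -/
lemma IsSplitCDG.exists_termwise_contraction (hC : IsSplitCDG K C) (A : Tw K C) :
    ∃ (H : BddSeq K C) (i : ∀ n, H.X n ⟶ A.seq.X n) (p : ∀ n, A.seq.X n ⟶ H.X n)
      (k : ∀ n m, A.seq.X n ⟶ A.seq.X m), (∀ n, i n ∈ gr (K := K) _ _ 0) ∧
      (∀ n, p n ∈ gr (K := K) _ _ 0) ∧ (∀ n m, k n m ∈ gr (K := K) _ _ 0) ∧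
      (∀ n m, m ≠ n - 1 → k n m = 0) ∧ (∀ n, i n ≫ p n = 𝟙 _) ∧
      (∀ n, i n ≫ A.δ n (n + 1) = 0) ∧ (∀ n, A.δ (n - 1) n ≫ p n = 0) ∧
      (∀ n, nabla (K := K) (i n) ≫ p n = 0) ∧
      ∀ n, p n ≫ i n + k n (n - 1) ≫ A.δ (n - 1) n + A.δ n (n + 1) ≫ k (n + 1) n = 𝟙 _ := by
  have hS : ∀ m n, n = m + 1 → Nonempty (SplitImage K (A.δ m n)) := by
    rintro m n rfl
    exact hC.nonempty_splitImage (A.δ_mem_cocycles m)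
  have hc : ∀ m n, n = m + 1 → A.δ m n ≫ A.δ n (n + 1) = 0 := by
    rintro m n rfl
    exact A.δ_comp_δ m
  -- One splitting is fixed for each differential, so that the contractions of adjacent terms use
  -- the same one and fit together.
  have S : ∀ m n, n = m + 1 → SplitImage K (A.δ m n) := fun m n h => (hS m n h).some
  choose H i p k h1 h2 h3 h4 h5 h6 h7 h8 h9 using fun n => hC.exists_contraction
    (S (n - 1) n (by ring)) (S n (n + 1) rfl) (hc (n - 1) n (by ring))
  obtain ⟨k', e1, e2⟩ : ∃ k' : ∀ n m, A.seq.X n ⟶ A.seq.X m, (∀ n, k' n (n - 1) = k n) ∧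
      ∀ n m, m ≠ n - 1 → k' n m = 0 :=
    ⟨fun n m => if h : m = n - 1 then k n ≫ eqToHom (congrArg A.seq.X h.symm) else 0,
      fun n => by simp, fun n m h => dif_neg h⟩
  refine ⟨⟨H, A.seq.finite.subset fun n hn hz => hn (by
    rw [IsZero.iff_id_eq_zero, ← h4, hz.eq_of_tgt (i n) 0, zero_comp])⟩, i, p, k', h1, h2, fun n m => ?_, e2, h4, h5, h6, h7, fun n => ?_⟩
  · by_cases h : m = n - 1
    · subst h
      rw [e1]
      exact h3 n
    · rw [e2 n m h]
      exact Submodule.zero_mem _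
  · have key : ∀ m n (h : n = m + 1), A.δ m n ≫ k' n m = (S m n h).π ≫ (S m n h).s := by
      intro m n h
      obtain rfl : m = n - 1 := by omega
      rw [e1]
      exact h9 n
    rw [key n (n + 1) rfl, e1]
    exact h8 n

/-- In a split category every twisted complex is homotopy equivalent to a minimal one. -/
lemma IsSplitCDG.exists_isMinimal (hC : IsSplitCDG K C) (A : Tw K C) :
    ∃ A' : Tw K C, A'.IsMinimal ∧ HomotopyEquivalent K A A' := by
  obtain ⟨H, i, p, k, hi, hp, hk, hk', hip, hid, hdp, hip', hc⟩ :=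
    hC.exists_termwise_contraction A
  -- The leading part of the differential, of internal degree 1; the rest of `δ` has internal degree
  -- at most -1.
  let d : A.seq ⟶ A.seq := fun m n => if n = m + 1 then A.δ m n else 0
  let h : A.seq ⟶ A.seq := k
  have hd : A.δ - d ∈ fil A.seq A.seq (-1) := fun m n hmn => by
    rw [BddSeq.sub_apply]
    by_cases h1 : n = m + 1
    · exact (congrArg (fun z => A.δ m n - z) (if_pos h1)).trans (sub_self _)
    · refine (congrArg (fun z => A.δ m n - z) (if_neg h1)).trans ?_
      rw [sub_zero]
      by_cases h2 : m = n
      · subst h2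
        exact A.isTwisted.internal_zero m
      · exact A.δ_mem_fil m n (by omega)
  have hhg : h ∈ gr (K := K) A.seq A.seq (-1) := fun m n => by
    by_cases h1 : n = m - 1
    · subst h1
      rw [show (-1 : ℤ) - (m - 1 - m) = 0 by ring]
      exact hk m (m - 1)
    · rw [show h m n = 0 from hk' m n h1]
      exact Submodule.zero_mem _
  have hhm : h ∈ fil A.seq A.seq (-1) := fun m n hmn => hk' m n (by omega)
  refine Tw.exists_isMinimal_of_contraction (A := A) (H := H) (i := diagHom i) (p := diagHom p)
    (d := d) (u := Tw.diff A A h) (diagHom_mem hi) (diagHom_mem hp) ?_ hd ?_ ?_ ?_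
    ⟨h, hhg, rfl⟩ ?_
  · rw [diagHom_comp_diagHom hi]
    exact congrArg diagHom (funext hip)
  · ext m n
    rw [diagHom_comp hi]
    by_cases h1 : n = m + 1
    · subst h1
      exact (congrArg (fun z => i m ≫ z) (if_pos rfl)).trans (hid m)
    · exact (congrArg (fun z => i m ≫ z) (if_neg h1)).trans comp_zero
  · ext m n
    rw [comp_diagHom]
    by_cases h1 : n = m + 1
    · obtain rfl : m = n - 1 := by omega
      exact (congrArg (fun z => z ≫ p n) (if_pos h1)).trans (hdp n)
    · exact (congrArg (fun z => z ≫ p n) (if_neg h1)).trans zero_comp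
  · ext m n
    rw [nabla_diagHom, comp_diagHom]
    by_cases h1 : m = n
    · subst h1
      rw [diagHom_self]
      exact hip' m
    · rw [diagHom_ne _ h1]
      exact zero_comp
  · have h1 : h ≫ A.δ ∈ fil A.seq A.seq 0 := comp_mem_fil hhm A.δ_mem_fil
    have h2 : A.δ ≫ h ∈ fil A.seq A.seq 0 := comp_mem_fil A.δ_mem_fil hhm
    -- As `h` has odd total degree, its differential contains the anticommutator with `δ`. The term
    -- `∇h` has internal degree -1, and on the diagonal only the leading part of `δ` contributes, so
    -- the contraction identity applies.
    have h3 : Tw.diff A A h = nabla (K := K) h + (h ≫ A.δ + A.δ ≫ h) := by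
      rw [Tw.diff_apply, twist_of_mem 1 hhg]
      simp [add_assoc]
    have h4 : diagHom p ≫ diagHom i ∈ fil A.seq A.seq 0 :=
      comp_mem_fil (diagHom_mem_fil p) (diagHom_mem_fil i)
    have h5 := Submodule.sub_mem _ (Submodule.add_mem _ h1 h2)
      (Submodule.sub_mem _ (id_mem_fil A.seq) h4)
    rw [h3, add_sub_assoc]
    refine Submodule.add_mem _ (nabla_mem_fil hhm) fun m n hmn => ?_
    by_cases hm : m = n
    · subst hm
      have e1 : (h ≫ A.δ) m m = k m (m - 1) ≫ A.δ (m - 1) m := by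
        rw [BddSeq.comp_apply, sum_eq_single_supp _ (m - 1)]
        · rw [twist_of_mem _ (hk m (m - 1)), mul_zero, Int.negOnePow_zero, one_smul]
        · intro q hq
          rw [show h m q = 0 from hk' m q hq, map_zero, zero_comp]
        · intro hz
          rw [hz.eq_of_src (A.δ (m - 1) m) 0, comp_zero]
      have e2 : (A.δ ≫ h) m m = A.δ m (m + 1) ≫ k (m + 1) m :=
        A.comp_apply_succ (fun q hq => Or.inr (hk' q m (by omega))) (A.δ_mem_gr_zero m)
      rw [BddSeq.sub_apply, BddSeq.add_apply, BddSeq.sub_apply, e1, e2, comp_diagHom, diagHom_self,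
        BddSeq.id_eq, diag_self, ← hc m]
      abel
    · exact h5 m n (by omega)

end MinimalModel

/-! ### The main theorem. -/

theorem mainTheorem1 {K : Type w} [CommRing K]
    {C : Type u₁} [Category.{v₁} C] [Preadditive C] [Linear K C] [CDGCategory K C]
    {D : Type u₂} [Category.{v₂} D] [Preadditive D] [Linear K D] [CDGCategory K D]
    (F : AInftyFunctor K C D) (hF : F.IsProper)
    (hC : SufficientlyMaurerCartan K C) (hD : SufficientlyMaurerCartan K D)
    (hC' : IsSplitCDG K C) (hD' : IsSplitCDG K D)
    (hF₀ : F.uncurved.IsQuasiEquivalence K) :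
    ∃ h : ∀ A : Tw K C, IsTwistedDifferential (F.mapSeq A.seq) (F.twDelta A),
      (F.twData h).IsAInfty K ∧ (F.twData h).IsQuasiEquivalence K := by
  -- Quasi-full faithfulness is homotopy invariant in both arguments, so both may be replaced by
  -- minimal models.
  have key : ∀ A B : Tw K C, (F.twData hF.isTwisted_twDelta).IsQuasiIsoOn K A B := fun A B => by
    obtain ⟨A', hA', hA⟩ := hC'.exists_isMinimal A
    obtain ⟨B', hB', hB⟩ := hC'.exists_isMinimal B
    exact AInftyData.IsAInfty.isQuasiIsoOn_of_homotopyEquivalent (fun _ => rfl) hF.isAInfty_twData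
      hA hB (hF.isQuasiIsoOn_of_isMinimal hF₀.quasiFullyFaithful hA' hB')
  refine ⟨hF.isTwisted_twDelta, hF.isAInfty_twData,
    ⟨fun A B => (key A B).injective, fun A B => (key A B).surjective⟩, fun Y => ?_⟩
  obtain ⟨Y', hY', hY⟩ := hD'.exists_isMinimal Y
  obtain ⟨X, hX⟩ := hF.exists_homotopyEquivalent_of_isMinimal hF₀.quasiFullyFaithful
    hF₀.quasiEssSurj hY'
  exact ⟨X, hX.trans hY.symm⟩
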